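/- **Theorem 5.15.** *Conventions.* A model category is a bicomplete category $\mathsf M$ with classes $\mathcal F,\mathcal C,\mathcal W$ (fibrations, cofibrations, weak equivalences) such that $\mathcal W$ contains the identities and satisfies 2-out-of-3, and $(\mathcal C,\mathcal F\cap\mathcal W)$ and $(\mathcal C\cap\mathcal W,\mathcal F)$ are weak factorization systems. It is *fibrantly generated* by a pair $(\mathcal X,\mathcal Z)$ of classes of morphisms if $\mathcal C\cap\mathcal W$ (respectively $\mathcal C$) is exactly the class of morphisms with the left lifting property with respect to $\mathcal X$ (respectively $\mathcal Z$). For a small category $\mathsf D$, the *injective model structure* on $\mathsf M^{\mathsf D}$, if it exists, is the model structure whose cofibrations and weak equivalences are determined objectwise. A *generalized Reedy category* is a small category $\mathsf R$ with a degree function $\deg\colon \operatorname{Ob}\mathsf R\to\mathbb N$ and wide subcategories $\mathsf R^+,\mathsf R^-$ such that: non-invertible morphisms of $\mathsf R^+$ (respectively $\mathsf R^-$) strictly raise (respectively lower) degree; isomorphisms preserve degree; $\mathsf R^+\cap\mathsf R^-=\mathrm{Iso}(\mathsf R)$; every morphism factors, uniquely up to isomorphism, as a morphism in $\mathsf R^-$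 followed by a morphism in $\mathsf R^+$; and if $\theta f=f$ with $\theta\in\mathrm{Iso}(\mathsf R)$, $f\in\mathsf R^-$, then $\theta$ is an identity. It is *dualizable* if moreover $f\theta=f$ with $\theta\in\mathrm{Iso}(\mathsf R)$, $f\in\mathsf R^+$ implies that $\theta$ is an identity. A model category $\mathsf M$ is *$\mathsf R$-injective* if $\mathsf M^{\mathrm{Aut}(r)}$ admits the injective model structure for every object $r$ of $\mathsf R$. For $\Phi\in\mathsf M^{\mathsf R}$, the latching object $L_r\Phi$ is the colimit of $\Phi$ over the category of morphisms $s\to r$ in $\mathsf R^+$ with $\deg s<\deg r$ (with morphisms in $\mathsf R^+$ over $r$), and the matching object $M_r\Phi$ is the limit of $\Phi$ over the category of morphisms $r\to s$ in $\mathsf R^-$ with $\deg s<\deg r$ (with morphisms in $\mathsf R^-$ under $r$); both carry the evident action of $\mathrm{Aut}(r)$. For $\tau\colon\Phi\to\Psi$ there are $\mathrm{Aut}(r)$-equivariant maps $$\ell_r(\tau)\colon \Phi(r)\sqcup_{L_r\Phi}L_r\Psi\to\Psi(r),\qquad m_r(\tau)\colon\Phi(r)\to M_r\Phi\times_{M_r\Psi}\Psi(r).$$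 For $E\in\mathsf M$ and $S\colon\mathsf R^{\mathrm{op}}\to\mathsf{Set}$ let $E\pitchfork S\in\mathsf M^{\mathsf R}$ be $d\mapsto\prod_{S(d)}E$. Let $\kappa^r\colon\partial\mathsf R(-,r)\hookrightarrow\mathsf R(-,r)$ be the subfunctor of all morphisms with codomain $r$ that factor through an object of degree less than $\deg(r)$. For $p\colon E\to B$ in $\mathsf M$ let $$p\,\widehat\pitchfork\,\kappa^r\colon E\pitchfork\mathsf R(-,r)\to \bigl(E\pitchfork\partial\mathsf R(-,r)\bigr)\times_{B\pitchfork\partial\mathsf R(-,r)}\bigl(B\pitchfork\mathsf R(-,r)\bigr)$$ be the induced map, and for a class $\mathcal X$ of morphisms of $\mathsf M$ let $\mathcal X\widehat\pitchfork\mathsf R=\{p\,\widehat\pitchfork\,\kappa^r\mid p\in\mathcal X,\ r\in\operatorname{Ob}\mathsf R\}$. *Statement.* Let $\mathsf R$ be a dualizable generalized Reedy category and let $\mathsf M$ be an $\mathsf R$-injective model category that is fibrantly generated by a pair $(\mathcal X,\mathcal Z)$ of classes of morphisms. Then there is a model structure on $\mathsf M^{\mathsf R}$ in which a map $\tau\colon\Phi\to\Psi$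 is - a weak equivalence if and only if, for every $r$, $\tau_r\colon\Phi(r)\to\Psi(r)$ is a weak equivalence in the injective model structure on $\mathsf M^{\mathrm{Aut}(r)}$; - a cofibration if and only if, for every $r$, $\ell_r(\tau)$ is a cofibration in the injective model structure on $\mathsf M^{\mathrm{Aut}(r)}$; - a fibration if and only if, for every $r$, $m_r(\tau)$ is a fibration in the injective model structure on $\mathsf M^{\mathrm{Aut}(r)}$; and this model structure is fibrantly generated by $(\mathcal X\widehat\pitchfork\mathsf R,\ \mathcal Z\widehat\pitchfork\mathsf R)$. -/

import Mathlib

open CategoryTheory Limits HomotopicalAlgebra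

universe w v u w'

namespace GenReedy

/-! ### Fibrant generation and injective model structures -/

/-- A model category is fibrantly generated by a pair `(X, Z)` of classes of morphisms if the
weak factorization systems (acyclic cofibrations, fibrations) and
(cofibrations, acyclic fibrations) are fibrantly generated by `X` and `Z` respectively, i.e. if
their left classes are the classes of morphisms having the left lifting property with respect
to `X` and `Z`. -/
structure IsFibrantlyGenerated (C : Type u) [Category.{v} C] [ModelCategory C]
    (X Z : MorphismProperty C) : Prop where
  trivialCofibrations_eq : trivialCofibrations C = X.llp
  cofibrations_eq : cofibrations C = Z.llp

section Injective

variable (D : Type w) [Category.{w'} D] (M : Type u) [Category.{v} M] [ModelCategory M]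

/-- A model structure on `D ⥤ M` is the injective one if its weak equivalences and its
cofibrations are determined objectwise. -/
structure IsInjectiveModelStructure [ModelCategory (D ⥤ M)] : Prop where
  weakEquivalences_eq :
    weakEquivalences (D ⥤ M) = (weakEquivalences M).functorCategory D
  cofibrations_eq :
    cofibrations (D ⥤ M) = (cofibrations M).functorCategory D

/-- `D ⥤ M` admits the injective model structure. -/
def AdmitsInjectiveModelStructure : Prop :=
  ∃ _ : ModelCategory (D ⥤ M), IsInjectiveModelStructure D M

/-- The injective fibrations: the morphisms of `D ⥤ M` having the right lifting property with
respect to the objectwise acyclic cofibrations. When the injective model structure exists, these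
are its fibrations, see `IsInjectiveModelStructure.fibrations_eq`. -/
def injectiveFibrations : MorphismProperty (D ⥤ M) :=
  ((trivialCofibrations M).functorCategory D).rlp

variable {D M} in
lemma IsInjectiveModelStructure.fibrations_eq [ModelCategory (D ⥤ M)]
    (h : IsInjectiveModelStructure D M) :
    fibrations (D ⥤ M) = injectiveFibrations D M := by
  have e : trivialCofibrations (D ⥤ M) = (trivialCofibrations M).functorCategory D := by
    ext A B f
    simp only [trivialCofibrations, h.weakEquivalences_eq, h.cofibrations_eq]
    exact ⟨fun hf d ↦ ⟨hf.1 d, hf.2 d⟩, fun hf ↦ ⟨fun d ↦ (hf d).1, fun d ↦ (hf d).2⟩⟩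
  rw [injectiveFibrations, ← e,
    MorphismProperty.rlp_eq_of_wfs (trivialCofibrations (D ⥤ M)) (fibrations (D ⥤ M))]

end Injective

/-! ### Restriction to automorphism groups, and powers -/

section Power

variable {R : Type w} [SmallCategory.{w} R] {M : Type u} [Category.{v} M]

/-- The inclusion in `R` of the one-object category given by the group of automorphisms
of `r`. -/
abbrev autInclusion (r : R) : SingleObj (Aut r) ⥤ R where
  obj _ := r
  map e := Iso.hom e
  map_id _ := rfl
  map_comp _ _ := rfl

/-- The restriction of a diagram to `Aut r`, i.e. its value at `r` with the action of `Aut r`. -/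
abbrev restrictAut (r : R) : (R ⥤ M) ⥤ (SingleObj (Aut r) ⥤ M) :=
  (Functor.whiskeringLeft _ _ M).obj (autInclusion r)

variable [HasLimitsOfSize.{w, w} M]

/-- The power `E ⋔ S` of an object `E` of `M` by a presheaf of sets `S`: it sends `d` to the
product of copies of `E` indexed by `S(d)`. -/
noncomputable abbrev power (E : M) (S : Rᵒᵖ ⥤ Type w) : R ⥤ M where
  obj d := ∏ᶜ fun _ : S.obj (Opposite.op d) ↦ E
  map f := Pi.lift fun x ↦ Pi.π (fun _ ↦ E) (S.map f.op x)
  map_id d := by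
    ext x
    simp
  map_comp f g := by
    ext x
    simp

/-- The functoriality of the power in the object of `M`. -/
noncomputable def powerMap {E B : M} (p : E ⟶ B) (S : Rᵒᵖ ⥤ Type w) : power E S ⟶ power B S where
  app d := Limits.Pi.map fun _ ↦ p
  naturality d d' f := by
    dsimp only [power]
    ext x
    simp

/-- The functoriality of the power in the presheaf. -/
noncomputable def powerRestrict (E : M) {S T : Rᵒᵖ ⥤ Type w} (α : S ⟶ T) :
    power E T ⟶ power E S where
  app d := Pi.lift fun x ↦ Pi.π (fun _ ↦ E) (α.app (Opposite.op d) x)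
  naturality d d' f := by
    dsimp only [power]
    ext x
    simp [NatTrans.naturality_apply]

lemma power_bifunctorial {E B : M} (p : E ⟶ B) {S T : Rᵒᵖ ⥤ Type w} (α : S ⟶ T) :
    powerRestrict E α ≫ powerMap p S = powerMap p T ≫ powerRestrict B α := by
  ext d
  dsimp only [powerRestrict, powerMap, power, NatTrans.comp_app]
  simp

end Power

/-! ### Generalized Reedy categories -/

/-- The structure of a generalized Reedy category on a small category `R`. The wide
subcategories are given by the classes `plus` and `minus` of their morphisms. -/
structure GeneralizedReedyStructure (R : Type w) [SmallCategory.{w} R] where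
  /-- the degree function -/
  deg : R → ℕ
  /-- the morphisms of the wide subcategory `R⁺` -/
  plus : MorphismProperty R
  /-- the morphisms of the wide subcategory `R⁻` -/
  minus : MorphismProperty R
  plus_isMultiplicative : plus.IsMultiplicative
  minus_isMultiplicative : minus.IsMultiplicative
  deg_lt_of_plus {a b : R} (f : a ⟶ b) (hf : plus f) (hf' : ¬ IsIso f) : deg a < deg b
  deg_lt_of_minus {a b : R} (f : a ⟶ b) (hf : minus f) (hf' : ¬ IsIso f) : deg b < deg a
  deg_eq_of_iso {a b : R} (e : a ≅ b) : deg a = deg b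
  plus_and_minus_iff {a b : R} (f : a ⟶ b) : (plus f ∧ minus f) ↔ IsIso f
  exists_factorization {a b : R} (f : a ⟶ b) :
    ∃ (c : R) (h : a ⟶ c) (g : c ⟶ b), minus h ∧ plus g ∧ h ≫ g = f
  factorization_unique {a b c c' : R} (h : a ⟶ c) (g : c ⟶ b) (h' : a ⟶ c') (g' : c' ⟶ b)
    (hh : minus h) (hg : plus g) (hh' : minus h') (hg' : plus g') (fac : h ≫ g = h' ≫ g') :
    ∃ e : c ≅ c', h ≫ e.hom = h' ∧ e.hom ≫ g' = g
  eq_id_of_minus {a b : R} (f : a ⟶ b) (hf : minus f) (e : b ≅ b) (he : f ≫ e.hom = f) :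
    e = Iso.refl b

namespace GeneralizedReedyStructure

variable {R : Type w} [SmallCategory.{w} R] (G : GeneralizedReedyStructure R)

/-- The additional axiom defining dualizable generalized Reedy categories. -/
def IsDualizable : Prop :=
  ∀ ⦃a b : R⦄ (f : a ⟶ b) (_ : G.plus f) (e : a ≅ a), e.hom ≫ f = f → e = Iso.refl a

instance : G.plus.IsMultiplicative := G.plus_isMultiplicative

instance : G.minus.IsMultiplicative := G.minus_isMultiplicative

lemma plus_hom {a b : R} (e : a ≅ b) : G.plus e.hom :=
  ((G.plus_and_minus_iff e.hom).2 inferInstance).1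

lemma minus_hom {a b : R} (e : a ≅ b) : G.minus e.hom :=
  ((G.plus_and_minus_iff e.hom).2 inferInstance).2

/-! ### Latching objects -/

/-- The objects of the category indexing the `r`-th latching object: morphisms `s ⟶ r` in `R⁺`
with `deg s < deg r`. -/
structure LatchingIndex (r : R) where
  /-- the source of the morphism -/
  left : R
  /-- the morphism to `r` -/
  hom : left ⟶ r
  plus_hom : G.plus hom
  deg_lt : G.deg left < G.deg r

variable {G} in
/-- Morphisms in the latching category: morphisms of `R⁺` over `r`. -/
@[ext]
structure LatchingIndex.Hom {r : R} (i j : G.LatchingIndex r) where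
  /-- the underlying morphism in `R` -/
  hom : i.left ⟶ j.left
  plus_hom : G.plus hom
  w : hom ≫ j.hom = i.hom

instance (r : R) : Category.{w} (G.LatchingIndex r) where
  Hom i j := LatchingIndex.Hom i j
  id i := ⟨𝟙 _, G.plus.id_mem _, by simp⟩
  comp f g := ⟨f.hom ≫ g.hom, G.plus.comp_mem _ _ f.plus_hom g.plus_hom, by
    rw [Category.assoc, g.w, f.w]⟩
  id_comp _ := LatchingIndex.Hom.ext (Category.id_comp _)
  comp_id _ := LatchingIndex.Hom.ext (Category.comp_id _)
  assoc _ _ _ := LatchingIndex.Hom.ext (Category.assoc _ _ _)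

/-- The forgetful functor from the latching category to `R`. -/
abbrev latchingForget (r : R) : G.LatchingIndex r ⥤ R where
  obj i := i.left
  map f := f.hom
  map_id _ := rfl
  map_comp _ _ := rfl

variable {G} in
/-- Automorphisms of `r` act on the latching category by postcomposition. -/
abbrev LatchingIndex.postcomp {r : R} (i : G.LatchingIndex r) (e : Aut r) : G.LatchingIndex r where
  left := i.left
  hom := i.hom ≫ e.hom
  plus_hom := G.plus.comp_mem _ _ i.plus_hom (G.plus_hom e)
  deg_lt := i.deg_lt

/-! ### Matching objects -/

/-- The objects of the category indexing the `r`-th matching object: morphisms `r ⟶ s` in `R⁻`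
with `deg s < deg r`. -/
structure MatchingIndex (r : R) where
  /-- the target of the morphism -/
  right : R
  /-- the morphism from `r` -/
  hom : r ⟶ right
  minus_hom : G.minus hom
  deg_lt : G.deg right < G.deg r

variable {G} in
/-- Morphisms in the matching category: morphisms of `R⁻` under `r`. -/
@[ext]
structure MatchingIndex.Hom {r : R} (i j : G.MatchingIndex r) where
  /-- the underlying morphism in `R` -/
  hom : i.right ⟶ j.right
  minus_hom : G.minus hom
  w : i.hom ≫ hom = j.hom

instance (r : R) : Category.{w} (G.MatchingIndex r) where
  Hom i j := MatchingIndex.Hom i j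
  id i := ⟨𝟙 _, G.minus.id_mem _, by simp⟩
  comp f g := ⟨f.hom ≫ g.hom, G.minus.comp_mem _ _ f.minus_hom g.minus_hom, by
    rw [← Category.assoc, f.w, g.w]⟩
  id_comp _ := MatchingIndex.Hom.ext (Category.id_comp _)
  comp_id _ := MatchingIndex.Hom.ext (Category.comp_id _)
  assoc _ _ _ := MatchingIndex.Hom.ext (Category.assoc _ _ _)

/-- The forgetful functor from the matching category to `R`. -/
abbrev matchingForget (r : R) : G.MatchingIndex r ⥤ R where
  obj i := i.right
  map f := f.hom
  map_id _ := rfl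
  map_comp _ _ := rfl

variable {G} in
/-- Automorphisms of `r` act on the matching category by precomposition. -/
abbrev MatchingIndex.precomp {r : R} (i : G.MatchingIndex r) (e : Aut r) : G.MatchingIndex r where
  right := i.right
  hom := e.hom ≫ i.hom
  minus_hom := G.minus.comp_mem _ _ (G.minus_hom e) i.minus_hom
  deg_lt := i.deg_lt

/-! ### Relative latching and matching maps -/

variable {M : Type u} [Category.{v} M]

section Latching

variable [HasColimitsOfSize.{w, w} M]

/-- The `r`-th latching object of `Φ`. -/
noncomputable def latchingObj (r : R) (Φ : R ⥤ M) : M :=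
  colimit (G.latchingForget r ⋙ Φ)

/-- The canonical morphism from the summand indexed by `i` to the latching object. -/
noncomputable def latchingι (r : R) (Φ : R ⥤ M) (i : G.LatchingIndex r) :
    Φ.obj i.left ⟶ G.latchingObj r Φ :=
  colimit.ι (G.latchingForget r ⋙ Φ) i

lemma latchingι_w (r : R) (Φ : R ⥤ M) {i j : G.LatchingIndex r} (f : i ⟶ j) :
    Φ.map f.hom ≫ G.latchingι r Φ j = G.latchingι r Φ i :=
  colimit.w (G.latchingForget r ⋙ Φ) f

variable {G} in
lemma latchingObj_hom_ext {r : R} {Φ : R ⥤ M} {A : M} {f g : G.latchingObj r Φ ⟶ A}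
    (h : ∀ i, G.latchingι r Φ i ≫ f = G.latchingι r Φ i ≫ g) : f = g :=
  colimit.hom_ext h

/-- The universal property of the latching object. -/
noncomputable def latchingDesc (r : R) (Φ : R ⥤ M) {A : M}
    (φ : ∀ i : G.LatchingIndex r, Φ.obj i.left ⟶ A)
    (hφ : ∀ (i j : G.LatchingIndex r) (f : i ⟶ j), Φ.map f.hom ≫ φ j = φ i) :
    G.latchingObj r Φ ⟶ A :=
  colimit.desc (G.latchingForget r ⋙ Φ)
    { pt := A
      ι := { app := φ, naturality := fun _ _ f ↦ (hφ _ _ f).trans (Category.comp_id _).symm } }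

lemma latchingι_desc (r : R) (Φ : R ⥤ M) {A : M}
    (φ : ∀ i : G.LatchingIndex r, Φ.obj i.left ⟶ A)
    (hφ : ∀ (i j : G.LatchingIndex r) (f : i ⟶ j), Φ.map f.hom ≫ φ j = φ i)
    (i : G.LatchingIndex r) :
    G.latchingι r Φ i ≫ G.latchingDesc r Φ φ hφ = φ i :=
  colimit.ι_desc _ _

/-- The action of an automorphism of `r` on the latching object: it sends the summand indexed by
`u : s ⟶ r` identically to the summand indexed by `u ≫ e.hom`. -/
noncomputable def latchingAct (r : R) (Φ : R ⥤ M) (e : Aut r) :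
    G.latchingObj r Φ ⟶ G.latchingObj r Φ :=
  G.latchingDesc r Φ (fun i ↦ G.latchingι r Φ (i.postcomp e)) (fun i j f ↦
    G.latchingι_w r Φ (i := i.postcomp e) (j := j.postcomp e)
      ⟨f.hom, f.plus_hom, by simp [LatchingIndex.postcomp, ← f.w]⟩)

/-- The map of latching objects induced by a natural transformation. -/
noncomputable def latchingObjMap (r : R) {Φ Ψ : R ⥤ M} (τ : Φ ⟶ Ψ) :
    G.latchingObj r Φ ⟶ G.latchingObj r Ψ :=
  G.latchingDesc r Φ (fun i ↦ τ.app i.left ≫ G.latchingι r Ψ i) (fun i j f ↦ by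
    rw [← Category.assoc, τ.naturality, Category.assoc, latchingι_w])

lemma latchingι_act (r : R) (Φ : R ⥤ M) (e : Aut r) (i : G.LatchingIndex r) :
    G.latchingι r Φ i ≫ G.latchingAct r Φ e = G.latchingι r Φ (i.postcomp e) :=
  G.latchingι_desc ..

lemma latchingι_map (r : R) {Φ Ψ : R ⥤ M} (τ : Φ ⟶ Ψ) (i : G.LatchingIndex r) :
    G.latchingι r Φ i ≫ G.latchingObjMap r τ = τ.app i.left ≫ G.latchingι r Ψ i :=
  G.latchingι_desc ..

lemma latchingAct_one (r : R) (Φ : R ⥤ M) : G.latchingAct r Φ 1 = 𝟙 _ :=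
  latchingObj_hom_ext fun i ↦ by
    rw [latchingι_act, Category.comp_id]
    have := G.latchingι_w r Φ (i := i.postcomp 1) (j := i)
      ⟨𝟙 i.left, G.plus.id_mem _, (Category.id_comp _).trans (Category.comp_id _).symm⟩
    rw [← this]
    exact (congrArg (· ≫ _) (Φ.map_id _)).trans (Category.id_comp _)

lemma latchingAct_mul (r : R) (Φ : R ⥤ M) (e e' : Aut r) :
    G.latchingAct r Φ (e' * e) = G.latchingAct r Φ e ≫ G.latchingAct r Φ e' :=
  latchingObj_hom_ext fun i ↦ by
    rw [latchingι_act, ← Category.assoc, latchingι_act, latchingι_act]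
    have := G.latchingι_w r Φ (i := i.postcomp (e' * e)) (j := (i.postcomp e).postcomp e')
      ⟨𝟙 i.left, G.plus.id_mem _, (Category.id_comp _).trans (Category.assoc _ _ _)⟩
    rw [← this]
    exact (congrArg (· ≫ _) (Φ.map_id _)).trans (Category.id_comp _)

/-- The `r`-th latching object, as a functor with values in objects of `M` with an action of
`Aut r`. -/
noncomputable def latchingFunctor (r : R) : (R ⥤ M) ⥤ (SingleObj (Aut r) ⥤ M) where
  obj Φ :=
    { obj _ := G.latchingObj r Φ
      map e := G.latchingAct r Φ e
      map_id _ := G.latchingAct_one r Φ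
      map_comp e e' := G.latchingAct_mul r Φ e e' }
  map {Φ Ψ} τ :=
    { app _ := G.latchingObjMap r τ
      naturality _ _ e := latchingObj_hom_ext fun i ↦ by
        dsimp only
        rw [← Category.assoc, latchingι_act, latchingι_map, ← Category.assoc, latchingι_map,
          Category.assoc, latchingι_act] }
  map_id Φ := by
    ext
    exact latchingObj_hom_ext fun i ↦ (G.latchingι_map r (𝟙 Φ) i).trans
      ((Category.id_comp _).trans (Category.comp_id _).symm)
  map_comp {Φ Ψ Ξ} τ τ' := by
    ext
    refine latchingObj_hom_ext fun i ↦ (G.latchingι_map r (τ ≫ τ') i).trans ?_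
    change _ = _ ≫ G.latchingObjMap r τ ≫ G.latchingObjMap r τ'
    rw [← Category.assoc (G.latchingι r Φ i), latchingι_map, Category.assoc, latchingι_map,
      NatTrans.comp_app, Category.assoc]

/-- The canonical `Aut r`-equivariant map from the latching object of `Φ` to `Φ.obj r`. -/
noncomputable def latchingMap (r : R) :
    G.latchingFunctor r ⟶ restrictAut (M := M) r where
  app Φ :=
    { app _ := G.latchingDesc r Φ (fun i ↦ Φ.map i.hom) (fun _ _ f ↦ by rw [← Φ.map_comp, f.w])
      naturality _ _ e := latchingObj_hom_ext fun i ↦ by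
        change _ ≫ G.latchingAct r Φ e ≫ _ = _ ≫ _ ≫ Φ.map (Iso.hom e)
        rw [← Category.assoc, latchingι_act, latchingι_desc, ← Category.assoc, latchingι_desc,
          ← Φ.map_comp] }
  naturality Φ Ψ τ := by
    ext
    refine latchingObj_hom_ext fun i ↦ ?_
    change _ ≫ G.latchingObjMap r τ ≫ _ = _ ≫ _ ≫ τ.app r
    rw [← Category.assoc, latchingι_map, Category.assoc, latchingι_desc, ← Category.assoc,
      latchingι_desc, τ.naturality]

/-- The relative latching map `Φ(r) ⊔_{L_r Φ} L_r Ψ ⟶ Ψ(r)` of `τ : Φ ⟶ Ψ`, as a morphism of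
`Aut r`-objects in `M`. -/
noncomputable def relativeLatchingMap [HasPushouts M] (r : R) {Φ Ψ : R ⥤ M} (τ : Φ ⟶ Ψ) :
    pushout ((G.latchingMap r).app Φ) ((G.latchingFunctor r).map τ) ⟶ (restrictAut r).obj Ψ :=
  pushout.desc ((restrictAut r).map τ) ((G.latchingMap r).app Ψ)
    ((G.latchingMap r).naturality τ).symm

end Latching

section Matching

variable [HasLimitsOfSize.{w, w} M]

/-- The `r`-th matching object of `Φ`. -/
noncomputable def matchingObj (r : R) (Φ : R ⥤ M) : M :=
  limit (G.matchingForget r ⋙ Φ)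

/-- The canonical projection of the matching object to the factor indexed by `i`. -/
noncomputable def matchingπ (r : R) (Φ : R ⥤ M) (i : G.MatchingIndex r) :
    G.matchingObj r Φ ⟶ Φ.obj i.right :=
  limit.π (G.matchingForget r ⋙ Φ) i

lemma matchingπ_w (r : R) (Φ : R ⥤ M) {i j : G.MatchingIndex r} (f : i ⟶ j) :
    G.matchingπ r Φ i ≫ Φ.map f.hom = G.matchingπ r Φ j :=
  limit.w (G.matchingForget r ⋙ Φ) f

variable {G} in
lemma matchingObj_hom_ext {r : R} {Φ : R ⥤ M} {A : M} {f g : A ⟶ G.matchingObj r Φ}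
    (h : ∀ i, f ≫ G.matchingπ r Φ i = g ≫ G.matchingπ r Φ i) : f = g :=
  limit.hom_ext h

/-- The universal property of the matching object. -/
noncomputable def matchingLift (r : R) (Φ : R ⥤ M) {A : M}
    (φ : ∀ i : G.MatchingIndex r, A ⟶ Φ.obj i.right)
    (hφ : ∀ (i j : G.MatchingIndex r) (f : i ⟶ j), φ i ≫ Φ.map f.hom = φ j) :
    A ⟶ G.matchingObj r Φ :=
  limit.lift (G.matchingForget r ⋙ Φ)
    { pt := A
      π := { app := φ, naturality := fun _ _ f ↦ (Category.id_comp _).trans (hφ _ _ f).symm } }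

lemma matchingLift_π (r : R) (Φ : R ⥤ M) {A : M}
    (φ : ∀ i : G.MatchingIndex r, A ⟶ Φ.obj i.right)
    (hφ : ∀ (i j : G.MatchingIndex r) (f : i ⟶ j), φ i ≫ Φ.map f.hom = φ j)
    (i : G.MatchingIndex r) :
    G.matchingLift r Φ φ hφ ≫ G.matchingπ r Φ i = φ i :=
  limit.lift_π _ _

/-- The action of an automorphism of `r` on the matching object: its component indexed by
`u : r ⟶ s` is the projection indexed by `e.hom ≫ u`. -/
noncomputable def matchingAct (r : R) (Φ : R ⥤ M) (e : Aut r) :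
    G.matchingObj r Φ ⟶ G.matchingObj r Φ :=
  G.matchingLift r Φ (fun i ↦ G.matchingπ r Φ (i.precomp e)) (fun i j f ↦
    G.matchingπ_w r Φ (i := i.precomp e) (j := j.precomp e)
      ⟨f.hom, f.minus_hom, by simp [MatchingIndex.precomp, ← f.w]⟩)

/-- The map of matching objects induced by a natural transformation. -/
noncomputable def matchingObjMap (r : R) {Φ Ψ : R ⥤ M} (τ : Φ ⟶ Ψ) :
    G.matchingObj r Φ ⟶ G.matchingObj r Ψ :=
  G.matchingLift r Ψ (fun i ↦ G.matchingπ r Φ i ≫ τ.app i.right) (fun i j f ↦ by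
    rw [Category.assoc, ← τ.naturality, ← Category.assoc, matchingπ_w])

lemma matchingAct_π (r : R) (Φ : R ⥤ M) (e : Aut r) (i : G.MatchingIndex r) :
    G.matchingAct r Φ e ≫ G.matchingπ r Φ i = G.matchingπ r Φ (i.precomp e) :=
  G.matchingLift_π ..

lemma matchingMap_π (r : R) {Φ Ψ : R ⥤ M} (τ : Φ ⟶ Ψ) (i : G.MatchingIndex r) :
    G.matchingObjMap r τ ≫ G.matchingπ r Ψ i = G.matchingπ r Φ i ≫ τ.app i.right :=
  G.matchingLift_π ..

lemma matchingAct_one (r : R) (Φ : R ⥤ M) : G.matchingAct r Φ 1 = 𝟙 _ :=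
  matchingObj_hom_ext fun i ↦ by
    rw [matchingAct_π, Category.id_comp]
    have := G.matchingπ_w r Φ (i := i) (j := i.precomp 1)
      ⟨𝟙 i.right, G.minus.id_mem _, (Category.comp_id _).trans (Category.id_comp _).symm⟩
    rw [← this]
    exact (congrArg (_ ≫ ·) (Φ.map_id _)).trans (Category.comp_id _)

lemma matchingAct_mul (r : R) (Φ : R ⥤ M) (e e' : Aut r) :
    G.matchingAct r Φ (e' * e) = G.matchingAct r Φ e ≫ G.matchingAct r Φ e' :=
  matchingObj_hom_ext fun i ↦ by
    rw [matchingAct_π, Category.assoc, matchingAct_π, matchingAct_π]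
    have := G.matchingπ_w r Φ (i := i.precomp (e' * e)) (j := (i.precomp e').precomp e)
      ⟨𝟙 i.right, G.minus.id_mem _, (Category.comp_id _).trans (Category.assoc _ _ _)⟩
    rw [← this]
    exact ((congrArg (_ ≫ ·) (Φ.map_id _)).trans (Category.comp_id _)).symm

/-- The `r`-th matching object, as a functor with values in objects of `M` with an action of
`Aut r`. -/
noncomputable def matchingFunctor (r : R) : (R ⥤ M) ⥤ (SingleObj (Aut r) ⥤ M) where
  obj Φ :=
    { obj _ := G.matchingObj r Φ
      map e := G.matchingAct r Φ e
      map_id _ := G.matchingAct_one r Φ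
      map_comp e e' := G.matchingAct_mul r Φ e e' }
  map {Φ Ψ} τ :=
    { app _ := G.matchingObjMap r τ
      naturality _ _ e := matchingObj_hom_ext fun i ↦ by
        dsimp only
        rw [Category.assoc, matchingMap_π, Category.assoc, matchingAct_π, matchingMap_π,
          ← Category.assoc, matchingAct_π] }
  map_id Φ := by
    ext
    exact matchingObj_hom_ext fun i ↦ (G.matchingMap_π r (𝟙 Φ) i).trans
      ((Category.comp_id _).trans (Category.id_comp _).symm)
  map_comp {Φ Ψ Ξ} τ τ' := by
    ext
    refine matchingObj_hom_ext fun i ↦ (G.matchingMap_π r (τ ≫ τ') i).trans ?_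
    change _ = (G.matchingObjMap r τ ≫ G.matchingObjMap r τ') ≫ _
    rw [Category.assoc, matchingMap_π, ← Category.assoc, matchingMap_π,
      NatTrans.comp_app, Category.assoc]

/-- The canonical `Aut r`-equivariant map from `Φ.obj r` to the matching object of `Φ`. -/
noncomputable def matchingMap (r : R) :
    restrictAut (M := M) r ⟶ G.matchingFunctor r where
  app Φ :=
    { app _ := G.matchingLift r Φ (fun i ↦ Φ.map i.hom) (fun _ _ f ↦ by rw [← Φ.map_comp, f.w])
      naturality _ _ e := matchingObj_hom_ext fun i ↦ by
        change (Φ.map (Iso.hom e) ≫ _) ≫ _ = (_ ≫ G.matchingAct r Φ e) ≫ _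
        rw [Category.assoc, matchingLift_π, Category.assoc, matchingAct_π, matchingLift_π,
          ← Φ.map_comp] }
  naturality Φ Ψ τ := by
    ext
    refine matchingObj_hom_ext fun i ↦ ?_
    change (τ.app r ≫ _) ≫ _ = (_ ≫ G.matchingObjMap r τ) ≫ _
    rw [Category.assoc, matchingLift_π, Category.assoc, matchingMap_π, ← Category.assoc,
      matchingLift_π, τ.naturality]

/-- The relative matching map `Φ(r) ⟶ M_r Φ ×_{M_r Ψ} Ψ(r)` of `τ : Φ ⟶ Ψ`, as a morphism of
`Aut r`-objects in `M`. -/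
noncomputable def relativeMatchingMap [HasPullbacks M] (r : R) {Φ Ψ : R ⥤ M} (τ : Φ ⟶ Ψ) :
    (restrictAut r).obj Φ ⟶
      pullback ((G.matchingFunctor r).map τ) ((G.matchingMap r).app Ψ) :=
  pullback.lift ((G.matchingMap r).app Φ) ((restrictAut r).map τ)
    ((G.matchingMap r).naturality τ).symm

end Matching

/-! ### The model structure on diagrams -/

section ModelStructure

variable (M) [ModelCategory M]

/-- `M` is `R`-injective: for every object `r` of `R`, the category of objects of `M` with an
action of `Aut r` admits the injective model structure. -/
def IsInjectiveModelCategory (_ : GeneralizedReedyStructure R) : Prop :=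
  ∀ r : R, AdmitsInjectiveModelStructure (SingleObj (Aut r)) M

/-- A model structure on `R ⥤ M` is the generalized Reedy model structure if its weak
equivalences (respectively cofibrations, fibrations) are the `τ` such that, for every `r`, the
map `τ_r` (respectively the relative latching map, the relative matching map) is a weak
equivalence (respectively cofibration, fibration) in the injective model structure on
`Aut r`-objects in `M`. -/
structure IsReedyModelStructure [HasLimitsOfSize.{w, w} M] [HasColimitsOfSize.{w, w} M]
    [ModelCategory (R ⥤ M)] : Prop where
  weakEquivalences_iff {Φ Ψ : R ⥤ M} (τ : Φ ⟶ Ψ) : weakEquivalences (R ⥤ M) τ ↔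
    ∀ r : R, (weakEquivalences M).functorCategory (SingleObj (Aut r)) ((restrictAut r).map τ)
  cofibrations_iff {Φ Ψ : R ⥤ M} (τ : Φ ⟶ Ψ) : cofibrations (R ⥤ M) τ ↔
    ∀ r : R, (cofibrations M).functorCategory (SingleObj (Aut r)) (G.relativeLatchingMap r τ)
  fibrations_iff {Φ Ψ : R ⥤ M} (τ : Φ ⟶ Ψ) : fibrations (R ⥤ M) τ ↔
    ∀ r : R, injectiveFibrations (SingleObj (Aut r)) M (G.relativeMatchingMap r τ)

end ModelStructure

/-! ### The generating classes -/

/-- The subfunctor `∂R(-, r)` of the representable functor `R(-, r)`: the morphisms with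
codomain `r` which factor through an object of degree less than the degree of `r`. -/
def boundary (r : R) : Subfunctor (yoneda.obj r) where
  obj d := {f | ∃ (t : R) (g : d.unop ⟶ t) (h : t ⟶ r), G.deg t < G.deg r ∧ g ≫ h = f}
  map {d d'} k := by
    rintro f ⟨t, g, h, ht, rfl⟩
    exact ⟨t, k.unop ≫ g, h, ht, Category.assoc _ _ _⟩

variable [HasLimitsOfSize.{w, w} M] [HasPullbacks M]

/-- The morphism
`p ⋔̂ κ^r : E ⋔ R(-, r) ⟶ (E ⋔ ∂R(-, r)) ×_{B ⋔ ∂R(-, r)} (B ⋔ R(-, r))` for `p : E ⟶ B`,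
where `κ^r` is the inclusion of `∂R(-, r)` in `R(-, r)`. -/
noncomputable def pullbackCotensor {E B : M} (p : E ⟶ B) (r : R) :
    power E (yoneda.obj r) ⟶
      pullback (powerMap p (G.boundary r).toFunctor) (powerRestrict B (G.boundary r).ι) :=
  pullback.lift (powerRestrict E (G.boundary r).ι) (powerMap p (yoneda.obj r))
    (power_bifunctorial p (G.boundary r).ι)

/-- The class `X ⋔̂ R` of the morphisms `p ⋔̂ κ^r` with `p` in `X` and `r` an object of `R`. -/
inductive pullbackCotensors (X : MorphismProperty M) : MorphismProperty (R ⥤ M)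
  | mk {E B : M} (p : E ⟶ B) (hp : X p) (r : R) : pullbackCotensors X (G.pullbackCotensor p r)

end GeneralizedReedyStructure

end GenReedy

/-! Both lifting and factorization in `R ⥤ M` are done by induction on the degree. If a diagonal of
a square is known in degrees below `deg r`, extending it to `r` amounts to an `Aut r`-equivariant
diagonal between the relative latching map of the left-hand morphism and the relative matching map
of the right-hand one (`PartialLift.exists_equivariant`, `hasLiftingProperty_of_relative`).
Likewise, a factorization known below `deg r` is extended to `r` by factoring, among `Aut
r`-objects, the map from the latching pushout to the matching pullback (`Stage.exists_succ`,
`exists_factorization_relative`); the injective model structures supply these equivariant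
factorizations. This gives two weak factorization systems (`isWeakFactorizationSystem_reedy`).

Since injective cofibrations are objectwise, the left classes only see the underlying morphisms in
`M` of the relative latching maps. By Yoneda, a morphism `τ` lifts against `p ⋔̂ κ^r` exactly when
its relative latching map at `r` lifts against `p`. So the left classes are cut out by pullback
cotensors (`reedyLeft_llp`), which is the fibrant generation.

It remains to compare the two systems with the objectwise weak equivalences. On the left, the point
is that latching objects preserve acyclic cofibrations (`latchingObjMap_mem_llp`). A lifting problem
out of a latching object is transposed to one against `E ⋔ ∂R(-, r) ⟶ B ⋔ ∂R(-, r)`. Dualizability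
makes `Aut s` act freely on the morphisms `s ⟶ r` of `R⁺`, so equivariant lifts can be chosen freely
on orbit representatives (`hasMatchingLift_powerMap_boundary`); 2-out-of-3 then gives
`reedyLeft_trivialCofibrations`. The argument on the right is not the dual one: the left adjoint of
evaluation at `r` sends cofibrations to Reedy cofibrations (`rlp_app_of_rlp_reedyLeft`), so the
right class is made of objectwise acyclic fibrations, and the retract argument gives the converse
(`reedyRight_cofibrations`). -/

namespace GenReedy

namespace GeneralizedReedyStructure

variable {R : Type w} [SmallCategory.{w} R] (G : GeneralizedReedyStructure R)

/-! ### Factorizations in generalized Reedy categories -/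

section Factorization

variable {G} in
lemma deg_le_of_plus {a b : R} {f : a ⟶ b} (hf : G.plus f) : G.deg a ≤ G.deg b := by
  by_cases h : IsIso f
  · exact (G.deg_eq_of_iso (asIso f)).le
  · exact (G.deg_lt_of_plus f hf h).le

variable {G} in
lemma deg_le_of_minus {a b : R} {f : a ⟶ b} (hf : G.minus f) : G.deg b ≤ G.deg a := by
  by_cases h : IsIso f
  · exact (G.deg_eq_of_iso (asIso f)).ge
  · exact (G.deg_lt_of_minus f hf h).le

variable {G} in
lemma isIso_of_plus {a b : R} {f : a ⟶ b} (hf : G.plus f) (h : G.deg b ≤ G.deg a) : IsIso f := by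
  by_contra h'
  exact absurd (G.deg_lt_of_plus f hf h') (by omega)

variable {G} in
lemma isIso_of_minus {a b : R} {f : a ⟶ b} (hf : G.minus f) (h : G.deg a ≤ G.deg b) :
    IsIso f := by
  by_contra h'
  exact absurd (G.deg_lt_of_minus f hf h') (by omega)

/-- The middle object of the Reedy factorization of a morphism. -/
noncomputable def mid {a b : R} (f : a ⟶ b) : R := (G.exists_factorization f).choose

/-- The first morphism of the Reedy factorization. -/
noncomputable def facMinus {a b : R} (f : a ⟶ b) : a ⟶ G.mid f :=
  (G.exists_factorization f).choose_spec.choose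

/-- The second morphism of the Reedy factorization. -/
noncomputable def facPlus {a b : R} (f : a ⟶ b) : G.mid f ⟶ b :=
  (G.exists_factorization f).choose_spec.choose_spec.choose

variable {a b : R} (f : a ⟶ b)

lemma minus_facMinus : G.minus (G.facMinus f) :=
  (G.exists_factorization f).choose_spec.choose_spec.choose_spec.1

lemma plus_facPlus : G.plus (G.facPlus f) :=
  (G.exists_factorization f).choose_spec.choose_spec.choose_spec.2.1

@[simp]
lemma fac : G.facMinus f ≫ G.facPlus f = f :=
  (G.exists_factorization f).choose_spec.choose_spec.choose_spec.2.2

@[simp]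
lemma fac_assoc {c : R} (g : b ⟶ c) : G.facMinus f ≫ G.facPlus f ≫ g = f ≫ g := by
  rw [← Category.assoc, fac]

lemma deg_mid_le_left : G.deg (G.mid f) ≤ G.deg a := deg_le_of_minus (G.minus_facMinus f)

lemma deg_mid_le_right : G.deg (G.mid f) ≤ G.deg b := deg_le_of_plus (G.plus_facPlus f)

lemma exists_iso_mid {c : R} (h : a ⟶ c) (g : c ⟶ b) (hh : G.minus h) (hg : G.plus g)
    (fac : h ≫ g = f) :
    ∃ e : G.mid f ≅ c, G.facMinus f ≫ e.hom = h ∧ e.hom ≫ g = G.facPlus f :=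
  G.factorization_unique _ _ _ _ (G.minus_facMinus f) (G.plus_facPlus f) hh hg
    ((G.fac f).trans fac.symm)

/-- The `R⁻` part of `facPlus f ≫ g` composes with `facMinus f`, and uniqueness of factorizations
identifies the resulting middle object with that of `f ≫ g`. So `mid` has the least degree among the
objects through which a morphism factors. -/
lemma deg_mid_comp_le {a b c : R} (f : a ⟶ b) (g : b ⟶ c) :
    G.deg (G.mid (f ≫ g)) ≤ G.deg b := by
  obtain ⟨e, -, -⟩ := G.exists_iso_mid (f ≫ g)
    (G.facMinus f ≫ G.facMinus (G.facPlus f ≫ g)) (G.facPlus (G.facPlus f ≫ g))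
    (G.minus.comp_mem _ _ (G.minus_facMinus _) (G.minus_facMinus _)) (G.plus_facPlus _) (by simp)
  rw [G.deg_eq_of_iso e]
  exact (G.deg_mid_le_left _).trans (G.deg_mid_le_right f)

lemma deg_mid_comp_le_left {a b c : R} (f : a ⟶ b) (g : b ⟶ c) :
    G.deg (G.mid (f ≫ g)) ≤ G.deg (G.mid f) := by
  conv_lhs => rw [← G.fac f, Category.assoc]
  exact G.deg_mid_comp_le _ _

lemma deg_mid_comp_le_right {a b c : R} (f : a ⟶ b) (g : b ⟶ c) :
    G.deg (G.mid (f ≫ g)) ≤ G.deg (G.mid g) := by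
  conv_lhs => rw [← G.fac g, ← Category.assoc]
  exact G.deg_mid_comp_le _ _

/-- Neither half of the factorization can change the degree. This is the dichotomy behind every
induction below: between objects of degree at most `n`, a morphism is invertible or factors through
degree less than `n`. -/
lemma isIso_of_deg_le_mid {n : ℕ} (ha : G.deg a ≤ n) (hb : G.deg b ≤ n)
    (h : n ≤ G.deg (G.mid f)) : IsIso f := by
  have := isIso_of_minus (G.minus_facMinus f) (by omega)
  have := isIso_of_plus (G.plus_facPlus f) (by omega)
  rw [← G.fac f]
  infer_instance

lemma mem_boundary_iff {d r : R} (x : d ⟶ r) :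
    x ∈ (G.boundary r).obj (Opposite.op d) ↔ G.deg (G.mid x) < G.deg r :=
  ⟨by rintro ⟨t, g, h, ht, rfl⟩; exact (G.deg_mid_comp_le g h).trans_lt ht,
    fun h ↦ ⟨_, _, _, h, G.fac x⟩⟩

end Factorization

variable {M : Type u} [Category.{v} M]

/-! ### Extending the latching cocone to all morphisms that factor through lower degree. -/

section Latching

variable [HasColimitsOfSize.{w, w} M]

/-- The morphism from `Φ.obj d` to the latching object of `Φ` at `r` corresponding to a
morphism `d ⟶ r` which factors through an object of lower degree. -/
noncomputable def boundaryι (r : R) (Φ : R ⥤ M) {d : R} (x : d ⟶ r)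
    (hx : G.deg (G.mid x) < G.deg r) : Φ.obj d ⟶ G.latchingObj r Φ :=
  Φ.map (G.facMinus x) ≫ G.latchingι r Φ ⟨G.mid x, G.facPlus x, G.plus_facPlus x, hx⟩

/-- The map attached to `x` does not depend on the factorization: the `R⁺` part of `k` is a morphism
of the latching category, and what remains is a Reedy factorization of `x`, unique up to an
isomorphism that also lies in the latching category. -/
lemma map_latchingι (r : R) (Φ : R ⥤ M) {d : R} (i : G.LatchingIndex r) (k : d ⟶ i.left)
    {x : d ⟶ r} (hx : G.deg (G.mid x) < G.deg r) (fac : k ≫ i.hom = x) :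
    Φ.map k ≫ G.latchingι r Φ i = G.boundaryι r Φ x hx := by
  let j : G.LatchingIndex r := ⟨G.mid k, G.facPlus k ≫ i.hom,
    G.plus.comp_mem _ _ (G.plus_facPlus _) i.plus_hom, (G.deg_mid_le_right k).trans_lt i.deg_lt⟩
  obtain ⟨e, he, he'⟩ := G.exists_iso_mid x (G.facMinus k) j.hom (G.minus_facMinus k) j.plus_hom
    (by simp [j, fac])
  have h₁ := G.latchingι_w r Φ (i := j) (j := i) ⟨G.facPlus k, G.plus_facPlus k, rfl⟩
  have h₂ := G.latchingι_w r Φ (i := ⟨G.mid x, G.facPlus x, G.plus_facPlus x, hx⟩) (j := j)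
    ⟨e.hom, G.plus_hom e, he'⟩
  rw [← G.fac k, Φ.map_comp, Category.assoc]
  erw [h₁]
  rw [boundaryι, ← h₂, ← he, Φ.map_comp, Category.assoc]

lemma map_boundaryι (r : R) (Φ : R ⥤ M) {d d' : R} (k : d' ⟶ d) (x : d ⟶ r)
    (hx : G.deg (G.mid x) < G.deg r) :
    Φ.map k ≫ G.boundaryι r Φ x hx =
      G.boundaryι r Φ (k ≫ x) ((G.deg_mid_comp_le_right k x).trans_lt hx) := by
  rw [boundaryι, ← Category.assoc, ← Φ.map_comp]
  exact G.map_latchingι r Φ ⟨_, _, G.plus_facPlus x, hx⟩ (k ≫ G.facMinus x) _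
    (by rw [Category.assoc, fac])

lemma boundaryι_hom (r : R) (Φ : R ⥤ M) (i : G.LatchingIndex r)
    (hi : G.deg (G.mid i.hom) < G.deg r) :
    G.boundaryι r Φ i.hom hi = G.latchingι r Φ i := by
  rw [← G.map_latchingι r Φ i (𝟙 _) hi (Category.id_comp _), Φ.map_id, Category.id_comp]

lemma boundaryι_map (r : R) {Φ Ψ : R ⥤ M} (τ : Φ ⟶ Ψ) {d : R} (x : d ⟶ r)
    (hx : G.deg (G.mid x) < G.deg r) :
    G.boundaryι r Φ x hx ≫ G.latchingObjMap r τ = τ.app d ≫ G.boundaryι r Ψ x hx := by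
  rw [boundaryι, Category.assoc, latchingι_map, τ.naturality_assoc, boundaryι]

/-- The canonical morphism from the latching object of `Φ` at `r` to `Φ.obj r`. -/
noncomputable def latchingHom (r : R) (Φ : R ⥤ M) : G.latchingObj r Φ ⟶ Φ.obj r :=
  ((G.latchingMap r).app Φ).app (SingleObj.star _)

lemma latchingι_hom (r : R) (Φ : R ⥤ M) (i : G.LatchingIndex r) :
    G.latchingι r Φ i ≫ G.latchingHom r Φ = Φ.map i.hom :=
  G.latchingι_desc r Φ (fun i ↦ Φ.map i.hom) (fun _ _ f ↦ by rw [← Φ.map_comp, f.w]) i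

lemma boundaryι_latchingHom (r : R) (Φ : R ⥤ M) {d : R} (x : d ⟶ r)
    (hx : G.deg (G.mid x) < G.deg r) :
    G.boundaryι r Φ x hx ≫ G.latchingHom r Φ = Φ.map x := by
  rw [boundaryι, Category.assoc, latchingι_hom, ← Φ.map_comp, fac]

lemma boundaryι_act (r : R) (Φ : R ⥤ M) (e : Aut r) {d : R} (x : d ⟶ r)
    (hx : G.deg (G.mid x) < G.deg r) :
    G.boundaryι r Φ x hx ≫ G.latchingAct r Φ e = G.boundaryι r Φ (x ≫ e.hom)
      ((G.deg_mid_comp_le_left x _).trans_lt hx) := by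
  rw [boundaryι, Category.assoc, latchingι_act]
  exact G.map_latchingι r Φ (.postcomp ⟨_, _, G.plus_facPlus x, hx⟩ e) (G.facMinus x) _
    (by rw [← Category.assoc, fac])

end Latching

/-! ### Extending the matching cone to all morphisms that factor through lower degree. -/

section Matching

variable [HasLimitsOfSize.{w, w} M]

/-- The morphism from the matching object of `Φ` at `r` to `Φ.obj d` corresponding to a
morphism `r ⟶ d` which factors through an object of lower degree. -/
noncomputable def boundaryπ (r : R) (Φ : R ⥤ M) {d : R} (x : r ⟶ d)
    (hx : G.deg (G.mid x) < G.deg r) : G.matchingObj r Φ ⟶ Φ.obj d :=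
  G.matchingπ r Φ ⟨G.mid x, G.facMinus x, G.minus_facMinus x, hx⟩ ≫ Φ.map (G.facPlus x)

lemma matchingπ_map (r : R) (Φ : R ⥤ M) {d : R} (i : G.MatchingIndex r) (k : i.right ⟶ d)
    {x : r ⟶ d} (hx : G.deg (G.mid x) < G.deg r) (fac : i.hom ≫ k = x) :
    G.matchingπ r Φ i ≫ Φ.map k = G.boundaryπ r Φ x hx := by
  let j : G.MatchingIndex r := ⟨G.mid k, i.hom ≫ G.facMinus k,
    G.minus.comp_mem _ _ i.minus_hom (G.minus_facMinus _), (G.deg_mid_le_left k).trans_lt i.deg_lt⟩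
  obtain ⟨e, he, he'⟩ := G.exists_iso_mid x j.hom (G.facPlus k) j.minus_hom (G.plus_facPlus k)
    (by simp [j, fac])
  have h₁ := G.matchingπ_w r Φ (i := i) (j := j) ⟨G.facMinus k, G.minus_facMinus k, rfl⟩
  have h₂ := G.matchingπ_w r Φ (i := ⟨G.mid x, G.facMinus x, G.minus_facMinus x, hx⟩) (j := j)
    ⟨e.hom, G.minus_hom e, he⟩
  rw [← G.fac k, Φ.map_comp, ← Category.assoc]
  erw [h₁]
  rw [boundaryπ, ← h₂, ← he', Φ.map_comp, Category.assoc]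

lemma boundaryπ_comp_map (r : R) (Φ : R ⥤ M) {d d' : R} (x : r ⟶ d) (k : d ⟶ d')
    (hx : G.deg (G.mid x) < G.deg r) :
    G.boundaryπ r Φ x hx ≫ Φ.map k =
      G.boundaryπ r Φ (x ≫ k) ((G.deg_mid_comp_le_left x k).trans_lt hx) := by
  rw [boundaryπ, Category.assoc, ← Φ.map_comp]
  exact G.matchingπ_map r Φ ⟨_, _, G.minus_facMinus x, hx⟩ (G.facPlus x ≫ k) _
    (by rw [← Category.assoc, fac])

lemma boundaryπ_hom (r : R) (Φ : R ⥤ M) (i : G.MatchingIndex r)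
    (hi : G.deg (G.mid i.hom) < G.deg r) :
    G.boundaryπ r Φ i.hom hi = G.matchingπ r Φ i := by
  rw [← G.matchingπ_map r Φ i (𝟙 _) hi (Category.comp_id _), Φ.map_id, Category.comp_id]

lemma map_boundaryπ (r : R) {Φ Ψ : R ⥤ M} (τ : Φ ⟶ Ψ) {d : R} (x : r ⟶ d)
    (hx : G.deg (G.mid x) < G.deg r) :
    G.matchingObjMap r τ ≫ G.boundaryπ r Ψ x hx = G.boundaryπ r Φ x hx ≫ τ.app d := by
  rw [boundaryπ, ← Category.assoc, matchingMap_π, Category.assoc, ← τ.naturality, boundaryπ,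
    Category.assoc]

/-- The canonical morphism from `Φ.obj r` to the matching object of `Φ` at `r`. -/
noncomputable def matchingHom (r : R) (Φ : R ⥤ M) : Φ.obj r ⟶ G.matchingObj r Φ :=
  ((G.matchingMap r).app Φ).app (SingleObj.star _)

lemma matchingHom_π (r : R) (Φ : R ⥤ M) (i : G.MatchingIndex r) :
    G.matchingHom r Φ ≫ G.matchingπ r Φ i = Φ.map i.hom :=
  G.matchingLift_π r Φ (fun i ↦ Φ.map i.hom) (fun _ _ f ↦ by rw [← Φ.map_comp, f.w]) i

lemma matchingHom_boundaryπ (r : R) (Φ : R ⥤ M) {d : R} (x : r ⟶ d)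
    (hx : G.deg (G.mid x) < G.deg r) :
    G.matchingHom r Φ ≫ G.boundaryπ r Φ x hx = Φ.map x := by
  rw [boundaryπ, ← Category.assoc, matchingHom_π, ← Φ.map_comp, fac]

lemma act_boundaryπ (r : R) (Φ : R ⥤ M) (e : Aut r) {d : R} (x : r ⟶ d)
    (hx : G.deg (G.mid x) < G.deg r) :
    G.matchingAct r Φ e ≫ G.boundaryπ r Φ x hx = G.boundaryπ r Φ (e.hom ≫ x)
      ((G.deg_mid_comp_le_right _ x).trans_lt hx) := by
  rw [boundaryπ, ← Category.assoc, matchingAct_π]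
  exact G.matchingπ_map r Φ (.precomp ⟨_, _, G.minus_facMinus x, hx⟩ e) (G.facPlus x) _
    (by rw [Category.assoc, fac])

end Matching

end GeneralizedReedyStructure

end GenReedy

namespace GenReedy

namespace GeneralizedReedyStructure

variable {R : Type w} [SmallCategory.{w} R] (G : GeneralizedReedyStructure R)

variable {M : Type u} [Category.{v} M]

/-! ### Lifting problems in terms of families of morphisms -/

/-- Given `τ : Φ ⟶ T`, an object `Z` of `M` equipped with a morphism from `Φ.obj r` and a family
of morphisms indexed by the latching category at `r`, this is the lifting property, with respect
to `q`, of the morphism to `Z` from the pushout of `Φ.obj r` and of the latching object of `T`,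
expressed in terms of families of morphisms. -/
def HasLatchingLift (r : R) {Φ T : R ⥤ M} (τ : Φ ⟶ T) {Z : M} (φ : Φ.obj r ⟶ Z)
    (inj : ∀ i : G.LatchingIndex r, T.obj i.left ⟶ Z) {E B : M} (q : E ⟶ B) : Prop :=
  ∀ (α : Φ.obj r ⟶ E) (β : ∀ i : G.LatchingIndex r, T.obj i.left ⟶ E) (γ : Z ⟶ B),
    (∀ (i j : G.LatchingIndex r) (f : i ⟶ j), T.map f.hom ≫ β j = β i) →
    (∀ i, Φ.map i.hom ≫ α = τ.app i.left ≫ β i) → α ≫ q = φ ≫ γ →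
    (∀ i, β i ≫ q = inj i ≫ γ) →
    ∃ l : Z ⟶ E, φ ≫ l = α ∧ (∀ i, inj i ≫ l = β i) ∧ l ≫ q = γ

section Latching

variable [HasColimitsOfSize.{w, w} M] [HasPushouts M]

/-- The pushout of `Φ.obj r` and of the latching object of `T`, with its action of `Aut r`. -/
noncomputable abbrev latchingPushout (r : R) {Φ T : R ⥤ M} (τ : Φ ⟶ T) :
    SingleObj (Aut r) ⥤ M :=
  pushout ((G.latchingMap r).app Φ) ((G.latchingFunctor r).map τ)

/-- The morphism from `Φ.obj r` to the pushout. -/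
noncomputable def latchingPushoutInl (r : R) {Φ T : R ⥤ M} (τ : Φ ⟶ T) :
    Φ.obj r ⟶ (G.latchingPushout r τ).obj (SingleObj.star _) :=
  (pushout.inl ((G.latchingMap r).app Φ) ((G.latchingFunctor r).map τ)).app (SingleObj.star _)

/-- The morphism from the latching object of `T` to the pushout. -/
noncomputable def latchingPushoutInr (r : R) {Φ T : R ⥤ M} (τ : Φ ⟶ T) :
    G.latchingObj r T ⟶ (G.latchingPushout r τ).obj (SingleObj.star _) :=
  (pushout.inr ((G.latchingMap r).app Φ) ((G.latchingFunctor r).map τ)).app (SingleObj.star _)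

lemma isPushout_latchingPushout (r : R) {Φ T : R ⥤ M} (τ : Φ ⟶ T) :
    IsPushout (G.latchingHom r Φ) (G.latchingObjMap r τ) (G.latchingPushoutInl r τ)
      (G.latchingPushoutInr r τ) :=
  (IsPushout.of_hasPushout ((G.latchingMap r).app Φ) ((G.latchingFunctor r).map τ)).map
    ((evaluation _ _).obj (SingleObj.star _))

lemma latchingPushoutInl_map (r : R) {Φ T : R ⥤ M} (τ : Φ ⟶ T) (e : Aut r) :
    G.latchingPushoutInl r τ ≫ (G.latchingPushout r τ).map
      (X := SingleObj.star _) (Y := SingleObj.star _) e =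
      Φ.map e.hom ≫ G.latchingPushoutInl r τ :=
  ((pushout.inl ((G.latchingMap r).app Φ) ((G.latchingFunctor r).map τ)).naturality
    (X := SingleObj.star _) (Y := SingleObj.star _) e).symm

lemma latchingPushoutInr_map (r : R) {Φ T : R ⥤ M} (τ : Φ ⟶ T) (e : Aut r) :
    G.latchingPushoutInr r τ ≫ (G.latchingPushout r τ).map
      (X := SingleObj.star _) (Y := SingleObj.star _) e =
      G.latchingAct r T e ≫ G.latchingPushoutInr r τ :=
  ((pushout.inr ((G.latchingMap r).app Φ) ((G.latchingFunctor r).map τ)).naturality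
    (X := SingleObj.star _) (Y := SingleObj.star _) e).symm

/-- The universal properties of the pushout and of the latching object are unfolded so that `T`
enters only through its values in degrees below `deg r`; the condition then survives a change of `T`
in higher degrees. -/
lemma hasLiftingProperty_iff_hasLatchingLift (r : R) {Φ T : R ⥤ M} (τ : Φ ⟶ T) {Z : M}
    (i : (G.latchingPushout r τ).obj (SingleObj.star _) ⟶ Z) {E B : M} (q : E ⟶ B) :
    HasLiftingProperty i q ↔ G.HasLatchingLift r τ (G.latchingPushoutInl r τ ≫ i)
      (fun j ↦ G.latchingι r T j ≫ G.latchingPushoutInr r τ ≫ i) q := by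
  have P := G.isPushout_latchingPushout r τ
  constructor
  · intro _ α β γ hβ hαβ hα hβγ
    let b := G.latchingDesc r T β hβ
    have hb (j) : G.latchingι r T j ≫ b = β j := G.latchingι_desc ..
    have w : G.latchingHom r Φ ≫ α = G.latchingObjMap r τ ≫ b :=
      latchingObj_hom_ext fun j ↦ by
        rw [← Category.assoc, latchingι_hom, ← Category.assoc, latchingι_map, Category.assoc, hb,
          hαβ]
    have sq : CommSq (P.desc α b w) i q γ := ⟨P.hom_ext (by simp [hα])
      (latchingObj_hom_ext fun j ↦ by
        rw [P.inr_desc_assoc, ← Category.assoc, hb, hβγ, Category.assoc, Category.assoc])⟩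
    exact ⟨sq.lift, by simp, fun j ↦ by simp [hb], sq.fac_right⟩
  · refine fun h ↦ ⟨fun {f g} sq ↦ ?_⟩
    obtain ⟨l, hl₁, hl₂, hl₃⟩ := h (G.latchingPushoutInl r τ ≫ f)
      (fun j ↦ G.latchingι r T j ≫ G.latchingPushoutInr r τ ≫ f) g
      (fun j k t ↦ by rw [← Category.assoc, latchingι_w])
      (fun j ↦ by
        rw [← latchingι_hom, Category.assoc, reassoc_of% P.w, ← Category.assoc, latchingι_map,
          Category.assoc])
      (by simp [sq.w]) (fun j ↦ by simp [sq.w])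
    refine ⟨⟨l, P.hom_ext (by simpa using hl₁) (latchingObj_hom_ext fun j ↦ ?_), hl₃⟩⟩
    simpa using hl₂ j

lemma hasLiftingProperty_relativeLatchingMap_iff (r : R) {Φ T : R ⥤ M} (τ : Φ ⟶ T)
    {E B : M} (q : E ⟶ B) :
    HasLiftingProperty ((G.relativeLatchingMap r τ).app (SingleObj.star _)) q ↔
      G.HasLatchingLift r τ (τ.app r) (fun j ↦ T.map j.hom) q := by
  have h₁ : G.latchingPushoutInl r τ ≫ (G.relativeLatchingMap r τ).app (SingleObj.star _) =
      τ.app r :=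
    congr_app (pushout.inl_desc (f := (G.latchingMap r).app Φ) (g := (G.latchingFunctor r).map τ)
      _ _ _) (SingleObj.star _)
  have h₂ : G.latchingPushoutInr r τ ≫ (G.relativeLatchingMap r τ).app (SingleObj.star _) =
      G.latchingHom r T :=
    congr_app (pushout.inr_desc (f := (G.latchingMap r).app Φ) (g := (G.latchingFunctor r).map τ)
      _ _ _) (SingleObj.star _)
  refine (G.hasLiftingProperty_iff_hasLatchingLift r τ
    (Z := T.obj r) ((G.relativeLatchingMap r τ).app (SingleObj.star _)) q).trans ?_
  rw [h₁, h₂]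
  simp only [latchingι_hom]

end Latching

/-- The dual of `HasLatchingLift`, for equivariant lifting problems: given `τ : T ⟶ Ψ`, an object
`Z` with an action of `Aut r`, an equivariant morphism to `Ψ.obj r` and a compatible family of
morphisms indexed by the matching category at `r`, this is the right lifting property, with
respect to the equivariant morphisms which belong to `L`, of the morphism from `Z` to the pullback
of `Ψ.obj r` and of the matching object of `T`. -/
def HasMatchingLift (r : R) {T Ψ : R ⥤ M} (τ : T ⟶ Ψ) {Z : SingleObj (Aut r) ⥤ M}
    (ψ : Z ⟶ (restrictAut r).obj Ψ)
    (pr : ∀ i : G.MatchingIndex r, Z.obj (SingleObj.star _) ⟶ T.obj i.right)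
    (L : MorphismProperty M) : Prop :=
  ∀ ⦃A B : SingleObj (Aut r) ⥤ M⦄ (f : A ⟶ B), L.functorCategory _ f →
    ∀ (α : A ⟶ Z) (β : ∀ i : G.MatchingIndex r, B.obj (SingleObj.star _) ⟶ T.obj i.right)
      (γ : B ⟶ (restrictAut r).obj Ψ),
      (∀ (i j : G.MatchingIndex r) (f : i ⟶ j), β i ≫ T.map f.hom = β j) →
      (∀ (e : Aut r) i, B.map (X := SingleObj.star _) (Y := SingleObj.star _) e ≫ β i =
        β (i.precomp e)) →
      (∀ i, β i ≫ τ.app i.right = γ.app (SingleObj.star _) ≫ Ψ.map i.hom) →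
      (∀ i, f.app (SingleObj.star _) ≫ β i = α.app (SingleObj.star _) ≫ pr i) →
      f ≫ γ = α ≫ ψ →
      ∃ l : B ⟶ Z, f ≫ l = α ∧ (∀ i, l.app (SingleObj.star _) ≫ pr i = β i) ∧ l ≫ ψ = γ

section Matching

variable [HasLimitsOfSize.{w, w} M] [HasPullbacks M]

/-- The pullback of `Ψ.obj r` and of the matching object of `T`, with its action of `Aut r`. -/
noncomputable abbrev matchingPullback (r : R) {T Ψ : R ⥤ M} (τ : T ⟶ Ψ) :
    SingleObj (Aut r) ⥤ M :=
  pullback ((G.matchingFunctor r).map τ) ((G.matchingMap r).app Ψ)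

/-- The projection of the pullback to the matching object of `T`. -/
noncomputable abbrev matchingPullbackFst (r : R) {T Ψ : R ⥤ M} (τ : T ⟶ Ψ) :
    G.matchingPullback r τ ⟶ (G.matchingFunctor r).obj T :=
  pullback.fst _ _

/-- The projection of the pullback to `Ψ.obj r`. -/
noncomputable abbrev matchingPullbackSnd (r : R) {T Ψ : R ⥤ M} (τ : T ⟶ Ψ) :
    G.matchingPullback r τ ⟶ (restrictAut r).obj Ψ :=
  pullback.snd _ _

lemma matchingPullback_condition (r : R) {T Ψ : R ⥤ M} (τ : T ⟶ Ψ) :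
    (G.matchingPullbackFst r τ).app (SingleObj.star _) ≫ G.matchingObjMap r τ =
      (G.matchingPullbackSnd r τ).app (SingleObj.star _) ≫ G.matchingHom r Ψ :=
  congr_app (pullback.condition (f := (G.matchingFunctor r).map τ) (g := (G.matchingMap r).app Ψ))
    (SingleObj.star _)

/-- A compatible family `β` is a morphism to the matching object; its compatibility with
precomposition by automorphisms is exactly the equivariance of that morphism. -/
lemma rlp_iff_hasMatchingLift (r : R) {T Ψ : R ⥤ M} (τ : T ⟶ Ψ)
    {Z : SingleObj (Aut r) ⥤ M} (p : Z ⟶ G.matchingPullback r τ) (L : MorphismProperty M) :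
    (L.functorCategory (SingleObj (Aut r))).rlp p ↔
      G.HasMatchingLift r τ (p ≫ G.matchingPullbackSnd r τ)
        (fun j ↦ (p ≫ G.matchingPullbackFst r τ).app (SingleObj.star _) ≫ G.matchingπ r T j) L := by
  constructor
  · intro h A B f hf α β γ hβ hβ' hβγ hαβ hα
    let b₀ : B.obj (SingleObj.star _) ⟶ G.matchingObj r T := G.matchingLift r T β hβ
    have hb₀ (j) : b₀ ≫ G.matchingπ r T j = β j := G.matchingLift_π ..
    let b : B ⟶ (G.matchingFunctor r).obj T :=
      { app _ := b₀
        naturality _ _ e := by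
          refine matchingObj_hom_ext fun j ↦ ?_
          change (B.map e ≫ b₀) ≫ _ = (b₀ ≫ G.matchingAct r T e) ≫ _
          rw [Category.assoc, hb₀, Category.assoc, matchingAct_π, hb₀]
          exact hβ' e j }
    have w : b ≫ (G.matchingFunctor r).map τ = γ ≫ (G.matchingMap r).app Ψ := by
      ext ⟨⟩
      refine matchingObj_hom_ext fun j ↦ ?_
      change (b₀ ≫ G.matchingObjMap r τ) ≫ _ = (γ.app _ ≫ G.matchingHom r Ψ) ≫ _
      rw [Category.assoc, matchingMap_π, ← Category.assoc, hb₀, Category.assoc, matchingHom_π]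
      exact hβγ j
    have := h _ hf
    have sq : CommSq α f p (pullback.lift b γ w) := ⟨by
      apply pullback.hom_ext
      · rw [Category.assoc, Category.assoc, pullback.lift_fst]
        ext ⟨⟩
        refine matchingObj_hom_ext fun j ↦ ?_
        change _ = (f.app _ ≫ b₀) ≫ _
        rw [Category.assoc, hb₀]
        exact (Category.assoc _ _ _).trans (hαβ j).symm
      · rw [Category.assoc, Category.assoc, pullback.lift_snd, hα]⟩
    refine ⟨sq.lift, sq.fac_left, fun j ↦ ?_, ?_⟩
    · have : (sq.lift ≫ p ≫ G.matchingPullbackFst r τ).app (SingleObj.star _) = b₀ := by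
        rw [sq.fac_right_assoc, pullback.lift_fst]
      rw [NatTrans.comp_app] at this
      erw [← hb₀, ← this, Category.assoc]
      rfl
    · rw [sq.fac_right_assoc, pullback.lift_snd]
  · intro h A B f hf
    refine ⟨fun {α g} sq ↦ ?_⟩
    obtain ⟨l, hl₁, hl₂, hl₃⟩ := h f hf α
      (fun j ↦ (g ≫ G.matchingPullbackFst r τ).app (SingleObj.star _) ≫ G.matchingπ r T j)
      (g ≫ G.matchingPullbackSnd r τ)
      (fun i j t ↦ by
        refine (Category.assoc _ _ _).trans (congrArg _ ?_)
        exact G.matchingπ_w r T t)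
      (fun e i ↦ by
        refine (Category.assoc _ _ _).symm.trans ((congrArg (· ≫ _)
          ((g ≫ G.matchingPullbackFst r τ).naturality _)).trans ((Category.assoc _ _ _).trans ?_))
        exact congrArg _ (G.matchingAct_π r T e i))
      (fun i ↦ by
        refine (Category.assoc _ _ _).trans ((congrArg _ (G.matchingMap_π r τ i).symm).trans ?_)
        refine (Category.assoc _ _ _).symm.trans ?_
        refine (congrArg (· ≫ _) ((Category.assoc _ _ _).trans
          ((congrArg _ (G.matchingPullback_condition r τ)).trans
            (Category.assoc _ _ _).symm))).trans ?_
        refine (Category.assoc _ _ _).trans (congrArg _ (G.matchingHom_π r Ψ i)))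
      (fun i ↦ by
        refine (Category.assoc _ _ _).symm.trans (Eq.trans ?_ (Category.assoc _ _ _))
        refine congrArg (· ≫ _) ?_
        rw [← NatTrans.comp_app, ← NatTrans.comp_app, sq.w_assoc])
      (by rw [sq.w_assoc])
    refine ⟨⟨l, hl₁, pullback.hom_ext ?_ ((Category.assoc _ _ _).trans hl₃)⟩⟩
    ext ⟨⟩
    refine matchingObj_hom_ext fun j ↦ Eq.trans ?_ (hl₂ j)
    exact (congrArg (· ≫ _) (congr_app (Category.assoc _ _ _) _)).trans (Category.assoc _ _ _)

lemma rlp_relativeMatchingMap_iff (r : R) {T Ψ : R ⥤ M} (τ : T ⟶ Ψ) (L : MorphismProperty M) :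
    (L.functorCategory (SingleObj (Aut r))).rlp (G.relativeMatchingMap r τ) ↔
      G.HasMatchingLift r τ ((restrictAut r).map τ) (fun j ↦ T.map j.hom) L := by
  refine (G.rlp_iff_hasMatchingLift r τ (G.relativeMatchingMap r τ) L).trans ?_
  have h₁ : G.relativeMatchingMap r τ ≫ G.matchingPullbackSnd r τ = (restrictAut r).map τ :=
    pullback.lift_snd _ _ _
  have h₂ : G.relativeMatchingMap r τ ≫ G.matchingPullbackFst r τ = (G.matchingMap r).app T :=
    pullback.lift_fst _ _ _
  rw [h₁, h₂]
  have h₃ : (fun j : G.MatchingIndex r ↦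
      ((G.matchingMap r).app T).app (SingleObj.star _) ≫ G.matchingπ r T j) =
      fun j ↦ T.map j.hom := by
    ext j
    exact G.matchingHom_π r T j
  exact iff_of_eq (congrArg (fun t ↦ G.HasMatchingLift r τ _ t L) h₃)

end Matching

end GeneralizedReedyStructure

end GenReedy

/-! ### Universal property of powers, and lifting against pullback cotensors. -/

namespace GenReedy

section Power

variable {R : Type w} [SmallCategory.{w} R] {M : Type u} [Category.{v} M]
  [HasLimitsOfSize.{w, w} M]

/-- The projection of a power to the factor corresponding to an element of the presheaf. -/
noncomputable def powerπ (E : M) (S : Rᵒᵖ ⥤ Type w) {d : R} (x : S.obj (Opposite.op d)) :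
    (power E S).obj d ⟶ E :=
  Pi.π (fun _ ↦ E) x

lemma map_powerπ (E : M) (S : Rᵒᵖ ⥤ Type w) {d d' : R} (f : d ⟶ d')
    (x : S.obj (Opposite.op d')) :
    (power E S).map f ≫ powerπ E S x = powerπ E S (S.map f.op x) := by
  simp [powerπ]

lemma power_obj_hom_ext {E A : M} {S : Rᵒᵖ ⥤ Type w} {d : R} {f g : A ⟶ (power E S).obj d}
    (h : ∀ x, f ≫ powerπ E S x = g ≫ powerπ E S x) : f = g :=
  Pi.hom_ext _ _ h

/-- The universal property of the values of a power. -/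
noncomputable def powerLift {E A : M} {S : Rᵒᵖ ⥤ Type w} {d : R}
    (φ : S.obj (Opposite.op d) → (A ⟶ E)) : A ⟶ (power E S).obj d :=
  Pi.lift φ

lemma powerLift_π {E A : M} {S : Rᵒᵖ ⥤ Type w} {d : R}
    (φ : S.obj (Opposite.op d) → (A ⟶ E)) (x : S.obj (Opposite.op d)) :
    powerLift φ ≫ powerπ E S x = φ x := by
  simp [powerLift, powerπ]

lemma powerMap_π {E B : M} (p : E ⟶ B) (S : Rᵒᵖ ⥤ Type w) {d : R} (x : S.obj (Opposite.op d)) :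
    (powerMap p S).app d ≫ powerπ B S x = powerπ E S x ≫ p := by
  simp [powerMap, powerπ]

lemma powerRestrict_π (E : M) {S T : Rᵒᵖ ⥤ Type w} (α : S ⟶ T) {d : R}
    (x : S.obj (Opposite.op d)) :
    (powerRestrict E α).app d ≫ powerπ E S x = powerπ E T (α.app _ x) := by
  simp [powerRestrict, powerπ]

lemma power_hom_ext {E : M} {S : Rᵒᵖ ⥤ Type w} {T : R ⥤ M} {f g : T ⟶ power E S}
    (h : ∀ (d : R) (x : S.obj (Opposite.op d)),
      f.app d ≫ powerπ E S x = g.app d ≫ powerπ E S x) : f = g := by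
  ext d : 2
  exact power_obj_hom_ext (h d)

/-- Morphisms to a power are natural families of morphisms. -/
noncomputable def toPower {E : M} {S : Rᵒᵖ ⥤ Type w} {T : R ⥤ M}
    (φ : ∀ (d : R) (_ : S.obj (Opposite.op d)), T.obj d ⟶ E)
    (hφ : ∀ ⦃d d' : R⦄ (f : d ⟶ d') (x : S.obj (Opposite.op d')),
      T.map f ≫ φ d' x = φ d (S.map f.op x)) : T ⟶ power E S where
  app d := powerLift (φ d)
  naturality d d' f := power_obj_hom_ext fun x ↦ by
    rw [Category.assoc, powerLift_π, hφ, Category.assoc, map_powerπ, powerLift_π]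

lemma toPower_π {E : M} {S : Rᵒᵖ ⥤ Type w} {T : R ⥤ M}
    (φ : ∀ (d : R) (_ : S.obj (Opposite.op d)), T.obj d ⟶ E)
    (hφ : ∀ ⦃d d' : R⦄ (f : d ⟶ d') (x : S.obj (Opposite.op d')),
      T.map f ≫ φ d' x = φ d (S.map f.op x)) (d : R) (x : S.obj (Opposite.op d)) :
    (toPower φ hφ).app d ≫ powerπ E S x = φ d x :=
  powerLift_π _ _

end Power

namespace GeneralizedReedyStructure

variable {R : Type w} [SmallCategory.{w} R] (G : GeneralizedReedyStructure R)

variable {M : Type u} [Category.{v} M]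

/-- The element of the boundary corresponding to a morphism which factors through an object
of lower degree. -/
def boundaryMk {d r : R} (x : d ⟶ r) (hx : G.deg (G.mid x) < G.deg r) :
    (G.boundary r).toFunctor.obj (Opposite.op d) :=
  ⟨x, (G.mem_boundary_iff x).2 hx⟩

variable {G} in
lemma deg_mid_lt_of_boundary {d r : R} (x : (G.boundary r).toFunctor.obj (Opposite.op d)) :
    G.deg (G.mid (a := d) (b := r) x.1) < G.deg r :=
  (G.mem_boundary_iff x.1).1 x.2

variable [HasLimitsOfSize.{w, w} M] [HasPullbacks M]

lemma pullbackCotensor_fst (r : R) {E B : M} (q : E ⟶ B) :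
    G.pullbackCotensor q r ≫ pullback.fst _ _ = powerRestrict E (G.boundary r).ι :=
  pullback.lift_fst _ _ _

lemma pullbackCotensor_snd (r : R) {E B : M} (q : E ⟶ B) :
    G.pullbackCotensor q r ≫ pullback.snd _ _ = powerMap q _ :=
  pullback.lift_snd _ _ _

variable [HasColimitsOfSize.{w, w} M]

/-- By Yoneda, morphisms `T ⟶ E ⋔ R(-, r)` are morphisms `T.obj r ⟶ E`, and morphisms `T ⟶ E ⋔ ∂R(-,
r)` are morphisms from the latching object of `T` at `r` to `E`. Under these bijections the two
lifting problems coincide. -/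
lemma hasLiftingProperty_pullbackCotensor_iff (r : R) {Φ T : R ⥤ M} (τ : Φ ⟶ T) {E B : M}
    (q : E ⟶ B) :
    HasLiftingProperty τ (G.pullbackCotensor q r) ↔
      G.HasLatchingLift r τ (τ.app r) (fun j ↦ T.map j.hom) q := by
  constructor
  · intro _ α β γ hβ hαβ hα hβγ
    let b := G.latchingDesc r T β hβ
    have hb (j) : G.latchingι r T j ≫ b = β j := G.latchingι_desc ..
    let a' : Φ ⟶ power E (yoneda.obj r) := toPower (fun d x ↦ Φ.map x ≫ α)
      (fun d d' f x ↦ by simp)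
    let b₁ : T ⟶ power E (G.boundary r).toFunctor :=
      toPower (fun d x ↦ G.boundaryι r T x.1 (deg_mid_lt_of_boundary x) ≫ b)
        (fun d d' f x ↦ by
          rw [← Category.assoc, map_boundaryι]
          rfl)
    let b₂ : T ⟶ power B (yoneda.obj r) := toPower (fun d x ↦ T.map x ≫ γ)
      (fun d d' f x ↦ by simp)
    have hbγ : b ≫ q = G.latchingHom r T ≫ γ := latchingObj_hom_ext fun j ↦ by
      rw [← Category.assoc, hb, hβγ, ← Category.assoc, latchingι_hom]
    have hab : G.latchingHom r Φ ≫ α = G.latchingObjMap r τ ≫ b :=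
      latchingObj_hom_ext fun j ↦ by
        rw [← Category.assoc, latchingι_hom, ← Category.assoc, latchingι_map, Category.assoc, hb,
          hαβ]
    have w : b₁ ≫ powerMap q _ = b₂ ≫ powerRestrict B (G.boundary r).ι :=
      power_hom_ext fun d x ↦ by
        rw [NatTrans.comp_app, NatTrans.comp_app, Category.assoc, powerMap_π, Category.assoc,
          powerRestrict_π, toPower_π, ← Category.assoc, toPower_π, Category.assoc, hbγ,
          ← Category.assoc, boundaryι_latchingHom]
        rfl
    have sq : CommSq a' τ (G.pullbackCotensor q r) (pullback.lift b₁ b₂ w) := ⟨by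
      apply pullback.hom_ext
      · rw [Category.assoc, pullbackCotensor, pullback.lift_fst, Category.assoc,
          pullback.lift_fst]
        refine power_hom_ext fun d x ↦ ?_
        rw [NatTrans.comp_app, NatTrans.comp_app, Category.assoc, powerRestrict_π, toPower_π,
          Category.assoc, toPower_π, ← Category.assoc, ← boundaryι_map, Category.assoc, ← hab,
          ← Category.assoc, boundaryι_latchingHom]
        rfl
      · rw [Category.assoc, pullbackCotensor, pullback.lift_snd, Category.assoc,
          pullback.lift_snd]
        refine power_hom_ext fun d x ↦ ?_
        rw [NatTrans.comp_app, NatTrans.comp_app, Category.assoc, powerMap_π, Category.assoc,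
          toPower_π, ← Category.assoc, toPower_π, Category.assoc, hα, τ.naturality_assoc]⟩
    have h₁ : sq.lift ≫ powerRestrict E (G.boundary r).ι = b₁ := by
      rw [← G.pullbackCotensor_fst r q, sq.fac_right_assoc, pullback.lift_fst]
    have h₂ : sq.lift ≫ powerMap q _ = b₂ := by
      rw [← G.pullbackCotensor_snd r q, sq.fac_right_assoc, pullback.lift_snd]
    -- Yoneda: the required morphism is the component at the identity of `r`.
    refine ⟨sq.lift.app r ≫ powerπ E (yoneda.obj r) (𝟙 r), ?_, fun j ↦ ?_, ?_⟩
    · rw [← Category.assoc, ← NatTrans.comp_app, sq.fac_left, toPower_π, Φ.map_id,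
        Category.id_comp]
    · have hj : G.deg (G.mid j.hom) < G.deg r := (G.deg_mid_le_left _).trans_lt j.deg_lt
      rw [← Category.assoc, sq.lift.naturality, Category.assoc, map_powerπ]
      refine Eq.trans ?_ ((congr_app h₁ j.left =≫
        powerπ E _ (G.boundaryMk j.hom hj)).trans ?_)
      · rw [NatTrans.comp_app, Category.assoc, powerRestrict_π]
        refine congrArg (fun t ↦ _ ≫ powerπ E (yoneda.obj r) t) ?_
        exact Category.comp_id j.hom
      · rw [toPower_π]
        exact (G.boundaryι_hom r T j hj =≫ b).trans (hb j)
    · rw [Category.assoc, ← powerMap_π, ← Category.assoc, ← NatTrans.comp_app, h₂, toPower_π,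
        T.map_id, Category.id_comp]
  · refine fun h ↦ ⟨fun {a b} sq ↦ ?_⟩
    let b₁ := b ≫ pullback.fst _ _
    let b₂ := b ≫ pullback.snd _ _
    have h₁ : a ≫ powerRestrict E (G.boundary r).ι = τ ≫ b₁ := by
      rw [← G.pullbackCotensor_fst r q, sq.w_assoc]
    have h₂ : a ≫ powerMap q _ = τ ≫ b₂ := by
      rw [← G.pullbackCotensor_snd r q, sq.w_assoc]
    have h₃ : b₁ ≫ powerMap q _ = b₂ ≫ powerRestrict B (G.boundary r).ι := by
      simp only [b₁, b₂, Category.assoc, pullback.condition]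
    have hid {A : R ⥤ M} {F : M} (f : A ⟶ power F (yoneda.obj r)) (d : R) (x : d ⟶ r) :
        A.map x ≫ f.app r ≫ powerπ F (yoneda.obj r) (𝟙 r) =
          f.app d ≫ powerπ F (yoneda.obj r) x := by
      rw [← Category.assoc, f.naturality, Category.assoc, map_powerπ]
      exact congrArg (fun t ↦ _ ≫ powerπ F (yoneda.obj r) t) (Category.comp_id x)
    have hlt (j : G.LatchingIndex r) : G.deg (G.mid j.hom) < G.deg r :=
      (G.deg_mid_le_left _).trans_lt j.deg_lt
    obtain ⟨l, hl₁, hl₂, hl₃⟩ := h (a.app r ≫ powerπ E (yoneda.obj r) (𝟙 r))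
      (fun j ↦ b₁.app j.left ≫ powerπ E _ (G.boundaryMk j.hom (hlt j)))
      (b₂.app r ≫ powerπ B (yoneda.obj r) (𝟙 r))
      (fun i j t ↦ by
        rw [← Category.assoc, b₁.naturality, Category.assoc, map_powerπ]
        exact congrArg (fun t ↦ _ ≫ powerπ E _ t) (Subtype.ext t.w))
      (fun j ↦ by
        rw [hid, ← Category.assoc, ← NatTrans.comp_app, ← h₁, NatTrans.comp_app,
          Category.assoc, powerRestrict_π]
        rfl)
      (by rw [Category.assoc, ← powerMap_π, ← Category.assoc, ← NatTrans.comp_app, h₂,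
          NatTrans.comp_app, Category.assoc])
      (fun j ↦ by
        rw [hid, Category.assoc, ← powerMap_π, ← Category.assoc, ← NatTrans.comp_app, h₃,
          NatTrans.comp_app, Category.assoc, powerRestrict_π]
        rfl)
    refine ⟨⟨toPower (fun d x ↦ T.map x ≫ l) (fun d d' f x ↦ by simp), ?_, ?_⟩⟩
    · refine power_hom_ext fun d x ↦ ?_
      rw [NatTrans.comp_app, Category.assoc, toPower_π, ← τ.naturality_assoc, hl₁, hid]
    · apply pullback.hom_ext
      · rw [Category.assoc, pullbackCotensor, pullback.lift_fst]
        refine power_hom_ext fun d x ↦ ?_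
        rw [NatTrans.comp_app, Category.assoc, powerRestrict_π, toPower_π]
        -- A boundary element factors as a morphism of `R⁻` followed by a latching index, where
        -- `hl₂` applies.
        have hx := deg_mid_lt_of_boundary x
        have := hl₂ ⟨_, _, G.plus_facPlus (a := d) (b := r) x.1, hx⟩
        change T.map (Y := r) x.1 ≫ l = b₁.app d ≫ _
        rw [← G.fac (a := d) (b := r) x.1, T.map_comp, Category.assoc, this, ← Category.assoc,
          b₁.naturality, Category.assoc, map_powerπ]
        exact congrArg (fun t ↦ _ ≫ powerπ E _ t) (Subtype.ext (G.fac (a := d) (b := r) x.1))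
      · rw [Category.assoc, pullbackCotensor, pullback.lift_snd]
        refine power_hom_ext fun d x ↦ ?_
        rw [NatTrans.comp_app, Category.assoc, powerMap_π, ← Category.assoc, toPower_π,
          Category.assoc, hl₃, hid]

end GeneralizedReedyStructure

end GenReedy

namespace GenReedy

namespace GeneralizedReedyStructure

/-! ### Representatives of isomorphism classes -/

section Representatives

variable {R : Type w} [SmallCategory.{w} R]

/-- A chosen representative of the isomorphism class of an object. -/
noncomputable def rep (a : R) : R :=
  (Quotient.mk (isIsomorphicSetoid R) a).out

/-- The isomorphism from an object to the chosen representative of its isomorphism class. -/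
noncomputable def repIso (a : R) : a ≅ rep a :=
  ((isIsomorphicSetoid R).symm (Quotient.mk_out (s := isIsomorphicSetoid R) a)).some

lemma rep_eq_of_iso {a b : R} (e : a ≅ b) : rep a = rep b :=
  congrArg (Quotient.out (s := isIsomorphicSetoid R)) (Quotient.sound ⟨e⟩)

end Representatives

variable {R : Type w} [SmallCategory.{w} R] (G : GeneralizedReedyStructure R)

lemma deg_rep (a : R) : G.deg (rep a) = G.deg a := (G.deg_eq_of_iso (repIso a)).symm

variable {M : Type u} [Category.{v} M]

/-! ### Lifting properties for diagrams -/

/-- A solution of a lifting problem on the objects of degree less than `n`. -/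
structure PartialLift {A B X Y : R ⥤ M} (τ : A ⟶ B) (π : X ⟶ Y) (α : A ⟶ X) (β : B ⟶ Y)
    (n : ℕ) where
  /-- the components of the partial lift -/
  app (d : R) (hd : G.deg d < n) : B.obj d ⟶ X.obj d
  naturality {a b : R} (f : a ⟶ b) (ha : G.deg a < n) (hb : G.deg b < n) :
    B.map f ≫ app b hb = app a ha ≫ X.map f
  fac_left (d : R) (hd : G.deg d < n) : τ.app d ≫ app d hd = α.app d
  fac_right (d : R) (hd : G.deg d < n) : app d hd ≫ π.app d = β.app d

variable [HasColimitsOfSize.{w, w} M] [HasPushouts M]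

section

variable {G} {A B X Y : R ⥤ M} {τ : A ⟶ B} {π : X ⟶ Y} {α : A ⟶ X} {β : B ⟶ Y} {n : ℕ}

/-- The partial lift and `α` give a morphism from the latching pushout to `X.obj r`; the partial
lift and `β` give one from `B.obj r` to the matching pullback. Both are equivariant, so the sought
component is a diagonal between the relative latching and relative matching maps. -/
lemma PartialLift.exists_equivariant (w : α ≫ π = τ ≫ β) (l : G.PartialLift τ π α β n)
    (L : MorphismProperty M) (r : R) (hr : G.deg r = n)
    (hτ : L ((G.relativeLatchingMap r τ).app (SingleObj.star _)))
    (hπ : G.HasMatchingLift r π ((restrictAut r).map π) (fun j ↦ X.map j.hom) L) :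
    ∃ m : B.obj r ⟶ X.obj r, τ.app r ≫ m = α.app r ∧ m ≫ π.app r = β.app r ∧
      (∀ i : G.LatchingIndex r, B.map i.hom ≫ m = l.app i.left (hr ▸ i.deg_lt) ≫ X.map i.hom) ∧
      (∀ i : G.MatchingIndex r, m ≫ X.map i.hom = B.map i.hom ≫ l.app i.right (hr ▸ i.deg_lt)) ∧
      ∀ e : r ≅ r, B.map e.hom ≫ m = m ≫ X.map e.hom := by
  have P := G.isPushout_latchingPushout r τ
  let b₀ : G.latchingObj r B ⟶ X.obj r := G.latchingDesc r B
    (fun i ↦ l.app i.left (hr ▸ i.deg_lt) ≫ X.map i.hom) (fun i j f ↦ by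
      rw [← Category.assoc, l.naturality f.hom (hr ▸ i.deg_lt), Category.assoc, ← X.map_comp, f.w])
  have hb₀ (i) : G.latchingι r B i ≫ b₀ = l.app i.left (hr ▸ i.deg_lt) ≫ X.map i.hom :=
    G.latchingι_desc ..
  let b : (G.latchingFunctor r).obj B ⟶ (restrictAut r).obj X :=
    { app _ := b₀
      naturality _ _ e := by
        refine latchingObj_hom_ext fun i ↦ ?_
        change _ ≫ G.latchingAct r B e ≫ b₀ = _ ≫ b₀ ≫ X.map (Iso.hom e)
        rw [← Category.assoc, latchingι_act, hb₀, ← Category.assoc, hb₀, Category.assoc,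
          ← X.map_comp] }
  have w' : (G.latchingMap r).app A ≫ (restrictAut r).map α =
      (G.latchingFunctor r).map τ ≫ b := by
    ext ⟨⟩
    refine latchingObj_hom_ext fun i ↦ ?_
    change _ ≫ G.latchingHom r A ≫ α.app r = _ ≫ G.latchingObjMap r τ ≫ b₀
    rw [← Category.assoc, latchingι_hom, ← Category.assoc, latchingι_map, Category.assoc, hb₀,
      ← Category.assoc, l.fac_left, α.naturality]
  let a : G.latchingPushout r τ ⟶ (restrictAut r).obj X :=
    pushout.desc ((restrictAut r).map α) b w'
  have ha₁ : G.latchingPushoutInl r τ ≫ a.app (SingleObj.star _) = α.app r :=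
    congr_app (pushout.inl_desc _ _ w') (SingleObj.star _)
  have ha₂ : G.latchingPushoutInr r τ ≫ a.app (SingleObj.star _) = b₀ :=
    congr_app (pushout.inr_desc _ _ w') (SingleObj.star _)
  have hl₁ : G.latchingPushoutInl r τ ≫ (G.relativeLatchingMap r τ).app (SingleObj.star _) =
      τ.app r :=
    congr_app (pushout.inl_desc (f := (G.latchingMap r).app A) (g := (G.latchingFunctor r).map τ)
      _ _ _) (SingleObj.star _)
  have hl₂ : G.latchingPushoutInr r τ ≫ (G.relativeLatchingMap r τ).app (SingleObj.star _) =
      G.latchingHom r B :=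
    congr_app (pushout.inr_desc (f := (G.latchingMap r).app A) (g := (G.latchingFunctor r).map τ)
      _ _ _) (SingleObj.star _)
  obtain ⟨m, hm₁, hm₂, hm₃⟩ := hπ (G.relativeLatchingMap r τ) (fun _ ↦ hτ) a
    (fun i ↦ B.map i.hom ≫ l.app i.right (hr ▸ i.deg_lt)) ((restrictAut r).map β)
    (fun i j f ↦ by
      rw [Category.assoc, ← l.naturality f.hom (hr ▸ i.deg_lt) (hr ▸ j.deg_lt), ← Category.assoc,
        ← B.map_comp, f.w])
    (fun e i ↦ by
      change B.map (Iso.hom e) ≫ _ = B.map (Iso.hom e ≫ i.hom) ≫ _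
      rw [B.map_comp, Category.assoc])
    (fun i ↦ by
      rw [Category.assoc, l.fac_right]
      exact β.naturality _)
    (fun i ↦ by
      refine P.hom_ext ?_ (latchingObj_hom_ext fun j ↦ ?_)
      · rw [← Category.assoc]
        erw [hl₁]
        rw [← Category.assoc, ← τ.naturality, Category.assoc, l.fac_left, ← Category.assoc]
        erw [ha₁]
        exact α.naturality _
      · rw [← Category.assoc (G.latchingPushoutInr r τ)]
        erw [hl₂]
        rw [← Category.assoc, latchingι_hom, ← Category.assoc, ← B.map_comp,
          l.naturality _ (hr ▸ j.deg_lt) (hr ▸ i.deg_lt),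
          ← Category.assoc (G.latchingPushoutInr r τ)]
        erw [ha₂]
        rw [← Category.assoc, hb₀, Category.assoc, X.map_comp])
    (by
      refine NatTrans.ext (funext fun _ ↦ ?_)
      refine P.hom_ext ?_ (latchingObj_hom_ext fun j ↦ ?_)
      · refine (Category.assoc _ _ _).symm.trans (Eq.trans ?_ (Category.assoc _ _ _))
        refine (congrArg (· ≫ _) hl₁).trans (Eq.trans ?_ (congrArg (· ≫ _) ha₁.symm))
        exact (congr_app w r).symm
      · refine (congrArg (G.latchingι r B j ≫ ·) ((Category.assoc _ _ _).symm.trans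
          (congrArg (· ≫ _) hl₂))).trans (Eq.trans ?_ (congrArg (G.latchingι r B j ≫ ·)
          ((Category.assoc _ _ _).symm.trans (congrArg (· ≫ _) ha₂))).symm)
        change _ ≫ G.latchingHom r B ≫ β.app r = _ ≫ b₀ ≫ π.app r
        rw [← Category.assoc, latchingι_hom, ← Category.assoc, hb₀, Category.assoc, π.naturality,
          ← Category.assoc, l.fac_right, β.naturality])
  refine ⟨m.app (SingleObj.star _), ?_, congr_app hm₃ (SingleObj.star _), fun i ↦ ?_, hm₂,
    fun e ↦ ?_⟩
  · exact (congrArg (· ≫ _) hl₁.symm).trans ((Category.assoc _ _ _).trans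
      ((congrArg _ (congr_app hm₁ (SingleObj.star _))).trans ha₁))
  · have : G.latchingHom r B ≫ m.app (SingleObj.star _) = b₀ :=
      (congrArg (· ≫ _) hl₂.symm).trans ((Category.assoc _ _ _).trans
        ((congrArg _ (congr_app hm₁ (SingleObj.star _))).trans ha₂))
    rw [← hb₀, ← this, ← Category.assoc, latchingι_hom]
  · exact m.naturality (X := SingleObj.star _) (Y := SingleObj.star _) e

/-- Naturality in degree `n` has two sources: morphisms through lower degree are governed by the
latching and matching compatibilities, and isomorphisms by equivariance. -/
lemma PartialLift.exists_succ (w : α ≫ π = τ ≫ β) (l : G.PartialLift τ π α β n)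
    (L : MorphismProperty M)
    (hτ : ∀ r, G.deg r = n → L ((G.relativeLatchingMap r τ).app (SingleObj.star _)))
    (hπ : ∀ r, G.deg r = n →
      G.HasMatchingLift r π ((restrictAut r).map π) (fun j ↦ X.map j.hom) L) :
    ∃ l' : G.PartialLift τ π α β (n + 1), ∀ d (hd : G.deg d < n),
      l'.app d (hd.trans n.lt_succ_self) = l.app d hd := by
  choose m hm₁ hm₂ hm₃ hm₄ hm₅ using fun r hr ↦
    PartialLift.exists_equivariant w l L r hr (hτ r hr) (hπ r hr)
  have hm₃' {c r : R} (v : c ⟶ r) (hc : G.deg c < n) (hr : G.deg r = n) :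
      B.map v ≫ m r hr = l.app c hc ≫ X.map v := by
    have h := (G.deg_mid_le_left v).trans_lt hc
    have := hm₃ r hr ⟨_, _, G.plus_facPlus v, h.trans_eq hr.symm⟩
    dsimp only at this
    rw [← G.fac v, B.map_comp, Category.assoc, this, ← Category.assoc,
      l.naturality _ hc h, X.map_comp, Category.assoc]
  have hm₄' {c r : R} (v : r ⟶ c) (hc : G.deg c < n) (hr : G.deg r = n) :
      m r hr ≫ X.map v = B.map v ≫ l.app c hc := by
    have h := (G.deg_mid_le_right v).trans_lt hc
    have := hm₄ r hr ⟨_, _, G.minus_facMinus v, h.trans_eq hr.symm⟩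
    dsimp only at this
    rw [← G.fac v, X.map_comp, ← Category.assoc, this, Category.assoc,
      ← l.naturality _ h hc, B.map_comp, Category.assoc]
  have hm₅' {r r' : R} (h : r = r') (hr : G.deg r = n) (hr' : G.deg r' = n) (e : r ≅ r') :
      B.map e.hom ≫ m r' hr' = m r hr ≫ X.map e.hom := by
    subst h
    exact hm₅ r hr e
  -- The lifts `m` chosen at distinct isomorphic objects are unrelated. Only those at the chosen
  -- representatives are kept, and they are transported along `repIso`; equivariance at the
  -- representative then gives naturality for all isomorphisms.
  let k (d : R) (hd : G.deg d = n) : B.obj d ⟶ X.obj d :=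
    B.map (repIso d).hom ≫ m (rep d) ((G.deg_rep d).trans hd) ≫ X.map (repIso d).inv
  have hk₁ (d : R) (hd : G.deg d = n) : τ.app d ≫ k d hd = α.app d := by
    simp [k, ← τ.naturality_assoc, reassoc_of% (hm₁ (rep d) ((G.deg_rep d).trans hd))]
  have hk₂ (d : R) (hd : G.deg d = n) : k d hd ≫ π.app d = β.app d := by
    simp [k, reassoc_of% (hm₂ (rep d) ((G.deg_rep d).trans hd))]
  have hk₃ {c d : R} (v : c ⟶ d) (hc : G.deg c < n) (hd : G.deg d = n) :
      B.map v ≫ k d hd = l.app c hc ≫ X.map v := by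
    dsimp only [k]
    rw [← Category.assoc, ← Category.assoc, ← B.map_comp, hm₃' _ hc, Category.assoc,
      ← X.map_comp, Category.assoc, Iso.hom_inv_id, Category.comp_id]
  have hk₄ {c d : R} (v : d ⟶ c) (hc : G.deg c < n) (hd : G.deg d = n) :
      k d hd ≫ X.map v = B.map v ≫ l.app c hc := by
    dsimp only [k]
    rw [Category.assoc, Category.assoc, ← X.map_comp, hm₄' _ hc, ← Category.assoc,
      ← B.map_comp, Iso.hom_inv_id_assoc]
  have hk₅ {a b : R} (e : a ≅ b) (ha : G.deg a = n) (hb : G.deg b = n) :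
      B.map e.hom ≫ k b hb = k a ha ≫ X.map e.hom := by
    have := hm₅' (rep_eq_of_iso e) ((G.deg_rep a).trans ha) ((G.deg_rep b).trans hb)
      ((repIso a).symm ≪≫ e ≪≫ repIso b)
    simp only [Iso.trans_hom, Iso.symm_hom, Functor.map_comp, Category.assoc] at this
    rw [← cancel_epi (B.map (repIso a).inv), ← cancel_mono (X.map (repIso b).hom)]
    dsimp only [k]
    simpa using this
  classical
  let app (d : R) (hd : G.deg d < n + 1) : B.obj d ⟶ X.obj d :=
    if h : G.deg d < n then l.app d h else k d (by omega)
  have app_lt {d : R} (hd : G.deg d < n + 1) (h : G.deg d < n) : app d hd = l.app d h := dif_pos h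
  have app_eq {d : R} (hd : G.deg d < n + 1) (h : G.deg d = n) : app d hd = k d h :=
    dif_neg (by omega)
  refine ⟨⟨app, fun {a b} f ha hb ↦ ?_, fun d hd ↦ ?_, fun d hd ↦ ?_⟩,
    fun d hd ↦ app_lt (by omega) hd⟩
  · obtain ha' | ha' := Nat.lt_succ_iff_lt_or_eq.1 ha
    · obtain hb' | hb' := Nat.lt_succ_iff_lt_or_eq.1 hb
      · rw [app_lt ha ha', app_lt hb hb', l.naturality]
      · rw [app_lt ha ha', app_eq hb hb', hk₃ _ ha' hb']
    · obtain hb' | hb' := Nat.lt_succ_iff_lt_or_eq.1 hb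
      · rw [app_eq ha ha', app_lt hb hb', hk₄ _ hb' ha']
      · rw [app_eq ha ha', app_eq hb hb']
        by_cases hf : G.deg (G.mid f) < n
        · rw [← G.fac f, B.map_comp, X.map_comp, Category.assoc, hk₃ _ hf hb', ← Category.assoc,
            ← hk₄ _ hf ha', Category.assoc]
        · have := G.isIso_of_deg_le_mid f ha'.le hb'.le (not_lt.1 hf)
          exact hk₅ (asIso f) ha' hb'
  · obtain h | h := Nat.lt_succ_iff_lt_or_eq.1 hd
    · rw [app_lt hd h, l.fac_left]
    · rw [app_eq hd h, hk₁ d h]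
  · obtain h | h := Nat.lt_succ_iff_lt_or_eq.1 hd
    · rw [app_lt hd h, l.fac_right]
    · rw [app_eq hd h, hk₂ d h]

/-- The hypotheses are restricted to degrees below `n` because, for maps of latching objects at `r`,
they are available only below `deg r`. -/
lemma exists_partialLift (w : α ≫ π = τ ≫ β) (L : MorphismProperty M) (n : ℕ)
    (hτ : ∀ r, G.deg r < n → L ((G.relativeLatchingMap r τ).app (SingleObj.star _)))
    (hπ : ∀ r, G.deg r < n →
      G.HasMatchingLift r π ((restrictAut r).map π) (fun j ↦ X.map j.hom) L) :
    Nonempty (G.PartialLift τ π α β n) := by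
  induction n with
  | zero =>
    exact ⟨fun _ h ↦ (Nat.not_lt_zero _ h).elim, fun _ h ↦ (Nat.not_lt_zero _ h).elim,
      fun _ h ↦ (Nat.not_lt_zero _ h).elim, fun _ h ↦ (Nat.not_lt_zero _ h).elim⟩
  | succ n hn =>
    obtain ⟨l⟩ := hn (fun r hr ↦ hτ r (hr.trans n.lt_succ_self))
      (fun r hr ↦ hπ r (hr.trans n.lt_succ_self))
    exact ⟨(PartialLift.exists_succ w l L (fun r hr ↦ hτ r (hr.trans_lt n.lt_succ_self))
      (fun r hr ↦ hπ r (hr.trans_lt n.lt_succ_self))).choose⟩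

lemma hasLiftingProperty_of_relative (L : MorphismProperty M)
    (hτ : ∀ r, L ((G.relativeLatchingMap r τ).app (SingleObj.star _)))
    (hπ : ∀ r, G.HasMatchingLift r π ((restrictAut r).map π) (fun j ↦ X.map j.hom) L) :
    HasLiftingProperty τ π := by
  refine ⟨fun {α β} sq ↦ ?_⟩
  let next (n : ℕ) (l : G.PartialLift τ π α β n) :=
    PartialLift.exists_succ sq.w l L (fun r _ ↦ hτ r) (fun r _ ↦ hπ r)
  -- Each partial lift is chosen as an extension of the preceding one, so that the component at `d`
  -- can be read off at stage `deg d + 1`, the first where it is defined.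
  let l (n : ℕ) : G.PartialLift τ π α β n := Nat.rec
    ⟨fun _ h ↦ (Nat.not_lt_zero _ h).elim, fun _ h ↦ (Nat.not_lt_zero _ h).elim,
      fun _ h ↦ (Nat.not_lt_zero _ h).elim, fun _ h ↦ (Nat.not_lt_zero _ h).elim⟩
    (fun n l ↦ (next n l).choose) n
  have hl (n : ℕ) (d : R) (hd : G.deg d < n) :
      (l (n + 1)).app d (hd.trans n.lt_succ_self) = (l n).app d hd :=
    (next n (l n)).choose_spec d hd
  have hl' (n : ℕ) (d : R) (hd : G.deg d < n) :
      (l n).app d hd = (l (G.deg d + 1)).app d (Nat.lt_succ_self _) := by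
    induction n, Nat.succ_le_of_lt hd using Nat.le_induction with
    | base => rfl
    | succ k hk hk' => exact (hl k d (by omega)).trans (hk' (by omega))
  refine ⟨⟨⟨fun d ↦ (l (G.deg d + 1)).app d (Nat.lt_succ_self _), fun a b f ↦ ?_⟩, ?_, ?_⟩⟩
  · have ha : G.deg a < max (G.deg a) (G.deg b) + 1 := by omega
    have hb : G.deg b < max (G.deg a) (G.deg b) + 1 := by omega
    rw [← hl' _ a ha, ← hl' _ b hb, (l _).naturality]
  · exact NatTrans.ext (funext fun d ↦ (l (G.deg d + 1)).fac_left d (Nat.lt_succ_self _))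
  · exact NatTrans.ext (funext fun d ↦ (l (G.deg d + 1)).fac_right d (Nat.lt_succ_self _))

end

end GeneralizedReedyStructure

end GenReedy

namespace GenReedy

namespace GeneralizedReedyStructure

variable {R : Type w} [SmallCategory.{w} R] (G : GeneralizedReedyStructure R)

/-! ### Latching objects of relative cofibrations -/

variable {G} in
lemma IsDualizable.eq_of_comp_eq (hG : G.IsDualizable) {a b : R} {f : a ⟶ b} (hf : G.plus f)
    {e e' : a ≅ a} (h : e.hom ≫ f = e'.hom ≫ f) : e = e' := by
  have := hG f hf (e'.symm ≪≫ e) (by simp [h])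
  rw [← Iso.refl_trans e, ← Iso.self_symm_id e', Iso.trans_assoc, this, Iso.trans_refl]

section AutMap

variable {M : Type u} [Category.{v} M] {r : R}

/-- The action of an automorphism of `r` on the underlying object of an `Aut r`-object. -/
abbrev autMap (D : SingleObj (Aut r) ⥤ M) (e : r ≅ r) :
    D.obj (SingleObj.star _) ⟶ D.obj (SingleObj.star _) :=
  D.map (X := SingleObj.star _) (Y := SingleObj.star _) (show Aut r from e)

lemma autMap_refl (D : SingleObj (Aut r) ⥤ M) : autMap D (Iso.refl r) = 𝟙 _ :=
  D.map_id (SingleObj.star _)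

lemma autMap_trans (D : SingleObj (Aut r) ⥤ M) (e e' : r ≅ r) :
    autMap D (e ≪≫ e') = autMap D e ≫ autMap D e' :=
  D.map_comp (X := SingleObj.star _) (Y := SingleObj.star _) (Z := SingleObj.star _)
    (show Aut r from e) (show Aut r from e')

lemma autMap_naturality {A D : SingleObj (Aut r) ⥤ M} (f : A ⟶ D) (e : r ≅ r) :
    autMap A e ≫ f.app (SingleObj.star _) = f.app (SingleObj.star _) ≫ autMap D e :=
  f.naturality _

end AutMap

/-- Two morphisms with the same source are equivalent if they differ by an automorphism
of the source. -/
def autSetoid (s r : R) : Setoid (s ⟶ r) where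
  r x y := ∃ e : s ≅ s, e.hom ≫ y = x
  iseqv :=
    { refl x := ⟨Iso.refl s, by simp⟩
      symm := by
        rintro x y ⟨e, rfl⟩
        exact ⟨e.symm, by simp⟩
      trans := by
        rintro x y z ⟨e, rfl⟩ ⟨e', rfl⟩
        exact ⟨e ≪≫ e', by simp⟩ }

/-- If automorphisms act freely on the morphisms of `R⁺`, one may choose equivariantly an
automorphism for each such morphism. -/
lemma IsDualizable.exists_equivariant_choice {G : GeneralizedReedyStructure R}
    (hG : G.IsDualizable) (s r : R) :
    ∃ (o : (s ⟶ r) → (s ⟶ r)) (a : (s ⟶ r) → (s ≅ s)), (∀ x, (a x).hom ≫ o x = x) ∧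
      (∀ (e : s ≅ s) (x : s ⟶ r), o (e.hom ≫ x) = o x) ∧
      ∀ (e : s ≅ s) (x : s ⟶ r), G.plus x → a (e.hom ≫ x) = e ≪≫ a x := by
  let o (x : s ⟶ r) : s ⟶ r := (Quotient.mk (autSetoid s r) x).out
  have ho (x : s ⟶ r) : ∃ e : s ≅ s, e.hom ≫ o x = x :=
    (autSetoid s r).symm (Quotient.mk_out (s := autSetoid s r) x)
  choose a ha using ho
  have ho' (e : s ≅ s) (x : s ⟶ r) : o (e.hom ≫ x) = o x :=
    congrArg (Quotient.out (s := autSetoid s r)) (Quotient.sound ⟨e, rfl⟩)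
  refine ⟨o, a, ha, ho', fun e x hx ↦ ?_⟩
  have hx' : G.plus (o x) := by
    have : o x = (a x).inv ≫ x := by rw [← cancel_epi (a x).hom, ha, Iso.hom_inv_id_assoc]
    rw [this]
    exact G.plus.comp_mem _ _ (G.plus_hom (a x).symm) hx
  -- Both automorphisms carry the representative `o x` to `e.hom ≫ x`, and the action on morphisms
  -- of `R⁺` is free.
  exact hG.eq_of_comp_eq hx' (by
    rw [← ho' e x, ha, ho', Iso.trans_hom, Category.assoc, ha])

variable {M : Type u} [Category.{v} M] [HasLimitsOfSize.{w, w} M]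

/-- As `deg s < deg r`, every morphism `s ⟶ r` lies in the boundary, so a lift is a family indexed
by all of them. The components that factor through degree below `deg s` are prescribed by the
matching data; the others are indexed by morphisms of `R⁺`, on which `Aut s` acts freely, so they
amount to one non-equivariant lift against `q` per orbit. -/
lemma hasMatchingLift_powerMap_boundary (hG : G.IsDualizable) (r s : R) (hs : G.deg s < G.deg r)
    {E B : M} (q : E ⟶ B) (L : MorphismProperty M)
    (hL : ∀ ⦃A D : M⦄ (f : A ⟶ D), L f → HasLiftingProperty f q) :
    G.HasMatchingLift s (powerMap q (G.boundary r).toFunctor)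
      ((restrictAut s).map (powerMap q (G.boundary r).toFunctor))
      (fun j ↦ (power E (G.boundary r).toFunctor).map j.hom) L := by
  intro A D f hf α β γ hβ hβ' hβγ hαβ hα
  let el {d : R} (hd : G.deg d < G.deg r) (x : d ⟶ r) :
      (G.boundary r).toFunctor.obj (Opposite.op d) :=
    G.boundaryMk x ((G.deg_mid_le_left x).trans_lt hd)
  have map_el {F : M} {d d' : R} (hd : G.deg d < G.deg r) (hd' : G.deg d' < G.deg r)
      (k : d ⟶ d') (x : d' ⟶ r) (y : d ⟶ r) (h : k ≫ x = y) :
      (power F (G.boundary r).toFunctor).map k ≫ powerπ F _ (el hd' x) =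
        powerπ F _ (el hd y) := by
    rw [map_powerπ]
    exact congrArg (powerπ F _) (Subtype.ext h)
  obtain ⟨o, a, hao, ho, ha⟩ := hG.exists_equivariant_choice s r
  have hj {j : G.MatchingIndex s} : G.deg j.right < G.deg r := j.deg_lt.trans hs
  have hm (x : s ⟶ r) : ∃ m : D.obj (SingleObj.star _) ⟶ E,
      f.app (SingleObj.star _) ≫ m = α.app (SingleObj.star _) ≫ powerπ E _ (el hs x) ∧
        m ≫ q = γ.app (SingleObj.star _) ≫ powerπ B _ (el hs x) := by
    have := hL _ (hf (SingleObj.star _))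
    have sq : CommSq (α.app (SingleObj.star _) ≫ powerπ E _ (el hs x))
        (f.app (SingleObj.star _)) q (γ.app (SingleObj.star _) ≫ powerπ B _ (el hs x)) := ⟨by
      rw [Category.assoc, ← powerMap_π, ← Category.assoc, ← Category.assoc]
      exact (congrArg (· ≫ _) (congr_app hα (SingleObj.star _))).symm⟩
    exact ⟨sq.lift, sq.fac_left, sq.fac_right⟩
  choose m hm₁ hm₂ using hm
  classical
  -- The component at `x` is forced by `β` in the first case; in the second, the lift at the orbit
  -- representative `o x` is translated by the automorphism `a x`.
  let l (x : s ⟶ r) : D.obj (SingleObj.star _) ⟶ E :=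
    if h : G.deg (G.mid x) < G.deg s then
      β ⟨_, _, G.minus_facMinus x, h⟩ ≫ powerπ E _ (el (h.trans hs) (G.facPlus x))
    else autMap D (a x) ≫ m (o x)
  have l_low (j : G.MatchingIndex s) (y : j.right ⟶ r) {x : s ⟶ r} (hx : j.hom ≫ y = x) :
      l x = β j ≫ powerπ E _ (el hj y) := by
    have h : G.deg (G.mid x) < G.deg s := by
      rw [← hx]
      exact (G.deg_mid_comp_le _ _).trans_lt j.deg_lt
    let k : G.MatchingIndex s := ⟨G.mid y, j.hom ≫ G.facMinus y,
      G.minus.comp_mem _ _ j.minus_hom (G.minus_facMinus _),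
      (G.deg_mid_le_left y).trans_lt j.deg_lt⟩
    obtain ⟨e, he, he'⟩ := G.exists_iso_mid x k.hom (G.facPlus y) k.minus_hom (G.plus_facPlus y)
      (by simp [k, hx])
    rw [show l x = _ from dif_pos h, ← map_el hj ((G.deg_mid_le_left y).trans_lt hj)
      (G.facMinus y) (G.facPlus y) y (G.fac y), ← Category.assoc]
    have h₁ := hβ j k ⟨G.facMinus y, G.minus_facMinus y, rfl⟩
    have h₂ := hβ ⟨_, _, G.minus_facMinus x, h⟩ k ⟨e.hom, G.minus_hom e, he⟩
    dsimp only [k] at h₁ h₂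
    rw [h₁, ← h₂, Category.assoc, map_el (h.trans hs) (k.deg_lt.trans hs) _ _ _ he']
  have l_high (x : s ⟶ r) (hx : ¬ G.deg (G.mid x) < G.deg s) :
      l x = autMap D (a x) ≫ m (o x) := dif_neg hx
  have l_act (e : s ≅ s) (x : s ⟶ r) : l (e.hom ≫ x) = autMap D e ≫ l x := by
    by_cases hx : G.deg (G.mid x) < G.deg s
    · let j : G.MatchingIndex s := ⟨_, _, G.minus_facMinus x, hx⟩
      rw [l_low j (G.facPlus x) (G.fac x), ← Category.assoc,
        show autMap D e ≫ β j = _ from hβ' e j,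
        l_low (j.precomp e) (G.facPlus x) (by simp [j])]
    -- The `R⁻` part of `x` does not lower the degree, hence is invertible; so `x` is in `R⁺`, where
    -- the choice of `a` is equivariant.
    · have hx' : G.plus x := by
        have := isIso_of_minus (G.minus_facMinus x) (by omega)
        rw [← G.fac x]
        exact G.plus.comp_mem _ _ (G.plus_hom (asIso (G.facMinus x))) (G.plus_facPlus x)
      have hx'' : ¬ G.deg (G.mid (e.hom ≫ x)) < G.deg s := fun h ↦ hx (by
        have := G.deg_mid_comp_le_right e.inv (e.hom ≫ x)
        rw [Iso.inv_hom_id_assoc] at this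
        exact this.trans_lt h)
      rw [l_high _ hx, l_high _ hx'', ha e x hx', ho, ← Category.assoc, autMap_trans]
  have l_left (x : s ⟶ r) : f.app (SingleObj.star _) ≫ l x =
      α.app (SingleObj.star _) ≫ powerπ E _ (el hs x) := by
    by_cases hx : G.deg (G.mid x) < G.deg s
    · rw [l_low ⟨_, _, G.minus_facMinus x, hx⟩ (G.facPlus x) (G.fac x), ← Category.assoc, hαβ,
        Category.assoc]
      exact congrArg _ (map_el hs (hx.trans hs) _ _ _ (G.fac x))
    · rw [l_high _ hx, ← Category.assoc, ← autMap_naturality, Category.assoc, hm₁, ← Category.assoc,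
        autMap_naturality, Category.assoc]
      exact congrArg _ (map_el hs hs _ _ _ (hao x))
  have l_right (x : s ⟶ r) : l x ≫ q =
      γ.app (SingleObj.star _) ≫ powerπ B _ (el hs x) := by
    by_cases hx : G.deg (G.mid x) < G.deg s
    · rw [l_low ⟨_, _, G.minus_facMinus x, hx⟩ (G.facPlus x) (G.fac x), Category.assoc,
        ← powerMap_π, ← Category.assoc, hβγ, Category.assoc]
      exact congrArg _ (map_el hs (hx.trans hs) _ _ _ (G.fac x))
    · rw [l_high _ hx, Category.assoc, hm₂, ← Category.assoc, autMap_naturality, Category.assoc]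
      exact congrArg _ (map_el hs hs _ _ _ (hao x))
  refine ⟨⟨fun _ ↦ powerLift (S := (G.boundary r).toFunctor) (d := s) fun x ↦ l x.1,
    fun _ _ e ↦ power_obj_hom_ext fun x ↦ ?_⟩, ?_, fun j ↦ power_obj_hom_ext fun y ↦ ?_, ?_⟩
  · rw [Category.assoc, powerLift_π, Category.assoc]
    refine (l_act e x.1).symm.trans ?_
    refine Eq.trans ?_ (congrArg _ (map_powerπ E _ e.hom x).symm)
    rw [powerLift_π]
    rfl
  · refine NatTrans.ext (funext fun _ ↦ power_obj_hom_ext fun x ↦ ?_)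
    rw [NatTrans.comp_app, Category.assoc, powerLift_π]
    exact l_left x.1
  · rw [Category.assoc, map_powerπ, powerLift_π]
    exact l_low j y.1 rfl
  · refine NatTrans.ext (funext fun _ ↦ power_obj_hom_ext fun x ↦ ?_)
    refine (Category.assoc _ _ _).trans ((congrArg _ (powerMap_π q _ x)).trans ?_)
    rw [← Category.assoc, powerLift_π]
    exact l_right x.1

variable [HasColimitsOfSize.{w, w} M] [HasPushouts M]

/-- Morphisms from the latching object to `E` transpose to morphisms to `E ⋔ ∂R(-, r)`, so the
lifting problem moves to diagrams, where induction on the degree applies. -/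
lemma latchingObjMap_mem_llp (hG : G.IsDualizable) (r : R) {Φ T : R ⥤ M} (τ : Φ ⟶ T)
    (Q : MorphismProperty M)
    (hτ : ∀ s, G.deg s < G.deg r →
      Q.llp ((G.relativeLatchingMap s τ).app (SingleObj.star _))) :
    Q.llp (G.latchingObjMap r τ) := by
  intro E B q hq
  refine ⟨fun {a b} sq ↦ ?_⟩
  let α : Φ ⟶ power E (G.boundary r).toFunctor :=
    toPower (fun d x ↦ G.boundaryι r Φ x.1 (deg_mid_lt_of_boundary x) ≫ a) (fun d d' f x ↦ by
      rw [← Category.assoc, map_boundaryι]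
      rfl)
  let β : T ⟶ power B (G.boundary r).toFunctor :=
    toPower (fun d x ↦ G.boundaryι r T x.1 (deg_mid_lt_of_boundary x) ≫ b) (fun d d' f x ↦ by
      rw [← Category.assoc, map_boundaryι]
      rfl)
  have w : α ≫ powerMap q _ = τ ≫ β := power_hom_ext fun d x ↦ by
    rw [NatTrans.comp_app, NatTrans.comp_app, Category.assoc, powerMap_π, Category.assoc,
      toPower_π, ← Category.assoc, toPower_π, Category.assoc, sq.w, ← Category.assoc,
      boundaryι_map, Category.assoc]
  -- A partial lift suffices, since the latching category only involves degrees below `deg r`.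
  obtain ⟨l⟩ := exists_partialLift w Q.llp (G.deg r) hτ (fun s hs ↦
    G.hasMatchingLift_powerMap_boundary hG r s hs q Q.llp (fun _ _ f hf ↦ hf q hq))
  have hlt (i : G.LatchingIndex r) : G.deg (G.mid i.hom) < G.deg r :=
    (G.deg_mid_le_left _).trans_lt i.deg_lt
  let c := G.latchingDesc r T
    (fun i ↦ l.app i.left i.deg_lt ≫ powerπ E _ (G.boundaryMk i.hom (hlt i))) (fun i j f ↦ by
      rw [← Category.assoc, l.naturality f.hom i.deg_lt j.deg_lt, Category.assoc, map_powerπ]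
      exact congrArg (fun t ↦ _ ≫ powerπ E _ t) (Subtype.ext f.w))
  have hc (i) : G.latchingι r T i ≫ c =
      l.app i.left i.deg_lt ≫ powerπ E _ (G.boundaryMk i.hom (hlt i)) := G.latchingι_desc ..
  refine ⟨⟨c, latchingObj_hom_ext fun i ↦ ?_, latchingObj_hom_ext fun i ↦ ?_⟩⟩
  · rw [← Category.assoc, latchingι_map, Category.assoc, hc, ← Category.assoc, l.fac_left,
      toPower_π]
    exact congrArg (· ≫ a) (G.boundaryι_hom r Φ i (hlt i))
  · rw [← Category.assoc, hc, Category.assoc, ← powerMap_π, ← Category.assoc, l.fac_right,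
      toPower_π]
    exact congrArg (· ≫ b) (G.boundaryι_hom r T i (hlt i))

lemma latchingPushoutInl_mem_llp (hG : G.IsDualizable) (r : R) {Φ T : R ⥤ M} (τ : Φ ⟶ T)
    (Q : MorphismProperty M)
    (hτ : ∀ s, G.deg s < G.deg r →
      Q.llp ((G.relativeLatchingMap s τ).app (SingleObj.star _))) :
    Q.llp (G.latchingPushoutInl r τ) :=
  MorphismProperty.of_isPushout (G.isPushout_latchingPushout r τ)
    (G.latchingObjMap_mem_llp hG r τ Q hτ)

end GeneralizedReedyStructure

end GenReedy

namespace GenReedy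

/-! ### Extension of a factorization from a full subcategory -/

/-- The middle object is the pullback of the right Kan extension of `F` along the unit from `Ψ` to
the right Kan extension of its own restriction. The subcategory being full, Kan extending and then
restricting changes nothing, so the pullback restricts to `F`. -/
lemma exists_extension_of_factorization {R : Type w} [SmallCategory.{w} R] {M : Type u}
    [Category.{v} M] [HasLimitsOfSize.{w, w} M] [HasPullbacks M] (D : ObjectProperty R)
    {Φ Ψ : R ⥤ M} (τ : Φ ⟶ Ψ) {F : D.FullSubcategory ⥤ M} (s : D.ι ⋙ Φ ⟶ F) (t : F ⟶ D.ι ⋙ Ψ)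
    (h : s ≫ t = Functor.whiskerLeft D.ι τ) :
    ∃ (T : R ⥤ M) (φ : Φ ⟶ T) (ψ : T ⟶ Ψ) (e : D.ι ⋙ T ≅ F), φ ≫ ψ = τ ∧
      Functor.whiskerLeft D.ι φ ≫ e.hom = s ∧ e.hom ≫ t = Functor.whiskerLeft D.ι ψ := by
  let adj := D.ι.ranAdjunction M
  let f : D.ι.ran.obj F ⟶ D.ι.ran.obj (D.ι ⋙ Ψ) := D.ι.ran.map t
  let g : Ψ ⟶ D.ι.ran.obj (D.ι ⋙ Ψ) := adj.unit.app Ψ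
  have h₁ : adj.unit.app Φ ≫ D.ι.ran.map s ≫ f = τ ≫ g := by
    dsimp only [f, g]
    rw [← Functor.map_comp, h]
    exact (adj.unit.naturality τ).symm
  have : IsIso (adj.counit.app F) :=
    inferInstanceAs (IsIso ((D.ι.ranAdjunction M).counit.app F))
  have : IsIso (adj.counit.app (D.ι ⋙ Ψ)) :=
    inferInstanceAs (IsIso ((D.ι.ranAdjunction M).counit.app (D.ι ⋙ Ψ)))
  have hg : Functor.whiskerLeft D.ι g ≫ adj.counit.app (D.ι ⋙ Ψ) = 𝟙 _ :=
    adj.left_triangle_components Ψ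
  -- The triangle identity exhibits the restriction of the unit `g` as a section of an invertible
  -- counit.
  have : IsIso (((Functor.whiskeringLeft _ _ M).obj D.ι).map g) :=
    ⟨adj.counit.app (D.ι ⋙ Ψ), hg, by
      rw [← cancel_mono (adj.counit.app (D.ι ⋙ Ψ)), Category.assoc]
      exact (congrArg (_ ≫ ·) hg).trans ((Category.comp_id _).trans (Category.id_comp _).symm)⟩
  have P := (IsPullback.of_hasPullback f g).map ((Functor.whiskeringLeft _ _ M).obj D.ι)
  have := P.isIso_fst_of_isIso
  let e : D.ι ⋙ pullback f g ≅ F :=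
    asIso (((Functor.whiskeringLeft _ _ M).obj D.ι).map (pullback.fst f g)) ≪≫
      asIso (adj.counit.app F)
  refine ⟨pullback f g, pullback.lift (adj.unit.app Φ ≫ D.ι.ran.map s) τ (by simpa using h₁),
    pullback.snd f g, e, pullback.lift_snd _ _ _, ?_, ?_⟩
  · change ((Functor.whiskeringLeft _ _ M).obj D.ι).map _ ≫
      ((Functor.whiskeringLeft _ _ M).obj D.ι).map (pullback.fst f g) ≫ adj.counit.app F = s
    rw [← Category.assoc, ← Functor.map_comp, pullback.lift_fst, Functor.map_comp, Category.assoc]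
    have := adj.counit.naturality s
    dsimp only [Functor.comp_map, Functor.id_map] at this
    rw [this, ← Category.assoc]
    exact (congrArg (· ≫ s) (adj.left_triangle_components Φ)).trans (Category.id_comp _)
  · change (((Functor.whiskeringLeft _ _ M).obj D.ι).map (pullback.fst f g) ≫
      adj.counit.app F) ≫ t = _
    have := adj.counit.naturality t
    dsimp only [Functor.comp_map, Functor.id_map] at this
    rw [Category.assoc, ← this, ← Category.assoc, ← Functor.map_comp, pullback.condition,
      Functor.map_comp, Category.assoc]
    exact (congrArg (_ ≫ ·) hg).trans (Category.comp_id _)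

end GenReedy

namespace GenReedy

namespace GeneralizedReedyStructure

variable {R : Type w} [SmallCategory.{w} R] (G : GeneralizedReedyStructure R)

variable {M : Type u} [Category.{v} M]

/-! ### Modification of a diagram in a given degree -/

/-- Given `φ : Φ ⟶ T` and `ψ : T ⟶ Ψ`, this is the structure that is needed on an object with an
action of `Aut r` so that it may replace `T.obj r` in a factorization of `φ ≫ ψ` which coincides
with the given one in degrees less than `n`. -/
structure Node {Φ T Ψ : R ⥤ M} (φ : Φ ⟶ T) (ψ : T ⟶ Ψ) (n : ℕ) (r : R) where
  /-- the object with an action of `Aut r` -/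
  obj : SingleObj (Aut r) ⥤ M
  /-- the maps to the objects of degree less than `n` -/
  pr {c : R} (u : r ⟶ c) (hc : G.deg c < n) : obj.obj (SingleObj.star _) ⟶ T.obj c
  /-- the maps from the objects of degree less than `n` -/
  inj {c : R} (v : c ⟶ r) (hc : G.deg c < n) : T.obj c ⟶ obj.obj (SingleObj.star _)
  /-- the map from the source -/
  src : Φ.obj r ⟶ obj.obj (SingleObj.star _)
  /-- the map to the target -/
  tgt : obj ⟶ (restrictAut r).obj Ψ
  pr_map {c d : R} (u : r ⟶ c) (k : c ⟶ d) (hc : G.deg c < n) (hd : G.deg d < n) :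
    pr u hc ≫ T.map k = pr (u ≫ k) hd
  map_inj {c d : R} (v : d ⟶ r) (k : c ⟶ d) (hc : G.deg c < n) (hd : G.deg d < n) :
    T.map k ≫ inj v hd = inj (k ≫ v) hc
  inj_pr {c d : R} (v : c ⟶ r) (u : r ⟶ d) (hc : G.deg c < n) (hd : G.deg d < n) :
    inj v hc ≫ pr u hd = T.map (v ≫ u)
  act_pr (e : r ≅ r) {c : R} (u : r ⟶ c) (hc : G.deg c < n) :
    autMap obj e ≫ pr u hc = pr (e.hom ≫ u) hc
  inj_act (e : r ≅ r) {c : R} (v : c ⟶ r) (hc : G.deg c < n) :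
    inj v hc ≫ autMap obj e = inj (v ≫ e.hom) hc
  src_act (e : r ≅ r) : src ≫ autMap obj e = Φ.map e.hom ≫ src
  src_pr {c : R} (u : r ⟶ c) (hc : G.deg c < n) : src ≫ pr u hc = Φ.map u ≫ φ.app c
  map_src {c : R} (v : c ⟶ r) (hc : G.deg c < n) : Φ.map v ≫ src = φ.app c ≫ inj v hc
  inj_tgt {c : R} (v : c ⟶ r) (hc : G.deg c < n) :
    inj v hc ≫ tgt.app (SingleObj.star _) = ψ.app c ≫ Ψ.map v
  pr_tgt {c : R} (u : r ⟶ c) (hc : G.deg c < n) :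
    pr u hc ≫ ψ.app c = tgt.app (SingleObj.star _) ≫ Ψ.map u
  src_tgt : src ≫ tgt.app (SingleObj.star _) = φ.app r ≫ ψ.app r

/-- The given factorization as a node. -/
def Node.trivial {Φ T Ψ : R ⥤ M} (φ : Φ ⟶ T) (ψ : T ⟶ Ψ) (n : ℕ) (r : R) : G.Node φ ψ n r where
  obj := (restrictAut r).obj T
  pr u _ := T.map u
  inj v _ := T.map v
  src := φ.app r
  tgt := (restrictAut r).map ψ
  pr_map u k _ _ := (T.map_comp u k).symm
  map_inj v k _ _ := (T.map_comp k v).symm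
  inj_pr v u _ _ := (T.map_comp v u).symm
  act_pr e _ u _ := (T.map_comp e.hom u).symm
  inj_act e _ v _ := (T.map_comp v e.hom).symm
  src_act e := (φ.naturality e.hom).symm
  src_pr u _ := (φ.naturality u).symm
  map_src v _ := φ.naturality v
  inj_tgt v _ := ψ.naturality v
  pr_tgt u _ := ψ.naturality u
  src_tgt := rfl

section

variable [HasColimitsOfSize.{w, w} M] [HasPushouts M]

lemma latchingPushoutInl_relativeLatchingMap (r : R) {Φ T : R ⥤ M} (φ : Φ ⟶ T) :
    G.latchingPushoutInl r φ ≫ (G.relativeLatchingMap r φ).app (SingleObj.star _) = φ.app r :=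
  congr_app (pushout.inl_desc (f := (G.latchingMap r).app Φ) (g := (G.latchingFunctor r).map φ)
    _ _ _) (SingleObj.star _)

lemma latchingPushoutInr_relativeLatchingMap (r : R) {Φ T : R ⥤ M} (φ : Φ ⟶ T) :
    G.latchingPushoutInr r φ ≫ (G.relativeLatchingMap r φ).app (SingleObj.star _) =
      G.latchingHom r T :=
  congr_app (pushout.inr_desc (f := (G.latchingMap r).app Φ) (g := (G.latchingFunctor r).map φ)
    _ _ _) (SingleObj.star _)

end

section

variable [HasLimitsOfSize.{w, w} M] [HasPullbacks M]

lemma relativeMatchingMap_fst (r : R) {T Ψ : R ⥤ M} (ψ : T ⟶ Ψ) :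
    (G.relativeMatchingMap r ψ).app (SingleObj.star _) ≫
      (G.matchingPullbackFst r ψ).app (SingleObj.star _) = G.matchingHom r T :=
  congr_app (pullback.lift_fst (f := (G.matchingFunctor r).map ψ) (g := (G.matchingMap r).app Ψ)
    _ _ _) (SingleObj.star _)

lemma relativeMatchingMap_snd (r : R) {T Ψ : R ⥤ M} (ψ : T ⟶ Ψ) :
    (G.relativeMatchingMap r ψ).app (SingleObj.star _) ≫
      (G.matchingPullbackSnd r ψ).app (SingleObj.star _) = ψ.app r :=
  congr_app (pullback.lift_snd (f := (G.matchingFunctor r).map ψ) (g := (G.matchingMap r).app Ψ)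
    _ _ _) (SingleObj.star _)

end

lemma comp_comp_comp_eq {A B C D E F : M} {a : A ⟶ B} {i : B ⟶ C} {p : C ⟶ D} {x : D ⟶ E}
    {l : B ⟶ F} {m : F ⟶ D} {a' : A ⟶ F} {x' : F ⟶ E} (h : i ≫ p = l ≫ m) (hl : a ≫ l = a')
    (hm : m ≫ x = x') : (a ≫ i) ≫ p ≫ x = a' ≫ x' := by
  rw [← hl, ← hm, Category.assoc, Category.assoc, ← Category.assoc i, h, Category.assoc]

section

variable [HasLimitsOfSize.{w, w} M] [HasColimitsOfSize.{w, w} M] [HasPullbacks M] [HasPushouts M]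

/-- The node given by a factorization of the canonical map from the pushout involving the
latching object to the pullback involving the matching object. -/
noncomputable def Node.ofFactorization {Φ T Ψ : R ⥤ M} (φ : Φ ⟶ T) (ψ : T ⟶ Ψ) {n : ℕ} {r : R}
    (hr : G.deg r = n) {Z : SingleObj (Aut r) ⥤ M} (i : G.latchingPushout r φ ⟶ Z)
    (p : Z ⟶ G.matchingPullback r ψ)
    (fac : i ≫ p = G.relativeLatchingMap r φ ≫ G.relativeMatchingMap r ψ) :
    G.Node φ ψ n r := by
  have hl {c : R} (v : c ⟶ r) (hc : G.deg c < n) : G.deg (G.mid v) < G.deg r :=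
    hr ▸ (G.deg_mid_le_left v).trans_lt hc
  have hm {c : R} (u : r ⟶ c) (hc : G.deg c < n) : G.deg (G.mid u) < G.deg r :=
    hr ▸ (G.deg_mid_le_right u).trans_lt hc
  let p₁ : Z.obj (SingleObj.star _) ⟶ G.matchingObj r T :=
    p.app (SingleObj.star _) ≫ (G.matchingPullbackFst r ψ).app (SingleObj.star _)
  let p₂ : Z.obj (SingleObj.star _) ⟶ Ψ.obj r :=
    p.app (SingleObj.star _) ≫ (G.matchingPullbackSnd r ψ).app (SingleObj.star _)
  let i₁ : Φ.obj r ⟶ Z.obj (SingleObj.star _) :=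
    G.latchingPushoutInl r φ ≫ i.app (SingleObj.star _)
  let i₂ : G.latchingObj r T ⟶ Z.obj (SingleObj.star _) :=
    G.latchingPushoutInr r φ ≫ i.app (SingleObj.star _)
  have fac' : i.app (SingleObj.star _) ≫ p.app (SingleObj.star _) =
      (G.relativeLatchingMap r φ).app (SingleObj.star _) ≫
        (G.relativeMatchingMap r ψ).app (SingleObj.star _) := congr_app fac (SingleObj.star _)
  -- The four composites of a leg into `Z` with a projection out of `Z` agree with those through
  -- `T.obj r`; the node axioms relating incoming to outgoing maps follow from them.
  have h₁₁ : i₁ ≫ p₁ = φ.app r ≫ G.matchingHom r T :=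
    comp_comp_comp_eq fac' (G.latchingPushoutInl_relativeLatchingMap r φ)
      (G.relativeMatchingMap_fst r ψ)
  have h₂₁ : i₂ ≫ p₁ = G.latchingHom r T ≫ G.matchingHom r T :=
    comp_comp_comp_eq fac' (G.latchingPushoutInr_relativeLatchingMap r φ)
      (G.relativeMatchingMap_fst r ψ)
  have h₁₂ : i₁ ≫ p₂ = φ.app r ≫ ψ.app r :=
    comp_comp_comp_eq fac' (G.latchingPushoutInl_relativeLatchingMap r φ)
      (G.relativeMatchingMap_snd r ψ)
  have h₂₂ : i₂ ≫ p₂ = G.latchingHom r T ≫ ψ.app r :=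
    comp_comp_comp_eq fac' (G.latchingPushoutInr_relativeLatchingMap r φ)
      (G.relativeMatchingMap_snd r ψ)
  have h₃ : p₁ ≫ G.matchingObjMap r ψ = p₂ ≫ G.matchingHom r Ψ :=
    (Category.assoc _ _ _).trans ((congrArg _ (G.matchingPullback_condition r ψ)).trans
      (Category.assoc _ _ _).symm)
  have hp₁ (e : r ≅ r) : autMap Z e ≫ p₁ = p₁ ≫ G.matchingAct r T e :=
    autMap_naturality (p ≫ G.matchingPullbackFst r ψ) e
  have hi₁ (e : r ≅ r) : i₁ ≫ autMap Z e = Φ.map e.hom ≫ i₁ := by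
    dsimp only [i₁]
    rw [Category.assoc, ← autMap_naturality, ← Category.assoc, latchingPushoutInl_map,
      Category.assoc]
  have hi₂ (e : r ≅ r) : i₂ ≫ autMap Z e = G.latchingAct r T e ≫ i₂ := by
    dsimp only [i₂]
    rw [Category.assoc, ← autMap_naturality, ← Category.assoc, latchingPushoutInr_map,
      Category.assoc]
  exact
    { obj := Z
      pr u hc := p₁ ≫ G.boundaryπ r T u (hm u hc)
      inj v hc := G.boundaryι r T v (hl v hc) ≫ i₂
      src := i₁
      tgt := p ≫ G.matchingPullbackSnd r ψ
      pr_map u k hc hd := by rw [Category.assoc, boundaryπ_comp_map]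
      map_inj v k hc hd := by rw [← Category.assoc, map_boundaryι]
      inj_pr v u hc hd := by
        rw [Category.assoc, ← Category.assoc i₂, h₂₁, Category.assoc, matchingHom_boundaryπ,
          ← Category.assoc, boundaryι_latchingHom, T.map_comp]
      act_pr e c u hc := by
        rw [← Category.assoc, hp₁, Category.assoc]
        exact congrArg _ (G.act_boundaryπ r T e u _)
      inj_act e c v hc := by
        rw [Category.assoc, hi₂, ← Category.assoc]
        exact congrArg (· ≫ i₂) (G.boundaryι_act r T e v _)
      src_act := hi₁
      src_pr u hc := by
        rw [← Category.assoc, h₁₁, Category.assoc, matchingHom_boundaryπ, φ.naturality]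
      map_src v hc := by
        rw [← G.boundaryι_latchingHom r Φ v (hl v hc), Category.assoc]
        dsimp only [i₁, i₂]
        rw [← Category.assoc (G.latchingHom r Φ), (G.isPushout_latchingPushout r φ).w,
          ← Category.assoc, ← Category.assoc, boundaryι_map, Category.assoc, Category.assoc]
      inj_tgt v hc := by
        change (_ ≫ i₂) ≫ p₂ = _
        rw [Category.assoc, h₂₂, ← Category.assoc, boundaryι_latchingHom, ψ.naturality]
      pr_tgt u hc := by
        change (p₁ ≫ _) ≫ _ = p₂ ≫ _
        rw [Category.assoc, ← map_boundaryπ, ← Category.assoc, h₃, Category.assoc,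
          matchingHom_boundaryπ]
      src_tgt := h₁₂ }

lemma Node.hasLatchingLift_ofFactorization {Φ T Ψ : R ⥤ M} (φ : Φ ⟶ T) (ψ : T ⟶ Ψ) {n : ℕ}
    {r : R} (hr : G.deg r = n) {Z : SingleObj (Aut r) ⥤ M} (i : G.latchingPushout r φ ⟶ Z)
    (p : Z ⟶ G.matchingPullback r ψ)
    (fac : i ≫ p = G.relativeLatchingMap r φ ≫ G.relativeMatchingMap r ψ) {E B : M} (q : E ⟶ B)
    (h : HasLiftingProperty (i.app (SingleObj.star _)) q) :
    G.HasLatchingLift r φ (Node.ofFactorization G φ ψ hr i p fac).src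
      (fun j ↦ (Node.ofFactorization G φ ψ hr i p fac).inj j.hom (hr ▸ j.deg_lt)) q := by
  have h' := (G.hasLiftingProperty_iff_hasLatchingLift r φ _ q).1 h
  exact (congrArg (fun t ↦ G.HasLatchingLift r φ (G.latchingPushoutInl r φ ≫
    i.app (SingleObj.star _)) t q) (funext fun j ↦
      congrArg (· ≫ G.latchingPushoutInr r φ ≫ i.app (SingleObj.star _))
        (G.boundaryι_hom r T j (hr ▸ (G.deg_mid_le_left _).trans_lt (hr ▸ j.deg_lt))))).mpr h'

lemma Node.hasMatchingLift_ofFactorization {Φ T Ψ : R ⥤ M} (φ : Φ ⟶ T) (ψ : T ⟶ Ψ) {n : ℕ}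
    {r : R} (hr : G.deg r = n) {Z : SingleObj (Aut r) ⥤ M} (i : G.latchingPushout r φ ⟶ Z)
    (p : Z ⟶ G.matchingPullback r ψ)
    (fac : i ≫ p = G.relativeLatchingMap r φ ≫ G.relativeMatchingMap r ψ)
    (L : MorphismProperty M) (h : (L.functorCategory _).rlp p) :
    G.HasMatchingLift r ψ (Node.ofFactorization G φ ψ hr i p fac).tgt
      (fun j ↦ (Node.ofFactorization G φ ψ hr i p fac).pr j.hom (hr ▸ j.deg_lt)) L := by
  have h' := (G.rlp_iff_hasMatchingLift r ψ p L).1 h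
  exact (congrArg (fun t ↦ G.HasMatchingLift r ψ (p ≫ G.matchingPullbackSnd r ψ) t L)
    (funext fun j ↦ congrArg ((p ≫ G.matchingPullbackFst r ψ).app (SingleObj.star _) ≫ ·)
      (G.boundaryπ_hom r T j (hr ▸ (G.deg_mid_le_right _).trans_lt (hr ▸ j.deg_lt))))).mpr h'

end

end GeneralizedReedyStructure

end GenReedy

namespace GenReedy

namespace GeneralizedReedyStructure

variable {R : Type w} [SmallCategory.{w} R] (G : GeneralizedReedyStructure R)

variable {M : Type u} [Category.{v} M]

/-! ### Invariance of the lifting conditions -/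

variable {G} in
/-- Transport of a latching index along an isomorphism. -/
abbrev LatchingIndex.trans {r r' : R} (i : G.LatchingIndex r) (e : r ≅ r') :
    G.LatchingIndex r' where
  left := i.left
  hom := i.hom ≫ e.hom
  plus_hom := G.plus.comp_mem _ _ i.plus_hom (G.plus_hom e)
  deg_lt := i.deg_lt.trans_eq (G.deg_eq_of_iso e)

variable {G} in
lemma LatchingIndex.exists_trans_eq {r r' : R} (i : G.LatchingIndex r') (e : r ≅ r') :
    ∃ j : G.LatchingIndex r, j.trans e = i := by
  refine ⟨i.trans e.symm, ?_⟩
  cases i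
  simp [LatchingIndex.trans]

variable {G} in
lemma LatchingIndex.family_congr {r : R} {T : R ⥤ M} {E : M}
    (β : ∀ i : G.LatchingIndex r, T.obj i.left ⟶ E) {c : R} {x y : c ⟶ r} (h : x = y)
    {hx : G.plus x} {hy : G.plus y} {hc hc' : G.deg c < G.deg r} :
    β ⟨c, x, hx, hc⟩ = β ⟨c, y, hy, hc'⟩ := by
  subst h
  rfl

variable {G} in
/-- Transport of a matching index along an isomorphism. -/
abbrev MatchingIndex.trans {r r' : R} (i : G.MatchingIndex r') (e : r ≅ r') :
    G.MatchingIndex r where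
  right := i.right
  hom := e.hom ≫ i.hom
  minus_hom := G.minus.comp_mem _ _ (G.minus_hom e) i.minus_hom
  deg_lt := i.deg_lt.trans_eq (G.deg_eq_of_iso e).symm

variable {G} in
lemma MatchingIndex.exists_trans_eq {r r' : R} (i : G.MatchingIndex r) (e : r ≅ r') :
    ∃ j : G.MatchingIndex r', j.trans e = i := by
  refine ⟨i.trans e.symm, ?_⟩
  cases i
  simp [MatchingIndex.trans]

variable {G} in
lemma MatchingIndex.family_congr {r : R} {T : R ⥤ M} {B : M}
    (β : ∀ i : G.MatchingIndex r, B ⟶ T.obj i.right) {c : R} {x y : r ⟶ c} (h : x = y)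
    {hx : G.minus x} {hy : G.minus y} {hc hc' : G.deg c < G.deg r} :
    β ⟨c, x, hx, hc⟩ = β ⟨c, y, hy, hc'⟩ := by
  subst h
  rfl

variable {G} in
-- Comparison isomorphisms are needed only below `deg r` and at the tested object. This allows both
-- passing to representatives and comparing diagrams that agree only in low degrees.
lemma HasLatchingLift.congr {r r' : R} (e : r ≅ r') {Φ T T' : R ⥤ M} {τ : Φ ⟶ T} {τ' : Φ ⟶ T'}
    {Z Z' : M} {φ : Φ.obj r ⟶ Z} {φ' : Φ.obj r' ⟶ Z'}
    {inj : ∀ i : G.LatchingIndex r, T.obj i.left ⟶ Z}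
    {inj' : ∀ i : G.LatchingIndex r', T'.obj i.left ⟶ Z'} {E B : M} {q : E ⟶ B}
    (ε : ∀ d, G.deg d < G.deg r → (T.obj d ≅ T'.obj d))
    (hε : ∀ ⦃c d : R⦄ (f : c ⟶ d) (hc : G.deg c < G.deg r) (hd : G.deg d < G.deg r),
      T.map f ≫ (ε d hd).hom = (ε c hc).hom ≫ T'.map f)
    (hτ : ∀ d hd, τ.app d ≫ (ε d hd).hom = τ'.app d) (θ : Z ≅ Z')
    (hφ : φ ≫ θ.hom = Φ.map e.hom ≫ φ')
    (hinj : ∀ i : G.LatchingIndex r, (ε i.left i.deg_lt).hom ≫ inj' (i.trans e) = inj i ≫ θ.hom)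
    (h : G.HasLatchingLift r' τ' φ' inj' q) : G.HasLatchingLift r τ φ inj q := by
  intro α β γ hβ hαβ hα hβγ
  have hε' ⦃c d : R⦄ (f : c ⟶ d) (hc : G.deg c < G.deg r) (hd : G.deg d < G.deg r) :
      T'.map f ≫ (ε d hd).inv = (ε c hc).inv ≫ T.map f := by
    rw [← cancel_epi (ε c hc).hom, ← cancel_mono (ε d hd).hom]
    simp [hε f hc hd]
  have hτ' (d hd) : τ'.app d ≫ (ε d hd).inv = τ.app d := by simp [← hτ d hd]
  have hφ' : φ' = Φ.map e.inv ≫ φ ≫ θ.hom := by simp [hφ]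
  let β' (i : G.LatchingIndex r') : T'.obj i.left ⟶ E :=
    (ε i.left (i.trans e.symm).deg_lt).inv ≫ β (i.trans e.symm)
  have hβ' (i : G.LatchingIndex r) : β' (i.trans e) = (ε i.left i.deg_lt).inv ≫ β i :=
    congrArg _ (LatchingIndex.family_congr β (by simp))
  obtain ⟨l, hl₁, hl₂, hl₃⟩ := h (Φ.map e.inv ≫ α) β' (θ.inv ≫ γ)
    (fun i j f ↦ by
      dsimp only [β']
      rw [← Category.assoc, hε' f.hom (i.trans e.symm).deg_lt, Category.assoc]
      exact congrArg _ (hβ (i.trans e.symm) (j.trans e.symm) ⟨f.hom, f.plus_hom, by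
        rw [← Category.assoc, f.w]⟩))
    (fun i ↦ by
      dsimp only [β']
      rw [← Category.assoc, ← Category.assoc, hτ', ← Φ.map_comp]
      exact hαβ (i.trans e.symm))
    (by simp [hφ', hα])
    (fun i ↦ by
      obtain ⟨i, rfl⟩ := i.exists_trans_eq e
      rw [hβ', Category.assoc, hβγ, ← cancel_epi (ε i.left i.deg_lt).hom]
      rw [Iso.hom_inv_id_assoc, ← Category.assoc, hinj, Category.assoc, Iso.hom_inv_id_assoc])
  refine ⟨θ.hom ≫ l, ?_, fun i ↦ ?_, ?_⟩
  · rw [← Category.assoc, hφ, Category.assoc, hl₁, ← Φ.map_comp_assoc, Iso.hom_inv_id, Φ.map_id,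
      Category.id_comp]
  · rw [← Category.assoc, ← hinj, Category.assoc, hl₂, hβ', Iso.hom_inv_id_assoc]
  · rw [Category.assoc, hl₃, Iso.hom_inv_id_assoc]

variable {G} in
lemma HasMatchingLift.congr {r r' : R} (e : r ≅ r') {T T' Ψ : R ⥤ M} {τ : T ⟶ Ψ} {τ' : T' ⟶ Ψ}
    {Z : SingleObj (Aut r) ⥤ M} {Z' : SingleObj (Aut r') ⥤ M}
    {ψ : Z ⟶ (restrictAut r).obj Ψ} {ψ' : Z' ⟶ (restrictAut r').obj Ψ}
    {pr : ∀ i : G.MatchingIndex r, Z.obj (SingleObj.star _) ⟶ T.obj i.right}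
    {pr' : ∀ i : G.MatchingIndex r', Z'.obj (SingleObj.star _) ⟶ T'.obj i.right}
    {L : MorphismProperty M}
    (ε : ∀ d, G.deg d < G.deg r → (T.obj d ≅ T'.obj d))
    (hε : ∀ ⦃c d : R⦄ (f : c ⟶ d) (hc : G.deg c < G.deg r) (hd : G.deg d < G.deg r),
      T.map f ≫ (ε d hd).hom = (ε c hc).hom ≫ T'.map f)
    (hτ : ∀ d hd, (ε d hd).hom ≫ τ'.app d = τ.app d)
    (θ : Z.obj (SingleObj.star _) ≅ Z'.obj (SingleObj.star _))
    (hθ : ∀ g : r ≅ r, autMap Z g ≫ θ.hom = θ.hom ≫ autMap Z' (e.symm ≪≫ g ≪≫ e))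
    (hψ : θ.hom ≫ ψ'.app (SingleObj.star _) = ψ.app (SingleObj.star _) ≫ Ψ.map e.hom)
    (hpr : ∀ i : G.MatchingIndex r',
      θ.hom ≫ pr' i = pr (i.trans e) ≫ (ε i.right (i.trans e).deg_lt).hom)
    (h : G.HasMatchingLift r' τ' ψ' pr' L) : G.HasMatchingLift r τ ψ pr L := by
  intro A B f hf α β γ hβ hβ' hβγ hαβ hα
  -- Conjugation by `e` turns an equivariant lifting problem for `Aut r` into one for `Aut r'`.
  let conj : SingleObj (Aut r') ⥤ SingleObj (Aut r) :=
    { obj _ := SingleObj.star _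
      map g := show Aut r from e ≪≫ (show r' ≅ r' from g) ≪≫ e.symm
      map_id _ := Iso.ext (by
        change e.hom ≫ 𝟙 _ ≫ e.inv = 𝟙 _
        simp)
      map_comp g g' := Iso.ext (by
        change e.hom ≫ (Iso.hom g ≫ Iso.hom g') ≫ e.inv =
          (e.hom ≫ Iso.hom g ≫ e.inv) ≫ e.hom ≫ Iso.hom g' ≫ e.inv
        simp) }
  have hθ' (g : r' ≅ r') : autMap Z (e ≪≫ g ≪≫ e.symm) ≫ θ.hom = θ.hom ≫ autMap Z' g := by
    rw [hθ]
    congr 2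
    ext
    simp
  obtain ⟨l, hl₁, hl₂, hl₃⟩ := h (A := conj ⋙ A) (B := conj ⋙ B) (Functor.whiskerLeft conj f)
    (fun _ ↦ hf _)
    { app _ := α.app (SingleObj.star _) ≫ θ.hom
      naturality _ _ g := by
        refine (Category.assoc _ _ _).symm.trans ((congrArg (· ≫ θ.hom)
          (autMap_naturality α (e ≪≫ (show r' ≅ r' from g) ≪≫ e.symm))).trans
            ((Category.assoc _ _ _).trans (Eq.trans ?_ (Category.assoc _ _ _).symm)))
        exact congrArg _ (hθ' g) }
    (fun i ↦ β (i.trans e) ≫ (ε i.right (i.trans e).deg_lt).hom)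
    { app _ := γ.app (SingleObj.star _) ≫ Ψ.map e.hom
      naturality _ _ g := by
        refine (Category.assoc _ _ _).symm.trans ((congrArg (· ≫ Ψ.map e.hom)
          (autMap_naturality γ (e ≪≫ (show r' ≅ r' from g) ≪≫ e.symm))).trans
            ((Category.assoc _ _ _).trans (Eq.trans ?_ (Category.assoc _ _ _).symm)))
        refine congrArg _ ?_
        change Ψ.map (e.hom ≫ Iso.hom g ≫ e.inv) ≫ Ψ.map e.hom = Ψ.map e.hom ≫ Ψ.map (Iso.hom g)
        simp }
    (fun i j t ↦ by
      rw [Category.assoc, ← hε t.hom (i.trans e).deg_lt (j.trans e).deg_lt, ← Category.assoc]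
      exact congrArg (· ≫ _) (hβ (i.trans e) (j.trans e) ⟨t.hom, t.minus_hom, by
        rw [Category.assoc, t.w]⟩))
    (fun g i ↦ by
      refine (Category.assoc _ _ _).symm.trans (congrArg (· ≫ _) ?_)
      refine (hβ' (e ≪≫ (show r' ≅ r' from g) ≪≫ e.symm) (i.trans e)).trans ?_
      refine MatchingIndex.family_congr β ?_
      change (e.hom ≫ Iso.hom g ≫ e.inv) ≫ e.hom ≫ i.hom = e.hom ≫ Iso.hom g ≫ i.hom
      simp)
    (fun i ↦ by
      rw [Category.assoc, hτ, hβγ (i.trans e), Ψ.map_comp]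
      exact (Category.assoc _ _ _).symm)
    (fun i ↦ by
      refine (Category.assoc _ _ _).symm.trans ((congrArg (· ≫ _) (hαβ (i.trans e))).trans ?_)
      refine (Category.assoc _ _ _).trans ((congrArg _ (hpr i).symm).trans
        (Category.assoc _ _ _).symm))
    (by
      refine NatTrans.ext (funext fun _ ↦ ?_)
      refine (Category.assoc _ _ _).symm.trans ((congrArg (· ≫ Ψ.map e.hom)
        (congr_app hα (SingleObj.star _))).trans ?_)
      exact (Category.assoc _ _ _).trans ((congrArg _ hψ.symm).trans (Category.assoc _ _ _).symm))
  have hl₁' := congr_app hl₁ (SingleObj.star _)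
  have hl₃' := congr_app hl₃ (SingleObj.star _)
  let l₀ : B.obj (SingleObj.star _) ⟶ Z'.obj (SingleObj.star _) := l.app (SingleObj.star _)
  have hl₀ (g : r ≅ r) : autMap B g ≫ l₀ = l₀ ≫ autMap Z' (e.symm ≪≫ g ≪≫ e) := by
    have := autMap_naturality l (e.symm ≪≫ g ≪≫ e)
    refine Eq.trans (congrArg (· ≫ l₀) ?_) this
    change autMap B g = autMap B (e ≪≫ (e.symm ≪≫ g ≪≫ e) ≪≫ e.symm)
    congr 1
    ext
    simp
  refine ⟨{ app _ := l₀ ≫ θ.inv, naturality _ _ g := ?_ }, ?_, fun i ↦ ?_, ?_⟩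
  · have h₁ := hl₀ g
    have h₂ : θ.inv ≫ autMap Z g = autMap Z' (e.symm ≪≫ (show r ≅ r from g) ≪≫ e) ≫ θ.inv := by
      rw [Iso.inv_comp_eq, ← Category.assoc, ← hθ, Category.assoc, Iso.hom_inv_id,
        Category.comp_id]
    exact (Category.assoc _ _ _).symm.trans ((congrArg (· ≫ θ.inv) h₁).trans
      ((Category.assoc _ _ _).trans ((congrArg _ h₂.symm).trans (Category.assoc _ _ _).symm)))
  · refine NatTrans.ext (funext fun _ ↦ ?_)
    refine (Category.assoc _ _ _).symm.trans ((congrArg (· ≫ θ.inv) hl₁').trans ?_)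
    exact (Category.assoc _ _ _).trans ((congrArg _ θ.hom_inv_id).trans (Category.comp_id _))
  · obtain ⟨i, rfl⟩ := i.exists_trans_eq e
    rw [← cancel_mono (ε i.right (i.trans e).deg_lt).hom]
    change ((l₀ ≫ θ.inv) ≫ pr (i.trans e)) ≫ _ = _
    rw [Category.assoc, ← hpr, Category.assoc, Iso.inv_hom_id_assoc]
    exact hl₂ i
  · refine NatTrans.ext (funext fun _ ↦ ?_)
    rw [← cancel_mono (Ψ.map e.hom)]
    change ((l₀ ≫ θ.inv) ≫ ψ.app (SingleObj.star _)) ≫ _ = _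
    rw [Category.assoc]
    erw [← hψ]
    rw [Category.assoc, Iso.inv_hom_id_assoc]
    exact hl₃'

end GeneralizedReedyStructure

end GenReedy

/-! ### Gluing replaced objects into a diagram on degrees at most `n`. -/

namespace GenReedy

namespace GeneralizedReedyStructure

variable {R : Type w} [SmallCategory.{w} R] (G : GeneralizedReedyStructure R)

variable {M : Type u} [Category.{v} M]

/-- Given `φ : Φ ⟶ T` and `ψ : T ⟶ Ψ`, these are the data that allow to modify `T` in degrees
at least `n`, without changing it in degrees less than `n`. -/
structure Attachment {Φ T Ψ : R ⥤ M} (φ : Φ ⟶ T) (ψ : T ⟶ Ψ) (n : ℕ) where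
  /-- the objects -/
  obj : R → M
  /-- the maps to the objects of degree less than `n` -/
  pr {a c : R} (u : a ⟶ c) (hc : G.deg c < n) : obj a ⟶ T.obj c
  /-- the maps from the objects of degree less than `n` -/
  inj {c b : R} (v : c ⟶ b) (hc : G.deg c < n) : T.obj c ⟶ obj b
  /-- the action of the isomorphisms -/
  act {a b : R} (e : a ≅ b) : obj a ⟶ obj b
  /-- the map from the source -/
  src (a : R) : Φ.obj a ⟶ obj a
  /-- the map to the target -/
  tgt (a : R) : obj a ⟶ Ψ.obj a
  pr_map {a c d : R} (u : a ⟶ c) (k : c ⟶ d) (hc : G.deg c < n) (hd : G.deg d < n) :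
    pr u hc ≫ T.map k = pr (u ≫ k) hd
  map_inj {c d b : R} (k : c ⟶ d) (v : d ⟶ b) (hc : G.deg c < n) (hd : G.deg d < n) :
    T.map k ≫ inj v hd = inj (k ≫ v) hc
  inj_pr {c a d : R} (v : c ⟶ a) (u : a ⟶ d) (hc : G.deg c < n) (hd : G.deg d < n) :
    inj v hc ≫ pr u hd = T.map (v ≫ u)
  -- Together with `inj_pr`, this identifies the new objects of degree less than `n` with those of
  -- `T`.
  pr_inj_id (a : R) (ha : G.deg a < n) : pr (𝟙 a) ha ≫ inj (𝟙 a) ha = 𝟙 _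
  act_refl (a : R) : act (Iso.refl a) = 𝟙 _
  act_trans {a b c : R} (e : a ≅ b) (e' : b ≅ c) : act (e ≪≫ e') = act e ≫ act e'
  act_pr {a b c : R} (e : a ≅ b) (u : b ⟶ c) (hc : G.deg c < n) :
    act e ≫ pr u hc = pr (e.hom ≫ u) hc
  inj_act {a b c : R} (e : a ≅ b) (v : c ⟶ a) (hc : G.deg c < n) :
    inj v hc ≫ act e = inj (v ≫ e.hom) hc
  src_act {a b : R} (e : a ≅ b) : src a ≫ act e = Φ.map e.hom ≫ src b
  act_tgt {a b : R} (e : a ≅ b) : act e ≫ tgt b = tgt a ≫ Ψ.map e.hom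
  src_pr {a c : R} (u : a ⟶ c) (hc : G.deg c < n) : src a ≫ pr u hc = Φ.map u ≫ φ.app c
  map_src {c b : R} (v : c ⟶ b) (hc : G.deg c < n) : Φ.map v ≫ src b = φ.app c ≫ inj v hc
  inj_tgt {c b : R} (v : c ⟶ b) (hc : G.deg c < n) : inj v hc ≫ tgt b = ψ.app c ≫ Ψ.map v
  pr_tgt {a c : R} (u : a ⟶ c) (hc : G.deg c < n) : pr u hc ≫ ψ.app c = tgt a ≫ Ψ.map u
  src_tgt (a : R) : src a ≫ tgt a = φ.app a ≫ ψ.app a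

section

variable {G} {Φ T Ψ : R ⥤ M} {φ : Φ ⟶ T} {ψ : T ⟶ Ψ} {n : ℕ}

/-- The isomorphisms between the underlying objects of the nodes of a family. -/
def nodeAct (N : ∀ r, G.Node φ ψ n r) {r r' : R} (h : r = r') (g : r ≅ r') :
    (N r).obj.obj (SingleObj.star _) ⟶ (N r').obj.obj (SingleObj.star _) := by
  subst h
  exact autMap (N r).obj g

variable (N : ∀ r, G.Node φ ψ n r)

lemma nodeAct_refl (r : R) : nodeAct N rfl (Iso.refl r) = 𝟙 _ := autMap_refl _

lemma nodeAct_trans {r r' r'' : R} (h : r = r') (h' : r' = r'') (g : r ≅ r') (g' : r' ≅ r'') :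
    nodeAct N (h.trans h') (g ≪≫ g') = nodeAct N h g ≫ nodeAct N h' g' := by
  subst h h'
  exact autMap_trans _ g g'

lemma nodeAct_pr {r r' c : R} (h : r = r') (g : r ≅ r') (u : r' ⟶ c) (hc : G.deg c < n) :
    nodeAct N h g ≫ (N r').pr u hc = (N r).pr (g.hom ≫ u) hc := by
  subst h
  exact (N r).act_pr g u hc

lemma inj_nodeAct {r r' c : R} (h : r = r') (g : r ≅ r') (v : c ⟶ r) (hc : G.deg c < n) :
    (N r).inj v hc ≫ nodeAct N h g = (N r').inj (v ≫ g.hom) hc := by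
  subst h
  exact (N r).inj_act g v hc

lemma src_nodeAct {r r' : R} (h : r = r') (g : r ≅ r') :
    (N r).src ≫ nodeAct N h g = Φ.map g.hom ≫ (N r').src := by
  subst h
  exact (N r).src_act g

lemma nodeAct_tgt {r r' : R} (h : r = r') (g : r ≅ r') :
    nodeAct N h g ≫ (N r').tgt.app (SingleObj.star _) =
      (N r).tgt.app (SingleObj.star _) ≫ Ψ.map g.hom := by
  subst h
  exact autMap_naturality (N r).tgt g

lemma Node.tgt_inv_eq {a r : R} (N : G.Node φ ψ n r) (e : a ≅ r) {c : R} (v : c ⟶ a)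
    (hc : G.deg c < n) :
    N.inj (v ≫ e.hom) hc ≫ N.tgt.app (SingleObj.star _) ≫ Ψ.map e.inv = ψ.app c ≫ Ψ.map v := by
  have h := N.inj_tgt (v ≫ e.hom) hc
  rw [Ψ.map_comp] at h
  refine (Category.assoc _ _ _).symm.trans ((congrArg (· ≫ Ψ.map e.inv) h).trans ?_)
  simp

/-- The data obtained from a family of nodes by extending it along the isomorphisms to the chosen
representatives of the isomorphism classes. -/
noncomputable def Attachment.ofNodes
    (hN : ∀ r (hr : G.deg r < n), (N r).pr (𝟙 r) hr ≫ (N r).inj (𝟙 r) hr = 𝟙 _) :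
    G.Attachment φ ψ n where
  obj a := (N (rep a)).obj.obj (SingleObj.star _)
  pr {a _} u hc := (N (rep a)).pr ((repIso a).inv ≫ u) hc
  inj {_ b} v hc := (N (rep b)).inj (v ≫ (repIso b).hom) hc
  act {a b} e := nodeAct N (rep_eq_of_iso e) ((repIso a).symm ≪≫ e ≪≫ repIso b)
  src a := Φ.map (repIso a).hom ≫ (N (rep a)).src
  tgt a := (N (rep a)).tgt.app (SingleObj.star _) ≫ Ψ.map (repIso a).inv
  pr_map u k hc hd := by rw [(N _).pr_map _ _ _ hd, Category.assoc]
  map_inj k v hc hd := by rw [(N _).map_inj _ _ hc, Category.assoc]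
  inj_pr v u hc hd := by rw [(N _).inj_pr, Category.assoc, Iso.hom_inv_id_assoc]
  pr_inj_id a ha := by
    have ha' : G.deg (rep a) < n := (G.deg_rep a).trans_lt ha
    have h₁ := (N (rep a)).pr_map (𝟙 _) (repIso a).inv ha' ha
    have h₂ := (N (rep a)).map_inj (𝟙 _) (repIso a).hom ha ha'
    rw [Category.id_comp] at h₁
    rw [Category.comp_id] at h₂
    rw [Category.comp_id, Category.id_comp, ← hN _ ha', ← h₁, ← h₂, Category.assoc,
      ← Category.assoc (T.map _), ← T.map_comp, Iso.inv_hom_id, T.map_id, Category.id_comp]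
  act_refl a := by
    rw [← nodeAct_refl]
    congr 1
    ext
    simp
  act_trans e e' := by
    rw [← nodeAct_trans]
    congr 1
    ext
    simp
  act_pr e u hc := by
    rw [nodeAct_pr]
    congr 1
    simp
  inj_act e v hc := by
    rw [inj_nodeAct]
    congr 1
    simp
  src_act e := by
    rw [Category.assoc, src_nodeAct, ← Category.assoc, ← Category.assoc, ← Φ.map_comp,
      ← Φ.map_comp]
    simp
  act_tgt e := by
    rw [← Category.assoc, nodeAct_tgt]
    refine (Category.assoc _ _ _).trans (Eq.trans ?_ (Category.assoc _ _ _).symm)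
    rw [← Ψ.map_comp, ← Ψ.map_comp]
    simp
  src_pr u hc := by
    rw [Category.assoc, (N _).src_pr, ← Category.assoc, ← Φ.map_comp, Iso.hom_inv_id_assoc]
  map_src v hc := by rw [← Category.assoc, ← Φ.map_comp, (N _).map_src]
  inj_tgt v hc := (N _).tgt_inv_eq _ v hc
  pr_tgt u hc := by
    rw [(N _).pr_tgt, Ψ.map_comp]
    exact (Category.assoc _ _ _).symm
  src_tgt a := by
    have h := (N (rep a)).src_tgt
    refine (Category.assoc _ _ _).trans ((congrArg (_ ≫ ·) ((Category.assoc _ _ _).symm.trans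
      (congrArg (· ≫ Ψ.map (repIso a).inv) h))).trans ?_)
    simp

namespace Attachment

variable (A : G.Attachment φ ψ n)

lemma pr_inj_eq {a b c c' : R} (u : a ⟶ c) (e : c ≅ c') (v : c' ⟶ b) (hc : G.deg c < n)
    (hc' : G.deg c' < n) :
    A.pr (u ≫ e.hom) hc' ≫ A.inj v hc' = A.pr u hc ≫ A.inj (e.hom ≫ v) hc := by
  rw [← A.pr_map u e.hom hc, Category.assoc, A.map_inj e.hom v hc]

/-- Passing through `T` gives the same result for every factorization through degree less than `n`:
splitting `u`, `v` and the middle composite yields the Reedy factorization of `u ≫ v` up to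
isomorphism. This is what makes the action of morphisms functorial. -/
lemma pr_inj_fac {a b c : R} (u : a ⟶ c) (v : c ⟶ b) (hc : G.deg c < n)
    (h : G.deg (G.mid (u ≫ v)) < n) :
    A.pr u hc ≫ A.inj v hc = A.pr (G.facMinus (u ≫ v)) h ≫ A.inj (G.facPlus (u ≫ v)) h := by
  have hu := (G.deg_mid_le_right u).trans_lt hc
  have hv := (G.deg_mid_le_left v).trans_lt hc
  let k := G.facPlus u ≫ G.facMinus v
  have hk := (G.deg_mid_le_left k).trans_lt hu
  obtain ⟨e, he, he'⟩ := G.exists_iso_mid (u ≫ v) (G.facMinus u ≫ G.facMinus k)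
    (G.facPlus k ≫ G.facPlus v) (G.minus.comp_mem _ _ (G.minus_facMinus _) (G.minus_facMinus _))
    (G.plus.comp_mem _ _ (G.plus_facPlus _) (G.plus_facPlus _)) (by simp [k])
  rw [← he', ← A.pr_inj_eq _ e _ h hk, he, ← A.pr_map _ _ hu, ← A.map_inj _ _ hk hv,
    Category.assoc, ← Category.assoc (T.map _) (T.map _), ← T.map_comp, G.fac, T.map_comp,
    Category.assoc, A.map_inj _ _ hc hv, G.fac, ← Category.assoc, A.pr_map _ _ hu hc, G.fac]

open Classical in
/-- The action of the morphisms of degree at most `n`. -/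
noncomputable def map {a b : R} (f : a ⟶ b) (ha : G.deg a < n + 1) (hb : G.deg b < n + 1) :
    A.obj a ⟶ A.obj b :=
  if h : G.deg (G.mid f) < n then A.pr (G.facMinus f) h ≫ A.inj (G.facPlus f) h
  else
    have := G.isIso_of_deg_le_mid f (Nat.lt_succ_iff.1 ha) (Nat.lt_succ_iff.1 hb) (not_lt.1 h)
    A.act (asIso f)

lemma map_comp_eq {a b c : R} (u : a ⟶ c) (v : c ⟶ b) (hc : G.deg c < n) (ha : G.deg a < n + 1)
    (hb : G.deg b < n + 1) : A.map (u ≫ v) ha hb = A.pr u hc ≫ A.inj v hc := by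
  have h : G.deg (G.mid (u ≫ v)) < n := (G.deg_mid_comp_le u v).trans_lt hc
  rw [map, dif_pos h, ← A.pr_inj_fac]

lemma act_eq {a b : R} (e : a ≅ b) (ha : G.deg a < n) :
    A.act e = A.pr (𝟙 a) ha ≫ A.inj e.hom ha := by
  rw [← Category.id_comp e.hom, ← A.inj_act, ← Category.assoc, A.pr_inj_id, Category.id_comp]

/-- Isomorphisms between objects of degree less than `n` fall into the first branch of `map`; there
`act` is itself given by `pr` and `inj`, so the branches agree. -/
lemma map_hom {a b : R} (e : a ≅ b) (ha : G.deg a < n + 1) (hb : G.deg b < n + 1) :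
    A.map e.hom ha hb = A.act e := by
  by_cases h : G.deg (G.mid e.hom) < n
  · obtain ⟨t, -, -⟩ := G.exists_iso_mid e.hom (𝟙 a) e.hom (G.minus.id_mem a) (G.plus_hom e)
      (Category.id_comp _)
    have ha' : G.deg a < n := (G.deg_eq_of_iso t).ge.trans_lt h
    rw [A.act_eq e ha', ← A.map_comp_eq (𝟙 a) e.hom ha' ha hb, Category.id_comp]
  · rw [map, dif_neg h]
    exact congrArg A.act (Iso.ext rfl)

/-- A morphism between objects of degree at most `n` is an isomorphism or factors through an
object of degree less than `n`. -/
lemma hom_cases {a b : R} {P : (a ⟶ b) → Prop} (ha : G.deg a < n + 1) (hb : G.deg b < n + 1)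
    (h₁ : ∀ (c : R) (u : a ⟶ c) (v : c ⟶ b), G.deg c < n → P (u ≫ v))
    (h₂ : ∀ e : a ≅ b, P e.hom) (f : a ⟶ b) : P f := by
  by_cases h : G.deg (G.mid f) < n
  · rw [← G.fac f]
    exact h₁ _ _ _ h
  · have := G.isIso_of_deg_le_mid f (Nat.lt_succ_iff.1 ha) (Nat.lt_succ_iff.1 hb) (not_lt.1 h)
    exact h₂ (asIso f)

lemma map_id (a : R) (ha : G.deg a < n + 1) : A.map (𝟙 a) ha ha = 𝟙 _ :=
  (A.map_hom (Iso.refl a) ha ha).trans (A.act_refl a)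

lemma inj_map {a b c : R} (v : c ⟶ a) (g : a ⟶ b) (hc : G.deg c < n) (ha : G.deg a < n + 1)
    (hb : G.deg b < n + 1) : A.inj v hc ≫ A.map g ha hb = A.inj (v ≫ g) hc := by
  induction g using hom_cases ha hb with
  | h₁ d u w hd =>
    rw [A.map_comp_eq u w hd, ← Category.assoc, A.inj_pr, A.map_inj _ _ hc, Category.assoc]
  | h₂ e => rw [A.map_hom, A.inj_act]

lemma map_comp {a b c : R} (f : a ⟶ b) (g : b ⟶ c) (ha : G.deg a < n + 1) (hb : G.deg b < n + 1)
    (hc : G.deg c < n + 1) : A.map (f ≫ g) ha hc = A.map f ha hb ≫ A.map g hb hc := by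
  induction f using hom_cases ha hb with
  | h₁ d u v hd =>
    rw [A.map_comp_eq u v hd, Category.assoc, A.map_comp_eq u (v ≫ g) hd, Category.assoc,
      A.inj_map]
  | h₂ e =>
    induction g using hom_cases hb hc with
    | h₁ d u v hd =>
      rw [A.map_hom, A.map_comp_eq u v hd, ← Category.assoc, A.map_comp_eq _ v hd,
        ← Category.assoc, A.act_pr]
    | h₂ e' => rw [A.map_hom, A.map_hom, ← A.act_trans, ← A.map_hom _ ha hc, Iso.trans_hom]

lemma src_map {a b : R} (f : a ⟶ b) (ha : G.deg a < n + 1) (hb : G.deg b < n + 1) :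
    A.src a ≫ A.map f ha hb = Φ.map f ≫ A.src b := by
  induction f using hom_cases ha hb with
  | h₁ d u v hd =>
    rw [A.map_comp_eq u v hd, ← Category.assoc, A.src_pr, Category.assoc, ← A.map_src,
      Φ.map_comp, Category.assoc]
  | h₂ e => rw [A.map_hom, A.src_act]

lemma map_tgt {a b : R} (f : a ⟶ b) (ha : G.deg a < n + 1) (hb : G.deg b < n + 1) :
    A.map f ha hb ≫ A.tgt b = A.tgt a ≫ Ψ.map f := by
  induction f using hom_cases ha hb with
  | h₁ d u v hd =>
    rw [A.map_comp_eq u v hd, Category.assoc, A.inj_tgt, ← Category.assoc, A.pr_tgt,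
      Category.assoc, ← Ψ.map_comp]
  | h₂ e => rw [A.map_hom, A.act_tgt]

/-- The modified diagram on the full subcategory of objects of degree at most `n`. -/
noncomputable def functor :
    (show ObjectProperty R from fun a ↦ G.deg a < n + 1).FullSubcategory ⥤ M where
  obj a := A.obj a.obj
  map {a b} f := A.map f.hom a.property b.property
  map_id _ := A.map_id _ _
  map_comp _ _ := A.map_comp _ _ _ _ _

/-- The modified object at `r`, with its action of `Aut r`. -/
def autObj (r : R) : SingleObj (Aut r) ⥤ M where
  obj _ := A.obj r
  map e := A.act e
  map_id _ := A.act_refl r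
  map_comp e e' := A.act_trans e e'

/-- The map to the target, as a map of `Aut r`-objects. -/
def autTgt (r : R) : A.autObj r ⟶ (restrictAut r).obj Ψ where
  app _ := A.tgt r
  naturality _ _ e := A.act_tgt e

end Attachment

lemma Attachment.hasLatchingLift_ofNodes
    (hN : ∀ r (hr : G.deg r < n), (N r).pr (𝟙 r) hr ≫ (N r).inj (𝟙 r) hr = 𝟙 _) {a : R}
    (ha : G.deg a = n) (ha' : G.deg (rep a) = n) {E B : M} {q : E ⟶ B}
    (h : G.HasLatchingLift (rep a) φ (N (rep a)).src
      (fun j ↦ (N (rep a)).inj j.hom (ha' ▸ j.deg_lt)) q) :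
    G.HasLatchingLift a φ ((ofNodes N hN).src a)
      (fun j ↦ (ofNodes N hN).inj j.hom (ha ▸ j.deg_lt)) q :=
  h.congr (repIso a) (fun _ _ ↦ Iso.refl _) (by simp) (by simp) (Iso.refl _)
    (Category.comp_id _) (fun _ ↦ (Category.id_comp _).trans (Category.comp_id _).symm)

lemma Attachment.hasMatchingLift_ofNodes
    (hN : ∀ r (hr : G.deg r < n), (N r).pr (𝟙 r) hr ≫ (N r).inj (𝟙 r) hr = 𝟙 _) {a : R}
    (ha : G.deg a = n) (ha' : G.deg (rep a) = n) {L : MorphismProperty M}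
    (h : G.HasMatchingLift (rep a) ψ (N (rep a)).tgt
      (fun j ↦ (N (rep a)).pr j.hom (ha' ▸ j.deg_lt)) L) :
    G.HasMatchingLift a ψ ((ofNodes N hN).autTgt a)
      (fun j ↦ (ofNodes N hN).pr j.hom (ha ▸ j.deg_lt)) L :=
  h.congr (repIso a) (fun _ _ ↦ Iso.refl _) (by simp) (by simp) (Iso.refl _)
    (fun _ ↦ (Category.comp_id _).trans (Category.id_comp _).symm)
    (by
      refine (Category.id_comp _).trans (Eq.trans ?_ (Category.assoc _ _ _).symm)
      exact ((congrArg ((N (rep a)).tgt.app _ ≫ ·) (Ψ.mapIso (repIso a)).inv_hom_id).trans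
        (Category.comp_id _)).symm)
    (fun i ↦ by
      refine (Category.id_comp _).trans (Eq.trans ?_ (Category.comp_id _).symm)
      change _ = (N (rep a)).pr ((repIso a).inv ≫ (repIso a).hom ≫ i.hom) _
      simp)

end

end GeneralizedReedyStructure

end GenReedy

/-! ### Stages: factorizations with the required properties below a given degree. -/

namespace GenReedy

namespace GeneralizedReedyStructure

variable {R : Type w} [SmallCategory.{w} R] (G : GeneralizedReedyStructure R)

variable {M : Type u} [Category.{v} M]

/-- The condition that a factorization of a natural transformation has in degrees less
than `n` the properties of the factorizations for the Reedy model structure. -/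
structure Stage {Φ Ψ : R ⥤ M} (τ : Φ ⟶ Ψ) (Q L : MorphismProperty M) (n : ℕ) where
  /-- the middle object -/
  obj : R ⥤ M
  /-- the first morphism -/
  left : Φ ⟶ obj
  /-- the second morphism -/
  right : obj ⟶ Ψ
  fac : left ≫ right = τ
  latching (r : R) (hr : G.deg r < n) {E B : M} (q : E ⟶ B) (hq : Q q) :
    G.HasLatchingLift r left (left.app r) (fun j ↦ obj.map j.hom) q
  matching (r : R) (hr : G.deg r < n) :
    G.HasMatchingLift r right ((restrictAut r).map right) (fun j ↦ obj.map j.hom) L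

variable {G} in
/-- The comparison between two stages which coincide in degrees less than `n`. -/
structure Stage.Comparison {Φ Ψ : R ⥤ M} {τ : Φ ⟶ Ψ} {Q L : MorphismProperty M} {n m : ℕ}
    (S : G.Stage τ Q L n) (S' : G.Stage τ Q L m) where
  /-- the isomorphisms -/
  iso (d : R) (hd : G.deg d < n) : S'.obj.obj d ≅ S.obj.obj d
  naturality ⦃c d : R⦄ (f : c ⟶ d) (hc : G.deg c < n) (hd : G.deg d < n) :
    S'.obj.map f ≫ (iso d hd).hom = (iso c hc).hom ≫ S.obj.map f
  left_iso (d : R) (hd : G.deg d < n) : S'.left.app d ≫ (iso d hd).hom = S.left.app d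
  iso_right (d : R) (hd : G.deg d < n) : (iso d hd).hom ≫ S.right.app d = S'.right.app d

variable [HasLimitsOfSize.{w, w} M] [HasPullbacks M]

variable {G} in
-- The attachment only defines a diagram in degrees at most `n`; it is extended to `R` over `Ψ` by
-- Kan extension, without control in higher degrees. The conditions below `n` are inherited along
-- the comparison with `S`, and those in degree `n` come from the attachment.
lemma Stage.exists_succ_of_attachment {Φ Ψ : R ⥤ M} {τ : Φ ⟶ Ψ} {Q L : MorphismProperty M} {n : ℕ}
    (S : G.Stage τ Q L n) (A : G.Attachment S.left S.right n)
    (hA : ∀ (r : R) (hr : G.deg r = n) ⦃E B : M⦄ (q : E ⟶ B), Q q →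
      G.HasLatchingLift r S.left (A.src r) (fun j ↦ A.inj j.hom (hr ▸ j.deg_lt)) q)
    (hA' : ∀ (r : R) (hr : G.deg r = n),
      G.HasMatchingLift r S.right (A.autTgt r) (fun j ↦ A.pr j.hom (hr ▸ j.deg_lt)) L) :
    ∃ S' : G.Stage τ Q L (n + 1), Nonempty (S.Comparison S') := by
  let D : ObjectProperty R := fun a ↦ G.deg a < n + 1
  let s : D.ι ⋙ Φ ⟶ A.functor :=
    { app a := A.src a.obj
      naturality a b f := (A.src_map f.hom a.property b.property).symm }
  let t : A.functor ⟶ D.ι ⋙ Ψ :=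
    { app a := A.tgt a.obj
      naturality a b f := A.map_tgt f.hom a.property b.property }
  obtain ⟨T, φ, ψ, o, h₁, h₂, h₃⟩ := exists_extension_of_factorization D τ s t
    (NatTrans.ext (funext fun a ↦ (A.src_tgt a.obj).trans (congr_app S.fac a.obj)))
  let o' (a : R) (ha : G.deg a < n + 1) : T.obj a ≅ A.obj a := o.app ⟨a, ha⟩
  have ho ⦃a b : R⦄ (f : a ⟶ b) (ha : G.deg a < n + 1) (hb : G.deg b < n + 1) :
      T.map f ≫ (o' b hb).hom = (o' a ha).hom ≫ A.map f ha hb :=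
    o.hom.naturality (X := ⟨a, ha⟩) (Y := ⟨b, hb⟩) (ObjectProperty.homMk f)
  have hs (a : R) (ha : G.deg a < n + 1) : φ.app a ≫ (o' a ha).hom = A.src a :=
    congr_app h₂ ⟨a, ha⟩
  have ht (a : R) (ha : G.deg a < n + 1) : (o' a ha).hom ≫ A.tgt a = ψ.app a :=
    congr_app h₃ ⟨a, ha⟩
  let ε (d : R) (hd : G.deg d < n) : T.obj d ≅ S.obj.obj d :=
    o' d (hd.trans n.lt_succ_self) ≪≫
      ⟨A.pr (𝟙 d) hd, A.inj (𝟙 d) hd, A.pr_inj_id d hd, (A.inj_pr _ _ hd hd).trans (by simp)⟩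
  have hε_hom (d : R) (hd : G.deg d < n) :
      (ε d hd).hom = (o' d (hd.trans n.lt_succ_self)).hom ≫ A.pr (𝟙 d) hd := rfl
  have hmap_pr ⦃c d : R⦄ (f : c ⟶ d) (hc : G.deg c < n + 1) (hd : G.deg d < n) :
      T.map f ≫ (ε d hd).hom = (o' c hc).hom ≫ A.pr f hd := by
    rw [hε_hom, ← Category.assoc, ho f hc, Category.assoc, ← Category.comp_id f,
      A.map_comp_eq f (𝟙 d) hd, Category.assoc, A.inj_pr, Category.comp_id, S.obj.map_id,
      Category.comp_id, Category.comp_id]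
  have hinj_map ⦃c d : R⦄ (f : c ⟶ d) (hc : G.deg c < n) (hd : G.deg d < n + 1) :
      (ε c hc).hom ≫ A.inj f hc = T.map f ≫ (o' d hd).hom := by
    rw [hε_hom, ho f (hc.trans n.lt_succ_self), ← Category.id_comp f, A.map_comp_eq (𝟙 c) f hc,
      Category.id_comp, Category.assoc]
  have hε ⦃c d : R⦄ (f : c ⟶ d) (hc : G.deg c < n) (hd : G.deg d < n) :
      T.map f ≫ (ε d hd).hom = (ε c hc).hom ≫ S.obj.map f := by
    rw [hmap_pr f (hc.trans n.lt_succ_self), hε_hom, Category.assoc, A.pr_map _ _ hc hd,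
      Category.id_comp]
  have hl (d : R) (hd : G.deg d < n) : φ.app d ≫ (ε d hd).hom = S.left.app d := by
    rw [hε_hom, ← Category.assoc, hs, A.src_pr, Φ.map_id, Category.id_comp]
  have hr (d : R) (hd : G.deg d < n) : (ε d hd).hom ≫ S.right.app d = ψ.app d := by
    rw [hε_hom, Category.assoc, A.pr_tgt, Ψ.map_id, Category.comp_id, ht]
  refine ⟨⟨T, φ, ψ, h₁, fun r hrn E B q hq ↦ ?_, fun r hrn ↦ ?_⟩, ⟨⟨ε, hε, hl, hr⟩⟩⟩
  · obtain hr' | hr' := Nat.lt_succ_iff_lt_or_eq.1 hrn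
    · exact (S.latching r hr' q hq).congr (Iso.refl r) (fun d hd ↦ ε d (hd.trans hr'))
        (fun _ _ f _ _ ↦ hε f _ _) (fun d _ ↦ hl d _) (ε r hr') (by simp [hl])
        (fun i ↦ by
          rw [hε i.hom (i.deg_lt.trans hr') hr']
          simp [LatchingIndex.trans])
    · exact (hA r hr' q hq).congr (Iso.refl r) (fun d hd ↦ ε d (hr' ▸ hd))
        (fun _ _ f _ _ ↦ hε f _ _) (fun d _ ↦ hl d _) (o' r hrn) (by simp [hs])
        (fun i ↦ by
          rw [← hinj_map i.hom (hr' ▸ i.deg_lt) hrn]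
          simp [LatchingIndex.trans])
  · obtain hr' | hr' := Nat.lt_succ_iff_lt_or_eq.1 hrn
    · exact (S.matching r hr').congr (Iso.refl r) (fun d hd ↦ ε d (hd.trans hr'))
        (fun _ _ f _ _ ↦ hε f _ _) (fun d _ ↦ hr d _)
        (Z := (restrictAut r).obj T) (Z' := (restrictAut r).obj S.obj) (ε r hr')
        (fun g ↦ by
          refine (hε g.hom hr' hr').trans (congrArg _ ?_)
          change _ = S.obj.map (𝟙 r ≫ g.hom ≫ 𝟙 r)
          simp)
        (by
          refine (hr r hr').trans ?_
          simp)
        (fun i ↦ by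
          refine (hε i.hom hr' (i.deg_lt.trans hr')).symm.trans ?_
          simp [MatchingIndex.trans])
    · exact (hA' r hr').congr (Iso.refl r) (fun d hd ↦ ε d (hr' ▸ hd))
        (fun _ _ f _ _ ↦ hε f _ _) (fun d _ ↦ hr d _)
        (Z := (restrictAut r).obj T) (Z' := A.autObj r) (o' r hrn)
        (fun g ↦ by
          refine (ho g.hom hrn hrn).trans (congrArg _ ?_)
          refine (A.map_hom g hrn hrn).trans (congrArg A.act ?_)
          ext
          simp)
        (by
          refine (ht r hrn).trans ?_
          simp)
        (fun i ↦ by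
          refine (hmap_pr i.hom hrn (hr' ▸ i.deg_lt)).symm.trans ?_
          simp [MatchingIndex.trans])

variable [HasColimitsOfSize.{w, w} M] [HasPushouts M]

variable {G} in
-- In degree `n` the object at `r` is replaced by an equivariant factorization of the map from the
-- latching pushout to the matching pullback; at all other degrees the old object is kept.
lemma Stage.exists_succ {Φ Ψ : R ⥤ M} {τ : Φ ⟶ Ψ} {Q L : MorphismProperty M} {n : ℕ}
    (S : G.Stage τ Q L n)
    (h : ∀ (r : R) ⦃A B : SingleObj (Aut r) ⥤ M⦄ (f : A ⟶ B),
      ∃ (Z : SingleObj (Aut r) ⥤ M) (i : A ⟶ Z) (p : Z ⟶ B),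
        Q.llp (i.app (SingleObj.star _)) ∧ (L.functorCategory _).rlp p ∧ i ≫ p = f) :
    ∃ S' : G.Stage τ Q L (n + 1), Nonempty (S.Comparison S') := by
  have key (r : R) : ∃ N : G.Node S.left S.right n r,
      (∀ (hr : G.deg r < n), N.pr (𝟙 r) hr ≫ N.inj (𝟙 r) hr = 𝟙 _) ∧
      (∀ (hr : G.deg r = n),
        (∀ ⦃E B : M⦄ (q : E ⟶ B), Q q →
          G.HasLatchingLift r S.left N.src (fun j ↦ N.inj j.hom (hr ▸ j.deg_lt)) q) ∧
        G.HasMatchingLift r S.right N.tgt (fun j ↦ N.pr j.hom (hr ▸ j.deg_lt)) L) := by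
    by_cases hr : G.deg r = n
    · obtain ⟨Z, i, p, hi, hp, fac⟩ :=
        h r (G.relativeLatchingMap r S.left ≫ G.relativeMatchingMap r S.right)
      exact ⟨Node.ofFactorization G S.left S.right hr i p fac, fun h ↦ (h.ne hr).elim, fun _ ↦
        ⟨fun _ _ q hq ↦
          Node.hasLatchingLift_ofFactorization G S.left S.right hr i p fac q (hi _ hq),
          Node.hasMatchingLift_ofFactorization G S.left S.right hr i p fac L hp⟩⟩
    · exact ⟨Node.trivial G S.left S.right n r,
        fun _ ↦ (congrArg₂ (· ≫ ·) (S.obj.map_id r) (S.obj.map_id r)).trans (Category.comp_id _),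
        fun h ↦ (hr h).elim⟩
  choose N hN₁ hN₂ using key
  exact S.exists_succ_of_attachment (.ofNodes N hN₁)
    (fun r hr _ _ q hq ↦ Attachment.hasLatchingLift_ofNodes N hN₁ hr ((G.deg_rep r).trans hr)
      ((hN₂ _ ((G.deg_rep r).trans hr)).1 q hq))
    (fun r hr ↦ Attachment.hasMatchingLift_ofNodes N hN₁ hr ((G.deg_rep r).trans hr) 
      (hN₂ _ ((G.deg_rep r).trans hr)).2)

end GeneralizedReedyStructure

end GenReedy

namespace GenReedy

namespace GeneralizedReedyStructure

variable {R : Type w} [SmallCategory.{w} R] (G : GeneralizedReedyStructure R)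

variable {M : Type u} [Category.{v} M]

/-! ### The factorizations -/

/-- A sequence of diagrams which stabilizes in each degree has a limit. -/
lemma exists_limit_of_sequence (T : ℕ → R ⥤ M)
    (ε : ∀ (n : ℕ) (d : R), G.deg d < n → ((T (n + 1)).obj d ≅ (T n).obj d))
    (hε : ∀ (n : ℕ) ⦃c d : R⦄ (f : c ⟶ d) (hc : G.deg c < n) (hd : G.deg d < n),
      (T (n + 1)).map f ≫ (ε n d hd).hom = (ε n c hc).hom ≫ (T n).map f) :
    ∃ (X : R ⥤ M) (up : ∀ (n : ℕ) (d : R), G.deg d < n → (X.obj d ≅ (T n).obj d)),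
      (∀ (n : ℕ) ⦃c d : R⦄ (f : c ⟶ d) (hc : G.deg c < n) (hd : G.deg d < n),
        X.map f ≫ (up n d hd).hom = (up n c hc).hom ≫ (T n).map f) ∧
      ∀ (n : ℕ) (d : R) (hd : G.deg d < n),
        (up (n + 1) d (hd.trans n.lt_succ_self)).hom ≫ (ε n d hd).hom = (up n d hd).hom := by
  let obj (d : R) : M := (T (G.deg d + 1)).obj d
  -- The value at `d` is taken from term `deg d + 1`, and the comparisons are composed from there
  -- upwards.
  let up (n : ℕ) (d : R) (hd : G.deg d < n) : obj d ≅ (T n).obj d :=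
    Nat.leRec (motive := fun k _ ↦ (obj d ≅ (T k).obj d)) (Iso.refl _)
      (fun k hk i ↦ i ≪≫ (ε k d hk).symm) (Nat.succ_le_of_lt hd)
  have up_succ (n : ℕ) (d : R) (hd : G.deg d < n) :
      up (n + 1) d (hd.trans n.lt_succ_self) = up n d hd ≪≫ (ε n d hd).symm :=
    Nat.leRec_succ ..
  let map {a b : R} (f : a ⟶ b) (n : ℕ) (ha : G.deg a < n) (hb : G.deg b < n) : obj a ⟶ obj b :=
    (up n a ha).hom ≫ (T n).map f ≫ (up n b hb).inv
  have map_succ {a b : R} (f : a ⟶ b) (n : ℕ) (ha : G.deg a < n) (hb : G.deg b < n) :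
      map f (n + 1) (ha.trans n.lt_succ_self) (hb.trans n.lt_succ_self) = map f n ha hb := by
    dsimp only [map]
    rw [up_succ n a ha, up_succ n b hb]
    simp only [Iso.trans_hom, Iso.symm_hom, Iso.trans_inv, Iso.symm_inv, Category.assoc]
    rw [← Category.assoc ((T (n + 1)).map f), hε n f ha hb, Category.assoc,
      Iso.inv_hom_id_assoc]
  have map_eq {a b : R} (f : a ⟶ b) (n m : ℕ) (hnm : n ≤ m) (ha : G.deg a < n)
      (hb : G.deg b < n) : map f m (ha.trans_le hnm) (hb.trans_le hnm) = map f n ha hb := by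
    induction m, hnm using Nat.le_induction with
    | base => rfl
    | succ k hk h => rw [map_succ f k (ha.trans_le hk) (hb.trans_le hk), h]
  let N (a b : R) : ℕ := max (G.deg a) (G.deg b) + 1
  have hN₁ (a b : R) : G.deg a < N a b := by dsimp only [N]; omega
  have hN₂ (a b : R) : G.deg b < N a b := by dsimp only [N]; omega
  have map_eq' {a b : R} (f : a ⟶ b) (n : ℕ) (ha : G.deg a < n) (hb : G.deg b < n) :
      map f (N a b) (hN₁ a b) (hN₂ a b) = map f n ha hb :=
    (map_eq f (N a b) n (by dsimp only [N]; omega) (hN₁ a b) (hN₂ a b)).symm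
  refine ⟨{
    obj := obj
    map {a b} f := map f (N a b) (hN₁ a b) (hN₂ a b)
    map_id a := by simp [map]
    map_comp {a b c} f g := by
      have ha : G.deg a < max (N a b) (N b c) := (hN₁ a b).trans_le (le_max_left _ _)
      have hb : G.deg b < max (N a b) (N b c) := (hN₂ a b).trans_le (le_max_left _ _)
      have hc : G.deg c < max (N a b) (N b c) := (hN₂ b c).trans_le (le_max_right _ _)
      rw [map_eq' f _ ha hb, map_eq' g _ hb hc, map_eq' (f ≫ g) _ ha hc]
      simp [map] }, up, fun n c d f hc hd ↦ ?_, fun n d hd ↦ ?_⟩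
  · dsimp only
    rw [map_eq' f n hc hd]
    simp [map]
  · rw [up_succ n d hd]
    simp

variable [HasLimitsOfSize.{w, w} M] [HasColimitsOfSize.{w, w} M] [HasPullbacks M] [HasPushouts M]

lemma exists_factorization_relative {Φ Ψ : R ⥤ M} (τ : Φ ⟶ Ψ) (Q L : MorphismProperty M)
    (h : ∀ (r : R) ⦃A B : SingleObj (Aut r) ⥤ M⦄ (f : A ⟶ B),
      ∃ (Z : SingleObj (Aut r) ⥤ M) (i : A ⟶ Z) (p : Z ⟶ B),
        Q.llp (i.app (SingleObj.star _)) ∧ (L.functorCategory _).rlp p ∧ i ≫ p = f) :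
    ∃ (X : R ⥤ M) (i : Φ ⟶ X) (p : X ⟶ Ψ),
      (∀ r, Q.llp ((G.relativeLatchingMap r i).app (SingleObj.star _))) ∧
      (∀ r, (L.functorCategory (SingleObj (Aut r))).rlp (G.relativeMatchingMap r p)) ∧
      i ≫ p = τ := by
  let next (n : ℕ) (S : G.Stage τ Q L n) := S.exists_succ h
  let S (n : ℕ) : G.Stage τ Q L n := Nat.rec
    -- At stage `0` nothing is required, so any factorization of `τ` can serve as the start.
    ⟨Φ, 𝟙 Φ, τ, Category.id_comp τ, fun _ h ↦ (Nat.not_lt_zero _ h).elim,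
      fun _ h ↦ (Nat.not_lt_zero _ h).elim⟩ (fun n S ↦ (next n S).choose) n
  let c (n : ℕ) : (S n).Comparison (S (n + 1)) := (next n (S n)).choose_spec.some
  obtain ⟨X, up, hup, hup'⟩ := G.exists_limit_of_sequence (fun n ↦ (S n).obj)
    (fun n ↦ (c n).iso) (fun n ↦ (c n).naturality)
  have hl (d : R) (n : ℕ) (hd : G.deg d < n) :
      (S n).left.app d ≫ (up n d hd).inv =
        (S (G.deg d + 1)).left.app d ≫ (up _ d (Nat.lt_succ_self _)).inv := by
    induction n, Nat.succ_le_of_lt hd using Nat.le_induction with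
    | base => rfl
    | succ k hk hk' =>
      rw [← hk' hk, ← (c k).left_iso d hk, ← cancel_mono (up (k + 1) d hd).hom, Category.assoc,
        Category.assoc, Iso.inv_hom_id, Category.comp_id, Category.assoc,
        ← cancel_mono ((c k).iso d hk).hom, Category.assoc, Category.assoc, Category.assoc,
        hup' k d hk, Iso.inv_hom_id, Category.comp_id]
  have hr (d : R) (n : ℕ) (hd : G.deg d < n) :
      (up n d hd).hom ≫ (S n).right.app d =
        (up _ d (Nat.lt_succ_self _)).hom ≫ (S (G.deg d + 1)).right.app d := by
    induction n, Nat.succ_le_of_lt hd using Nat.le_induction with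
    | base => rfl
    | succ k hk hk' => rw [← hk' hk, ← (c k).iso_right d hk, ← Category.assoc, hup']
  let i : Φ ⟶ X :=
    { app d := (S (G.deg d + 1)).left.app d ≫ (up _ d (Nat.lt_succ_self _)).inv
      naturality a b f := by
        have ha : G.deg a < max (G.deg a) (G.deg b) + 1 := by omega
        have hb : G.deg b < max (G.deg a) (G.deg b) + 1 := by omega
        rw [← hl a _ ha, ← hl b _ hb, ← cancel_mono (up _ b hb).hom]
        simp [hup _ f ha hb] }
  let p : X ⟶ Ψ :=
    { app d := (up _ d (Nat.lt_succ_self _)).hom ≫ (S (G.deg d + 1)).right.app d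
      naturality a b f := by
        have ha : G.deg a < max (G.deg a) (G.deg b) + 1 := by omega
        have hb : G.deg b < max (G.deg a) (G.deg b) + 1 := by omega
        rw [← hr a _ ha, ← hr b _ hb, ← Category.assoc, hup _ f ha hb, Category.assoc,
          Category.assoc, NatTrans.naturality] }
  have hi (n : ℕ) (d : R) (hd : G.deg d < n) : i.app d ≫ (up n d hd).hom = (S n).left.app d := by
    change (_ ≫ _) ≫ _ = _
    rw [← hl d n hd, Category.assoc, Iso.inv_hom_id, Category.comp_id]
  have hp (n : ℕ) (d : R) (hd : G.deg d < n) : (up n d hd).hom ≫ (S n).right.app d = p.app d :=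
    hr d n hd
  refine ⟨X, i, p, fun r E B q hq ↦ ?_, fun r ↦ ?_, NatTrans.ext (funext fun d ↦ ?_)⟩
  · rw [hasLiftingProperty_relativeLatchingMap_iff]
    have hr' : G.deg r < G.deg r + 1 := Nat.lt_succ_self _
    exact ((S (G.deg r + 1)).latching r hr' q hq).congr (Iso.refl r)
      (fun d hd ↦ up _ d (hd.trans hr')) (fun _ _ f _ _ ↦ hup _ f _ _) (fun d _ ↦ hi _ d _)
      (up _ r hr') (by simp [hi])
      (fun j ↦ by
        rw [hup _ j.hom (j.deg_lt.trans hr') hr']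
        simp [LatchingIndex.trans])
  · rw [rlp_relativeMatchingMap_iff]
    have hr' : G.deg r < G.deg r + 1 := Nat.lt_succ_self _
    exact ((S (G.deg r + 1)).matching r hr').congr (Iso.refl r)
      (fun d hd ↦ up _ d (hd.trans hr')) (fun _ _ f _ _ ↦ hup _ f _ _) (fun d _ ↦ hp _ d _)
      (Z := (restrictAut r).obj X) (Z' := (restrictAut r).obj (S _).obj) (up _ r hr')
      (fun g ↦ by
        refine (hup _ g.hom hr' hr').trans (congrArg _ ?_)
        change _ = (S _).obj.map (𝟙 r ≫ g.hom ≫ 𝟙 r)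
        simp)
      (by
        refine (hp _ r hr').trans ?_
        simp)
      (fun j ↦ by
        refine (hup _ j.hom hr' (j.deg_lt.trans hr')).symm.trans ?_
        simp [MatchingIndex.trans])
  · change (_ ≫ (up _ d _).inv) ≫ (up _ d _).hom ≫ _ = _
    rw [Category.assoc, Iso.inv_hom_id_assoc, ← NatTrans.comp_app, (S _).fac]

end GeneralizedReedyStructure

end GenReedy

namespace GenReedy

namespace GeneralizedReedyStructure

variable {R : Type w} [SmallCategory.{w} R] (G : GeneralizedReedyStructure R)

variable {M : Type u} [Category.{v} M]

/-! ### Weak factorization systems for diagrams -/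

variable {G} in
lemma HasMatchingLift.of_retract {r : R} {T T' Ψ Ψ' : R ⥤ M} {τ : T ⟶ Ψ} {τ' : T' ⟶ Ψ'}
    {L : MorphismProperty M} (ρ : RetractArrow τ' τ)
    (h : G.HasMatchingLift r τ ((restrictAut r).map τ) (fun j ↦ T.map j.hom) L) :
    G.HasMatchingLift r τ' ((restrictAut r).map τ') (fun j ↦ T'.map j.hom) L := by
  intro A B f hf α β γ hβ hβ' hβγ hαβ hα
  let i₁ : T' ⟶ T := ρ.i.left
  let i₂ : Ψ' ⟶ Ψ := ρ.i.right
  let p₁ : T ⟶ T' := ρ.r.left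
  let p₂ : Ψ ⟶ Ψ' := ρ.r.right
  have hi : i₁ ≫ τ = τ' ≫ i₂ := ρ.i_w
  have hp : p₁ ≫ τ' = τ ≫ p₂ := ρ.r_w
  have h₁ : i₁ ≫ p₁ = 𝟙 T' := ρ.retract_left
  have h₂ : i₂ ≫ p₂ = 𝟙 Ψ' := ρ.retract_right
  obtain ⟨l, hl₁, hl₂, hl₃⟩ := h f hf (α ≫ (restrictAut r).map i₁) (fun j ↦ β j ≫ i₁.app j.right)
    (γ ≫ (restrictAut r).map i₂)
    (fun i j t ↦ by rw [Category.assoc, ← i₁.naturality, ← Category.assoc, hβ i j t])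
    (fun e i ↦ by
      rw [← Category.assoc]
      exact congrArg (· ≫ i₁.app i.right) (hβ' e i))
    (fun i ↦ by
      rw [Category.assoc, ← NatTrans.comp_app, hi, NatTrans.comp_app, ← Category.assoc, hβγ,
        Category.assoc, i₂.naturality]
      exact (Category.assoc _ _ _).symm)
    (fun i ↦ by
      rw [← Category.assoc, hαβ, Category.assoc, i₁.naturality]
      exact (Category.assoc _ _ _).symm)
    (by rw [← Category.assoc, hα, Category.assoc, Category.assoc, ← Functor.map_comp,
      ← Functor.map_comp, hi])
  refine ⟨l ≫ (restrictAut r).map p₁, ?_, fun i ↦ ?_, ?_⟩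
  · rw [← Category.assoc, hl₁, Category.assoc, ← Functor.map_comp, h₁,
      CategoryTheory.Functor.map_id, Category.comp_id]
  · refine (Category.assoc _ _ _).trans ((congrArg _ (p₁.naturality i.hom).symm).trans
      ((Category.assoc _ _ _).symm.trans ((congrArg (· ≫ _) (hl₂ i)).trans ?_)))
    rw [Category.assoc, ← NatTrans.comp_app, h₁]
    exact Category.comp_id _
  · rw [Category.assoc, ← Functor.map_comp, hp, Functor.map_comp, ← Category.assoc, hl₃,
      Category.assoc, ← Functor.map_comp, h₂, CategoryTheory.Functor.map_id, Category.comp_id]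

/-- The morphisms of diagrams whose relative latching maps belong to a given class. -/
def reedyLeft [HasColimitsOfSize.{w, w} M] [HasPushouts M] (L : MorphismProperty M) :
    MorphismProperty (R ⥤ M) :=
  fun _ _ τ ↦ ∀ r : R, L ((G.relativeLatchingMap r τ).app (SingleObj.star _))

/-- The morphisms of diagrams whose relative matching maps have the right lifting property
with respect to the equivariant morphisms in a given class. -/
def reedyRight [HasLimitsOfSize.{w, w} M] [HasPullbacks M] (L : MorphismProperty M) :
    MorphismProperty (R ⥤ M) :=
  fun _ _ τ ↦ ∀ r : R, (L.functorCategory (SingleObj (Aut r))).rlp (G.relativeMatchingMap r τ)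

instance isStableUnderRetracts_reedyRight [HasLimitsOfSize.{w, w} M] [HasPullbacks M]
    (L : MorphismProperty M) : (G.reedyRight L).IsStableUnderRetracts where
  of_retract ρ h r := (G.rlp_relativeMatchingMap_iff r _ L).2
    (((G.rlp_relativeMatchingMap_iff r _ L).1 (h r)).of_retract ρ)

section

variable [HasLimitsOfSize.{w, w} M] [HasColimitsOfSize.{w, w} M] [HasPushouts M]

/-- The component at `r` is a cobase change of the map of latching objects followed by the relative
latching map. -/
lemma reedyLeft_le_functorCategory (hG : G.IsDualizable) (Q : MorphismProperty M) :
    G.reedyLeft Q.llp ≤ Q.llp.functorCategory R := fun _ _ τ hτ r ↦ by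
  rw [← latchingPushoutInl_relativeLatchingMap G r τ]
  exact Q.llp.comp_mem _ _ (G.latchingPushoutInl_mem_llp hG r τ Q (fun s _ ↦ hτ s)) (hτ r)

end

variable [HasLimitsOfSize.{w, w} M] [HasPullbacks M]

/-- At a fixed object, the components of a lift are independent of each other: those indexed by the
boundary are prescribed, and each remaining one is a lift against `q`. -/
lemma hasLiftingProperty_pullbackCotensor_app (r s : R) {E B : M} (q : E ⟶ B) {A C : M}
    (i : A ⟶ C) [HasLiftingProperty i q] :
    HasLiftingProperty i ((G.pullbackCotensor q s).app r) := by
  classical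
  have P := (IsPullback.of_hasPullback (powerMap q (G.boundary s).toFunctor)
    (powerRestrict B (G.boundary s).ι)).map ((evaluation R M).obj r)
  have h₁ := congr_app (G.pullbackCotensor_fst s q) r
  have h₂ := congr_app (G.pullbackCotensor_snd s q) r
  refine ⟨fun {a b} sq ↦ ?_⟩
  let b₁ : C ⟶ (power E (G.boundary s).toFunctor).obj r := b ≫ (pullback.fst
    (powerMap q (G.boundary s).toFunctor) (powerRestrict B (G.boundary s).ι)).app r
  let b₂ : C ⟶ (power B (yoneda.obj s)).obj r := b ≫ (pullback.snd
    (powerMap q (G.boundary s).toFunctor) (powerRestrict B (G.boundary s).ι)).app r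
  let bd (x : r ⟶ s) (hx : x ∈ (G.boundary s).obj (Opposite.op r)) :
      (G.boundary s).toFunctor.obj (Opposite.op r) := ⟨x, hx⟩
  have hb : b₁ ≫ (powerMap q (G.boundary s).toFunctor).app r =
      b₂ ≫ (powerRestrict B (G.boundary s).ι).app r :=
    (Category.assoc _ _ _).trans ((congrArg (b ≫ ·) P.w).trans (Category.assoc _ _ _).symm)
  have ha₁ : a ≫ (powerRestrict E (G.boundary s).ι).app r = i ≫ b₁ := by
    rw [← h₁, NatTrans.comp_app, ← Category.assoc, sq.w, Category.assoc]
  have ha₂ : a ≫ (powerMap q (yoneda.obj s)).app r = i ≫ b₂ := by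
    rw [← h₂, NatTrans.comp_app, ← Category.assoc, sq.w, Category.assoc]
  have sq' (x : r ⟶ s) : CommSq (a ≫ powerπ E (yoneda.obj s) x) i q
      (b₂ ≫ powerπ B (yoneda.obj s) x) := ⟨by
    rw [Category.assoc, ← powerMap_π, ← Category.assoc, ha₂, Category.assoc]⟩
  let l : C ⟶ (power E (yoneda.obj s)).obj r := powerLift fun x ↦
    if hx : x ∈ (G.boundary s).obj (Opposite.op r) then b₁ ≫ powerπ E _ (bd x hx) else (sq' x).lift
  have l_pos (x : r ⟶ s) (hx : x ∈ (G.boundary s).obj (Opposite.op r)) :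
      l ≫ powerπ E (yoneda.obj s) x = b₁ ≫ powerπ E _ (bd x hx) :=
    (powerLift_π _ _).trans (dif_pos hx)
  have l_neg (x : r ⟶ s) (hx : x ∉ (G.boundary s).obj (Opposite.op r)) :
      l ≫ powerπ E (yoneda.obj s) x = (sq' x).lift :=
    (powerLift_π _ _).trans (dif_neg hx)
  refine ⟨⟨l, power_obj_hom_ext fun x ↦ ?_, P.hom_ext ?_ ?_⟩⟩
  · by_cases hx : x ∈ (G.boundary s).obj (Opposite.op r)
    · rw [Category.assoc, l_pos x hx, ← Category.assoc, ← ha₁, Category.assoc, powerRestrict_π]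
      rfl
    · rw [Category.assoc, l_neg x hx, CommSq.fac_left]
  · refine (Category.assoc _ _ _).trans ((congrArg (l ≫ ·) h₁).trans
      (power_obj_hom_ext fun x ↦ ?_))
    refine (Category.assoc _ _ _).trans ((congrArg (l ≫ ·) (powerRestrict_π _ _ x)).trans ?_)
    exact l_pos x.1 x.2
  · refine (Category.assoc _ _ _).trans ((congrArg (l ≫ ·) h₂).trans
      (power_obj_hom_ext fun x ↦ ?_))
    refine (Category.assoc _ _ _).trans ((congrArg (l ≫ ·) (powerMap_π q _ x)).trans ?_)
    refine (Category.assoc _ _ _).symm.trans ?_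
    by_cases hx : x ∈ (G.boundary s).obj (Opposite.op r)
    · rw [l_pos x hx, Category.assoc, ← powerMap_π, ← Category.assoc, hb, Category.assoc,
        powerRestrict_π]
      rfl
    · rw [l_neg x hx, CommSq.fac_right]
      rfl

variable [HasColimitsOfSize.{w, w} M] [HasPushouts M]

lemma reedyLeft_llp (Q : MorphismProperty M) : G.reedyLeft Q.llp = (G.pullbackCotensors Q).llp := by
  ext Φ T τ
  constructor
  · rintro h _ _ _ ⟨q, hq, r⟩
    rw [hasLiftingProperty_pullbackCotensor_iff, ← hasLiftingProperty_relativeLatchingMap_iff]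
    exact h r q hq
  · intro h r E B q hq
    rw [hasLiftingProperty_relativeLatchingMap_iff, ← hasLiftingProperty_pullbackCotensor_iff]
    exact h _ ⟨q, hq, r⟩

/-- Factorization and lifting come from the two inductions on the degree. Stability of the left
class under retracts is free, since it is defined by a left lifting property. -/
lemma isWeakFactorizationSystem_reedy (Q : MorphismProperty M)
    (h : ∀ r : R, MorphismProperty.HasFactorization
      (Q.llp.functorCategory (SingleObj (Aut r))) (Q.llp.functorCategory (SingleObj (Aut r))).rlp) :
    MorphismProperty.IsWeakFactorizationSystem (G.reedyLeft Q.llp) (G.reedyRight Q.llp) := by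
  have : (G.reedyLeft Q.llp).IsStableUnderRetracts := by
    rw [reedyLeft_llp]
    infer_instance
  have : MorphismProperty.HasFactorization (G.reedyLeft Q.llp) (G.reedyRight Q.llp) := ⟨fun τ ↦ by
    obtain ⟨X, i, p, hi, hp, fac⟩ := G.exists_factorization_relative τ Q Q.llp (fun r A B f ↦ by
      have d := (Q.llp.functorCategory (SingleObj (Aut r))).factorizationData
        (Q.llp.functorCategory (SingleObj (Aut r))).rlp f
      exact ⟨d.Z, d.i, d.p, d.hi _, d.hp, d.fac⟩)
    exact ⟨⟨X, i, p, fac, hi, hp⟩⟩⟩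
  exact .mk' _ _ (fun i p hi hp ↦ hasLiftingProperty_of_relative Q.llp hi
    (fun r ↦ (G.rlp_relativeMatchingMap_iff r p _).1 (hp r)))

/-- By adjunction it is enough that the left adjoint of evaluation at `r` sends `Q.llp` into
`reedyLeft Q.llp`; by adjunction again, this is a statement about the values at `r` of pullback
cotensors. -/
lemma rlp_app_of_rlp_reedyLeft (Q : MorphismProperty M) {X Y : R ⥤ M} {p : X ⟶ Y}
    (hp : (G.reedyLeft Q.llp).rlp p) (r : R) : Q.llp.rlp (p.app r) := by
  intro A C i hi
  refine ((evaluationAdjunctionRight M r).hasLiftingProperty_iff i p).1 (hp _ ?_)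
  rw [reedyLeft_llp]
  rintro _ _ _ ⟨q, hq, s⟩
  have := hi q hq
  exact ((evaluationAdjunctionRight M r).hasLiftingProperty_iff i _).2
    (G.hasLiftingProperty_pullbackCotensor_app r s q i)

end GeneralizedReedyStructure

section

variable {D : Type w} [Category.{w'} D] {M : Type u} [Category.{v} M] [ModelCategory M]

lemma AdmitsInjectiveModelStructure.hasFactorization_cofibrations
    (h : AdmitsInjectiveModelStructure D M) :
    MorphismProperty.HasFactorization ((cofibrations M).functorCategory D)
      ((cofibrations M).functorCategory D).rlp := by
  obtain ⟨_, h⟩ := h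
  rw [← h.cofibrations_eq, MorphismProperty.rlp_eq_of_wfs _ (trivialFibrations (D ⥤ M))]
  infer_instance

lemma AdmitsInjectiveModelStructure.hasFactorization_trivialCofibrations
    (h : AdmitsInjectiveModelStructure D M) :
    MorphismProperty.HasFactorization ((trivialCofibrations M).functorCategory D)
      ((trivialCofibrations M).functorCategory D).rlp := by
  obtain ⟨_, h⟩ := h
  have e : trivialCofibrations (D ⥤ M) = (trivialCofibrations M).functorCategory D := by
    ext A B f
    simp only [trivialCofibrations, h.weakEquivalences_eq, h.cofibrations_eq]
    exact ⟨fun hf d ↦ ⟨hf.1 d, hf.2 d⟩, fun hf ↦ ⟨fun d ↦ (hf d).1, fun d ↦ (hf d).2⟩⟩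
  rw [← e, MorphismProperty.rlp_eq_of_wfs _ (fibrations (D ⥤ M))]
  infer_instance

instance hasTwoOutOfThreeProperty_functorCategory :
    ((weakEquivalences M).functorCategory D).HasTwoOutOfThreeProperty where
  comp_mem _ _ hf hg d := (weakEquivalences M).comp_mem _ _ (hf d) (hg d)
  of_postcomp f _ hg hfg d := (weakEquivalences M).of_postcomp (f.app d) _ (hg d) (hfg d)
  of_precomp f g hf hfg d := (weakEquivalences M).of_precomp (f.app d) (g.app d) (hf d) (hfg d)

end

namespace GeneralizedReedyStructure

/-! ### The Reedy model structure -/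

variable {R : Type w} [SmallCategory.{w} R] (G : GeneralizedReedyStructure R)

variable {M : Type u} [Category.{v} M] [HasLimitsOfSize.{w, w} M] [HasColimitsOfSize.{w, w} M]
  [ModelCategory M]

lemma isWeakFactorizationSystem_cofibrations (hM : G.IsInjectiveModelCategory M) :
    MorphismProperty.IsWeakFactorizationSystem (G.reedyLeft (cofibrations M))
      (G.reedyRight (cofibrations M)) := by
  have h (r : R) := (hM r).hasFactorization_cofibrations
  rw [← MorphismProperty.llp_eq_of_wfs (cofibrations M) (trivialFibrations M)] at h ⊢
  exact G.isWeakFactorizationSystem_reedy _ h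

lemma isWeakFactorizationSystem_trivialCofibrations (hM : G.IsInjectiveModelCategory M) :
    MorphismProperty.IsWeakFactorizationSystem (G.reedyLeft (trivialCofibrations M))
      (G.reedyRight (trivialCofibrations M)) := by
  have h (r : R) := (hM r).hasFactorization_trivialCofibrations
  rw [← MorphismProperty.llp_eq_of_wfs (trivialCofibrations M) (fibrations M)] at h ⊢
  exact G.isWeakFactorizationSystem_reedy _ h

/-- For the converse, once the relative latching maps in lower degrees are acyclic, so is the
inclusion of `Φ.obj r` in the latching pushout; 2-out-of-3 then passes acyclicity from `τ.app r` to
the relative latching map. -/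
lemma reedyLeft_trivialCofibrations (hG : G.IsDualizable) :
    G.reedyLeft (trivialCofibrations M) =
      G.reedyLeft (cofibrations M) ⊓ (weakEquivalences M).functorCategory R := by
  have e := MorphismProperty.llp_eq_of_wfs (trivialCofibrations M) (fibrations M)
  ext Φ T τ
  constructor
  · refine fun h ↦ ⟨fun r ↦ (h r).1, fun r ↦ ?_⟩
    rw [← e] at h
    have := G.reedyLeft_le_functorCategory hG _ _ h r
    rw [e] at this
    exact this.2
  · rintro ⟨h₁, h₂⟩ r
    induction hn : G.deg r using Nat.strong_induction_on generalizing r with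
    | _ n ih =>
      refine ⟨h₁ r, ?_⟩
      have h := G.latchingPushoutInl_mem_llp hG r τ (fibrations M) (fun s hs ↦ by
        rw [e]
        exact ih _ (hn ▸ hs) s rfl)
      rw [e] at h
      refine (weakEquivalences M).of_precomp (G.latchingPushoutInl r τ) _ h.2 ?_
      rw [latchingPushoutInl_relativeLatchingMap]
      exact h₂ r

lemma reedyRight_cofibrations (hG : G.IsDualizable) (hM : G.IsInjectiveModelCategory M) :
    G.reedyRight (cofibrations M) =
      G.reedyRight (trivialCofibrations M) ⊓ (weakEquivalences M).functorCategory R := by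
  have := G.isWeakFactorizationSystem_cofibrations hM
  have := G.isWeakFactorizationSystem_trivialCofibrations hM
  have hW : G.reedyRight (cofibrations M) ≤ (weakEquivalences M).functorCategory R := by
    intro X Y p hp r
    rw [← MorphismProperty.rlp_eq_of_wfs (G.reedyLeft (cofibrations M))
      (G.reedyRight (cofibrations M)),
      ← MorphismProperty.llp_eq_of_wfs (cofibrations M) (trivialFibrations M)] at hp
    have h := G.rlp_app_of_rlp_reedyLeft _ hp r
    rw [MorphismProperty.llp_eq_of_wfs (cofibrations M) (trivialFibrations M),
      MorphismProperty.rlp_eq_of_wfs (cofibrations M) (trivialFibrations M)] at h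
    exact h.2
  apply le_antisymm
  · refine fun X Y p hp ↦ ⟨fun r ↦ ?_, hW p hp⟩
    have hle : (trivialCofibrations M).functorCategory (SingleObj (Aut r)) ≤
        (cofibrations M).functorCategory (SingleObj (Aut r)) := fun _ _ _ hf d ↦ (hf d).1
    exact MorphismProperty.antitone_rlp hle _ (hp r)
  -- Retract argument: the left factor of `p` is a weak equivalence by 2-out-of-3, hence lies in the
  -- acyclic left class and lifts against `p`, so `p` is a retract of the right factor.
  · rintro X Y p ⟨hp₁, hp₂⟩
    have d := (G.reedyLeft (cofibrations M)).factorizationData (G.reedyRight (cofibrations M)) p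
    have hi : G.reedyLeft (trivialCofibrations M) d.i := by
      rw [reedyLeft_trivialCofibrations G hG]
      refine ⟨d.hi, MorphismProperty.of_postcomp _ d.i d.p (hW _ d.hp) ?_⟩
      rw [d.fac]
      exact hp₂
    have := MorphismProperty.hasLiftingProperty_of_wfs d.i p hi hp₁
    exact MorphismProperty.of_retract (RetractArrow.ofRightLiftingProperty d.fac) d.hp

/-- The Reedy model structure on the category of diagrams. -/
noncomputable abbrev reedyModelCategory (hG : G.IsDualizable)
    (hM : G.IsInjectiveModelCategory M) : ModelCategory (R ⥤ M) :=
  letI : CategoryWithFibrations (R ⥤ M) := ⟨G.reedyRight (trivialCofibrations M)⟩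
  letI : CategoryWithCofibrations (R ⥤ M) := ⟨G.reedyLeft (cofibrations M)⟩
  letI : CategoryWithWeakEquivalences (R ⥤ M) := ⟨(weakEquivalences M).functorCategory R⟩
  haveI : (weakEquivalences (R ⥤ M)).HasTwoOutOfThreeProperty :=
    inferInstanceAs ((weakEquivalences M).functorCategory R).HasTwoOutOfThreeProperty
  haveI : (cofibrations (R ⥤ M)).IsWeakFactorizationSystem (trivialFibrations (R ⥤ M)) := by
    change (G.reedyLeft (cofibrations M)).IsWeakFactorizationSystem
      (G.reedyRight (trivialCofibrations M) ⊓ (weakEquivalences M).functorCategory R)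
    rw [← G.reedyRight_cofibrations hG hM]
    exact G.isWeakFactorizationSystem_cofibrations hM
  haveI : (trivialCofibrations (R ⥤ M)).IsWeakFactorizationSystem (fibrations (R ⥤ M)) := by
    change (G.reedyLeft (cofibrations M) ⊓
      (weakEquivalences M).functorCategory R).IsWeakFactorizationSystem
      (G.reedyRight (trivialCofibrations M))
    rw [← G.reedyLeft_trivialCofibrations hG]
    exact G.isWeakFactorizationSystem_trivialCofibrations hM
  .mk' _

end GeneralizedReedyStructure

end GenReedy

theorem theorem5p15 {R : Type w} [SmallCategory.{w} R] (G : GenReedy.GeneralizedReedyStructure R)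
    (hG : G.IsDualizable) {M : Type u} [Category.{v} M] [HasLimitsOfSize.{w, w} M]
    [HasColimitsOfSize.{w, w} M] [ModelCategory M] (hM : G.IsInjectiveModelCategory M)
    (X Z : MorphismProperty M) (hXZ : GenReedy.IsFibrantlyGenerated M X Z) :
    ∃ _ : ModelCategory (R ⥤ M), G.IsReedyModelStructure M ∧
      GenReedy.IsFibrantlyGenerated (R ⥤ M) (G.pullbackCotensors X) (G.pullbackCotensors Z) := by
  let := G.reedyModelCategory hG hM
  refine ⟨this, ⟨fun τ ↦ ?_, fun τ ↦ ?_, fun τ ↦ Iff.rfl⟩, ⟨?_, ?_⟩⟩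
  · exact ⟨fun h r _ ↦ h r, fun h r ↦ h r (SingleObj.star _)⟩
  · exact ⟨fun h r _ ↦ h r, fun h r ↦ h r (SingleObj.star _)⟩
  · rw [← G.reedyLeft_llp, ← hXZ.trivialCofibrations_eq]
    exact (G.reedyLeft_trivialCofibrations hG).symm
  · rw [← G.reedyLeft_llp, ← hXZ.cofibrations_eq]
    rfl
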